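/- Let $n\ge 1$, $0<s<1$, $a=1-2s$, and let $\mu,\lambda\in\mathbb R$ satisfy $\mu\ge\delta_0$ and $2\mu+\lambda\ge\delta_0$ for some $\delta_0>0$. Let $\mathbb L\mathbf u=\mu\Delta\mathbf u+(\mu+\lambda)\nabla\operatorname{div}\mathbf u$ be the Lamé operator on $\mathbb R^n$. Write $\hat f(\xi,\sigma)$ for the Fourier transform of $f(x,t)$ on $\mathbb R^n\times\mathbb R$. For $r\in\mathbb R$ let $$\|f\|_{H^r}^2=\int_{\mathbb R^{n+1}}\bigl(1+\bigl||\xi|^2+i\sigma\bigr|^2\bigr)^{r/2}|\hat f(\xi,\sigma)|^2\,d\xi\,d\sigma$$ be the parabolic Sobolev norm (of $\mathbb C^n$-valued tempered distributions whose Fourier transform is a function), and for $r \geq 0$ let $H^r$ be the space of all $f\in L^2(\mathbb R^{n+1};\mathbb C^n)$ with $\|f\|_{H^r}<\infty$ (it contains the $\mathbb R^n$-valued ones). For $\mathbf u\in H^s$ the tempered distribution $\mathbb H^s\mathbf u=(\partial_t-\mathbb L)^s\mathbf u$ is defined by $\widehat{\mathbb H^s\mathbf u}=A^s\hat{\mathbf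 u}$, where $$A^s(\xi,\sigma)=(\mu|\xi|^2+i\sigma)^s I_n+\bigl(((2\mu+\lambda)|\xi|^2+i\sigma)^s-(\mu|\xi|^2+i\sigma)^s\bigr)\frac{\xi\otimes\xi}{|\xi|^2}$$ (principal branch of the powers). Let $\mathbf W(x,t)$, $t>0$, be the heat kernel of $\mathbb L$, i.e. the matrix-valued function whose Fourier transform in $x$ is $e^{-t(\mu|\xi|^2I_n+(\mu+\lambda)\xi\otimes\xi)}$, and for $y,t>0$ let $$\mathbf P^{(a)}_y(x,z,t)=\frac{1}{2^{2s}\Gamma(s)}\frac{y^{2s}}{t^{1+s}}e^{-\frac{y^2}{4t}}\,\mathbf W(x-z,t).$$ There is a constant $C$ depending only on $n,s,\mu,\lambda$ such that the following holds for every $\mathbf u\in H^s$. For $x\in\mathbb R^n$, $y>0$, $t\in\mathbb R$ the integral $$\tilde{\mathbf u}(x,y,t)=\int_0^\infty\int_{\mathbb R^n}\mathbf P^{(a)}_y(x,z,\tau)\,\mathbf u(z,t-\tau)\,dz\,d\tau$$ converges absolutely; $\tilde{\mathbf u}$ is a $C^2$ function on $\{y>0\}$ that satisfies there $$\partial_t\tilde{\mathbf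 u}=\Bigl(\partial_y^2+\frac ay\partial_y+\mathbb L\Bigr)\tilde{\mathbf u}.$$ It has the boundary value $\mathbf u$ at $y=0$ in the following sense: $\tilde{\mathbf u}(\cdot,y,\cdot)\in H^s$ for every $y>0$ and $$\|\tilde{\mathbf u}(\cdot,y,\cdot)-\mathbf u\|_{H^s}\to0\quad\text{as }y\to0+ .$$ Moreover $\partial_y\tilde{\mathbf u}(\cdot,y,\cdot)\in L^2(\mathbb R^{n+1})$ for every $y>0$, $\|\mathbb H^s\mathbf u\|_{H^{-s}}<\infty$, and $$\Bigl\|\frac{2^{2s-1}\Gamma(s)}{\Gamma(1-s)}\,y^a\partial_y\tilde{\mathbf u}(\cdot,y,\cdot)+\mathbb H^s\mathbf u\Bigr\|_{H^{-s}}\to0\quad\text{as }y\to0+ .$$ Finally, $$\int_0^M\int_{\mathbb R^{n+1}}y^a|\tilde{\mathbf u}|^2\,dx\,dt\,dy\le C\,M^{1+a}\|\mathbf u\|_{L^2(\mathbb R^{n+1})}^2\quad\text{for every }M>0,$$ $$\int_0^\infty\int_{\mathbb R^{n+1}}y^a|\nabla_{x,y}\tilde{\mathbf u}|^2\,dx\,dt\,dy\le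 C\,\|\mathbf u\|_{H^s}^2 .$$ -/

import Mathlib

open MeasureTheory Set Filter Topology
open scoped ENNReal NNReal SchwartzMap FourierTransform Laplacian Matrix

noncomputable section

namespace Lame

/-- Euclidean space `ℝⁿ` (points `x`, frequencies `ξ`). -/
abbrev Space (n : ℕ) : Type := EuclideanSpace ℝ (Fin n)

/-- Values `ℂⁿ` of the vector fields; `ℝⁿ`-valued fields are a special case. -/
abbrev Val (n : ℕ) : Type := EuclideanSpace ℂ (Fin n)

/-- Space-time `ℝⁿ × ℝ` with its Euclidean structure and Lebesgue measure. A point `p` has space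
component `p.fst` and time component `p.snd`; a frequency `ζ` has components `ξ = ζ.fst` and
`σ = ζ.snd`. -/
abbrev SpaceTime (n : ℕ) : Type := WithLp 2 (Space n × ℝ)

variable {n : ℕ}

/-- A complex matrix acting on a vector of `ℂⁿ`. -/
def act (A : Matrix (Fin n) (Fin n) ℂ) (v : Val n) : Val n :=
  WithLp.toLp 2 (A *ᵥ v.ofLp)

/-! ### The Lamé operator -/

/-- The divergence `∑ⱼ ∂ⱼ fⱼ` of a vector field. -/
def divergence (f : Space n → Val n) (x : Space n) : ℂ :=
  ∑ j, (fderiv ℝ f x (EuclideanSpace.single j 1)) j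

/-- The gradient `(∂₁ g, …, ∂ₙ g)` of a complex-valued function. -/
def grad (g : Space n → ℂ) (x : Space n) : Val n :=
  WithLp.toLp 2 fun i => fderiv ℝ g x (EuclideanSpace.single i 1)

/-- The Lamé operator `𝕃 f = μ Δ f + (μ + lam) ∇ div f`. -/
def lameOp (μ lam : ℝ) (f : Space n → Val n) (x : Space n) : Val n :=
  μ • Δ f x + (μ + lam) • grad (divergence f) x

/-! ### Heat kernel, Poisson kernel and the extension

Mathlib's Fourier transform is `𝓕 f ζ = ∫ e^{-2πi⟨x, ζ⟩} f x dx`. Hence the transform with kernel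
`e^{-i⟨x, ξ⟩}` at `ξ = 2πζ` is `𝓕 f ζ`, and symbols in the variable `ξ` are evaluated at `2πζ`. -/

/-- The symbol `μ|ξ|² I + (μ + lam) ξ ⊗ ξ` of `-𝕃`. -/
def lameSymbol (μ lam : ℝ) (ξ : Space n) : Matrix (Fin n) (Fin n) ℂ :=
  Matrix.of fun j k =>
    (((if j = k then μ * ‖ξ‖ ^ 2 else 0) + (μ + lam) * (ξ j * ξ k) : ℝ) : ℂ)

/-- The heat kernel of `𝕃` at time `t > 0`, i.e. the convolution kernel of the semigroup `e^{t𝕃}`: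
its Fourier transform in `x` is `exp (-t (μ|ξ|² I + (μ + lam) ξ ⊗ ξ))`. -/
def heatKernel (μ lam : ℝ) (x : Space n) (t : ℝ) : Matrix (Fin n) (Fin n) ℂ :=
  Matrix.of fun j k =>
    𝓕⁻ (fun ζ : Space n =>
      (NormedSpace.exp (-(t : ℂ) • lameSymbol μ lam ((2 * Real.pi) • ζ))) j k) x

/-- The Poisson kernel `(2^{2s} Γ(s))⁻¹ (y^{2s} / t^{1+s}) e^{-y²/(4t)} W(x - z, t)`. -/
def poissonKernel (μ lam s y : ℝ) (x z : Space n) (t : ℝ) : Matrix (Fin n) (Fin n) ℂ :=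
  ((1 / ((2 : ℝ) ^ (2 * s) * Real.Gamma s) * (y ^ (2 * s) / t ^ (1 + s)) *
    Real.exp (-(y ^ 2) / (4 * t)) : ℝ) : ℂ) • heatKernel μ lam (x - z) t

/-- The integrand `P_y(x, z, τ) u(z, t - τ)` of the Poisson representation. -/
def poissonIntegrand (μ lam s : ℝ) (u : SpaceTime n → Val n) (x : Space n) (y t : ℝ)
    (τ : ℝ) (z : Space n) : Val n :=
  act (poissonKernel μ lam s y x z τ) (u (WithLp.toLp 2 (z, t - τ)))

/-- The extension `ũ(x, y, t) = ∫₀^∞ ∫_{ℝⁿ} P_y(x, z, τ) u(z, t - τ) dz dτ`. -/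
def extension (μ lam s : ℝ) (u : SpaceTime n → Val n) (x : Space n) (y t : ℝ) : Val n :=
  ∫ τ in Ioi (0 : ℝ), ∫ z : Space n, poissonIntegrand μ lam s u x y t τ z

/-- `U(x, y, t)` is a classical (`C²`) solution of
`∂ₜ U = (∂_y² + (a / y) ∂_y + 𝕃) U` in `{y > 0}`, with `a = 1 - 2 s`. -/
def SolvesExtensionEquation (μ lam s : ℝ) (U : Space n → ℝ → ℝ → Val n) : Prop :=
  ContDiffOn ℝ 2 (fun q : Space n × ℝ × ℝ => U q.1 q.2.1 q.2.2) {q | 0 < q.2.1} ∧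
  ∀ (x : Space n) (y t : ℝ), 0 < y →
    deriv (fun t' => U x y t') t =
      iteratedDeriv 2 (fun y' => U x y' t) y
        + ((1 - 2 * s) / y) • deriv (fun y' => U x y' t) y
        + lameOp μ lam (fun x' => U x' y t) x

/-- `|∇_{x,y} U|²` at `(x, y, t)`, as an extended nonnegative real. -/
def gradSq (U : Space n → ℝ → ℝ → Val n) (x : Space n) (y t : ℝ) : ℝ≥0∞ :=
  (∑ i, ‖fderiv ℝ (fun x' => U x' y t) x (EuclideanSpace.single i 1)‖ₑ ^ 2)
    + ‖deriv (fun y' => U x y' t) y‖ₑ ^ 2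

/-! ### Parabolic Sobolev spaces and fractional powers -/

open Classical in
/-- The tempered distribution defined by a function in `L²(ℝⁿ⁺¹; ℂⁿ)` (only used for such). -/
def toDist (f : SpaceTime n → Val n) : 𝓢'(SpaceTime n, Val n) :=
  if h : MemLp f 2 volume then Lp.toTemperedDistribution (h.toLp f) else 0

open Classical in
/-- The Fourier(-Plancherel) transform of a function in `L²(ℝⁿ⁺¹; ℂⁿ)` (only used for such). -/
def fourierL2 (f : SpaceTime n → Val n) : SpaceTime n → Val n :=
  if h : MemLp f 2 volume then ⇑(𝓕 (h.toLp f) : Lp (Val n) 2 (volume : Measure (SpaceTime n)))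
  else 0

/-- The Fourier transform of the tempered distribution `T` is the function `g`. Such a `g` is
unique up to null sets. -/
def HasFourierDensity (T : 𝓢'(SpaceTime n, Val n)) (g : SpaceTime n → Val n) : Prop :=
  AEStronglyMeasurable g volume ∧
  ∀ φ : 𝓢(SpaceTime n, ℂ), Integrable (fun ζ => φ ζ • g ζ) volume ∧
    (𝓕 T : 𝓢'(SpaceTime n, Val n)) φ = ∫ ζ, φ ζ • g ζ

/-- The weight `1 + ||ξ|² + iσ|²` at the frequency `(ξ, σ) = 2πζ`. -/
def weight (ζ : SpaceTime n) : ℝ :=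
  1 + ‖((‖(2 * Real.pi) • ζ.fst‖ ^ 2 : ℝ) : ℂ) + Complex.I * ((2 * Real.pi * ζ.snd : ℝ) : ℂ)‖ ^ 2

/-- The norm of the parabolic Sobolev space `H^r(ℝⁿ⁺¹; ℂⁿ)`, `r ∈ ℝ`:
`‖T‖² = ∫ (1 + ||ξ|² + iσ|²)^{r/2} |T̂|²`. It is `∞` if `T̂` is not a function. -/
def sobolevNorm (r : ℝ) (T : 𝓢'(SpaceTime n, Val n)) : ℝ≥0∞ :=
  ⨅ (g : SpaceTime n → Val n) (_ : HasFourierDensity T g),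
    (∫⁻ ζ, ENNReal.ofReal (weight ζ ^ (r / 2)) * ‖g ζ‖ₑ ^ 2) ^ (1 / 2 : ℝ)

/-- `u ∈ H^s`, for `s ≥ 0`: `u` is in `L²` and has finite `H^s` norm. -/
def MemH (s : ℝ) (u : SpaceTime n → Val n) : Prop :=
  MemLp u 2 volume ∧ sobolevNorm s (toDist u) < ⊤

/-- The fractional power `A^s` of the symbol
`A(ξ, σ) = (μ|ξ|² + iσ) I + (μ + lam) ξ ⊗ ξ` of `ℍ = ∂ₜ - 𝕃`: the matrix with eigenvalue
`((2μ + lam)|ξ|² + iσ)^s` on the line of `ξ` and `(μ|ξ|² + iσ)^s` on its orthogonal complement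
(principal branch). -/
def fracSymbol (μ lam s : ℝ) (ξ : Space n) (σ : ℝ) : Matrix (Fin n) (Fin n) ℂ :=
  (((μ * ‖ξ‖ ^ 2 : ℝ) : ℂ) + Complex.I * (σ : ℂ)) ^ (s : ℂ) • (1 : Matrix (Fin n) (Fin n) ℂ)
    + (((((2 * μ + lam) * ‖ξ‖ ^ 2 : ℝ) : ℂ) + Complex.I * (σ : ℂ)) ^ (s : ℂ)
        - (((μ * ‖ξ‖ ^ 2 : ℝ) : ℂ) + Complex.I * (σ : ℂ)) ^ (s : ℂ)) •
      Matrix.of fun j k => ((ξ j * ξ k / ‖ξ‖ ^ 2 : ℝ) : ℂ)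

/-- The tempered distribution `T` is `ℍ^s u`, i.e. its Fourier transform is `A^s(ξ, σ) û(ξ, σ)`. -/
def IsFracPower (μ lam s : ℝ) (u : SpaceTime n → Val n) (T : 𝓢'(SpaceTime n, Val n)) : Prop :=
  HasFourierDensity T fun ζ =>
    act (fracSymbol μ lam s ((2 * Real.pi) • ζ.fst) (2 * Real.pi * ζ.snd)) (fourierL2 u ζ)

end Lame

end

noncomputable section

namespace Lame

/-! ### The subordination kernel and its Laplace transform -/

/-! Write K_ν(y, τ) = τ^{-1-ν} e^{-y²/(4τ)} and L_ν(y, z) = ∫₀^∞ K_ν(y, τ) e^{-τz} dτ (`subKernel`,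
`subLaplace`). The Lamé symbol has the eigenvalue μ|ξ|² on the complement of ξ and (2μ+λ)|ξ|² on the
line of ξ. Hence the space-time Fourier transform of the Poisson kernel acts on the two eigenspaces
by the scalar multiplier m_y(z) = c y^{2s} L_s(y, z), taken at z = κ|ξ|² + iσ with κ = μ and κ =
2μ+λ. Since n ≥ 1, Re z > 0 at almost every frequency. The whole theorem thus reduces to facts about
m_y and ∂_y m_y on the open right half-plane. The estimates have to be in terms of |z|, because z
comes arbitrarily close to the imaginary axis.

Two identities drive everything: ∂_y L_ν = -(y/2) L_{ν+1} (`hasDerivAt_subLaplace`) and, by parts in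
τ, z L_ν = -(1+ν) L_{ν+1} + (y²/4) L_{ν+2} (`mul_subLaplace`). Iterating the second shows that L_ν
decays faster than any power of |z|, locally uniformly in y > 0. Consequently the kernel at fixed
height has a transform in L¹ ∩ L². Its convolution with u ∈ L² converges absolutely and is an
inverse Fourier integral (`poisson_representation`), which may be differentiated under the integral
sign (`contDiffOn_invFourier`). Combined, the two identities say that the Bessel operator ∂_y² +
(a/y)∂_y multiplies by z on m_y, and this is the extension equation (`solvesExtensionEquation`).

Trace: by scaling m_y(z) = c L_s(1, y²z), the kernel has mass one, so |m_y| ≤ 1 and m_y → 1;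
dominated convergence in frequency does the rest. Neumann condition: the identity at ν = s-1 gives
∂_y m_y = -2c y^{2s-1} z L_{s-1}(y, z). Here L_{s-1}(y, z) → Γ(1-s) z^{s-1} as y → 0, by Euler's
integral with complex parameter (`tendsto_subLaplace_zero`), and |w L_{s-1}(1, w)| ≤ C|w|^s
(`exists_norm_mul_subLaplace_le_rpow`) provides the dominating function for the H^{-s} norm.

Energy: by Plancherel and Tonelli it suffices to bound ∫ y^a (|z||m_y|² + |∂_y m_y|²) dy by C|z|^s
for each z. The integral is split at y = |z|^{-1/2}, with the bounds 1 and C y^{2s-1}|z|^s below and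
the decay bounds above (`exists_lintegral_energyMul_le`). -/

/-- The kernel `τ^{-1-ν} e^{-y²/(4τ)}`. -/
def subKernel (ν y τ : ℝ) : ℝ := τ ^ (-1 - ν) * Real.exp (-(y ^ 2) / (4 * τ))

/-- The Laplace transform of the subordination kernel; up to elementary factors this is the
Macdonald function. -/
def subLaplace (ν y : ℝ) (z : ℂ) : ℂ :=
  ∫ τ in Ioi (0 : ℝ), (subKernel ν y τ : ℂ) * Complex.exp (-(τ * z))

lemma subKernel_nonneg (ν y : ℝ) {τ : ℝ} (hτ : 0 < τ) : 0 ≤ subKernel ν y τ := by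
  unfold subKernel; positivity

lemma measurable_subKernel (ν y : ℝ) : Measurable (subKernel ν y) := by
  unfold subKernel; fun_prop

/-- The integrand produced by the substitution τ ↦ τ⁻¹, which turns the total mass of the kernel
into Euler's integral for Γ(ν). -/
lemma subKernel_eq_comp (ν y : ℝ) {τ : ℝ} (hτ : 0 < τ) :
    (|(-1 : ℝ)| * τ ^ ((-1 : ℝ) - 1)) •
      ((τ ^ (-1 : ℝ)) ^ (ν - 1) * Real.exp (-(y ^ 2 / 4 * τ ^ (-1 : ℝ)))) = subKernel ν y τ := by
  unfold subKernel
  rw [← Real.rpow_mul hτ.le, abs_neg, abs_one, one_mul, smul_eq_mul, ← mul_assoc,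
    ← Real.rpow_add hτ, Real.rpow_neg_one]
  congr 2
  · ring
  · field_simp

lemma integral_subKernel {ν y : ℝ} (hν : 0 < ν) (hy : 0 < y) :
    ∫ τ in Ioi (0 : ℝ), subKernel ν y τ = (4 / y ^ 2) ^ ν * Real.Gamma ν := by
  have h := integral_comp_rpow_Ioi
    (fun t : ℝ => t ^ (ν - 1) * Real.exp (-(y ^ 2 / 4 * t))) (p := -1) (by norm_num)
  rw [Real.integral_rpow_mul_exp_neg_mul_Ioi hν (by positivity)] at h
  rw [show (4 / y ^ 2 : ℝ) = 1 / (y ^ 2 / 4) by field_simp, ← h]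
  exact setIntegral_congr_fun measurableSet_Ioi fun τ hτ => (subKernel_eq_comp ν y hτ).symm

lemma integral_subKernel_pos {ν y : ℝ} (hν : 0 < ν) (hy : 0 < y) :
    0 < ∫ τ in Ioi (0 : ℝ), subKernel ν y τ := by
  rw [integral_subKernel hν hy]
  have := Real.Gamma_pos_of_pos hν
  positivity

lemma integrableOn_subKernel {ν y : ℝ} (hν : 0 < ν) (hy : 0 < y) :
    IntegrableOn (subKernel ν y) (Ioi 0) :=
  -- A non-integrable function has integral zero by convention, so a nonzero value proves
  -- integrability.
  .of_integral_ne_zero (integral_subKernel_pos hν hy).ne'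

lemma norm_subKernel_mul_exp (ν y : ℝ) (z : ℂ) {τ : ℝ} (hτ : 0 < τ) :
    ‖(subKernel ν y τ : ℂ) * Complex.exp (-(τ * z))‖
      = subKernel ν y τ * Real.exp (-(τ * z.re)) := by
  rw [norm_mul, Complex.norm_real, Real.norm_of_nonneg (subKernel_nonneg ν y hτ),
    Complex.norm_exp]
  simp

lemma norm_subKernel_mul_exp_le (ν y : ℝ) {z : ℂ} (hz : 0 ≤ z.re) {τ : ℝ} (hτ : 0 < τ) :
    ‖(subKernel ν y τ : ℂ) * Complex.exp (-(τ * z))‖ ≤ subKernel ν y τ := by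
  rw [norm_subKernel_mul_exp ν y z hτ]
  refine mul_le_of_le_one_right (subKernel_nonneg ν y hτ) (Real.exp_le_one_iff.2 ?_)
  have := mul_nonneg hτ.le hz
  linarith

lemma aestronglyMeasurable_subKernel_mul_exp (ν y : ℝ) (z : ℂ) (m : Measure ℝ) :
    AEStronglyMeasurable (fun τ : ℝ => (subKernel ν y τ : ℂ) * Complex.exp (-(τ * z))) m := by
  have := measurable_subKernel ν y
  exact Measurable.aestronglyMeasurable (by fun_prop)

lemma integrableOn_subKernel_mul_exp {ν y : ℝ} (hν : 0 < ν) (hy : 0 < y) {z : ℂ}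
    (hz : 0 ≤ z.re) :
    IntegrableOn (fun τ : ℝ => (subKernel ν y τ : ℂ) * Complex.exp (-(τ * z))) (Ioi 0) := by
  refine (integrableOn_subKernel hν hy).mono' (aestronglyMeasurable_subKernel_mul_exp ν y z _) ?_
  filter_upwards [ae_restrict_mem measurableSet_Ioi] with τ hτ
  exact norm_subKernel_mul_exp_le ν y hz hτ

lemma norm_subLaplace_le {ν y : ℝ} (hν : 0 < ν) (hy : 0 < y) {z : ℂ} (hz : 0 ≤ z.re) :
    ‖subLaplace ν y z‖ ≤ (4 / y ^ 2) ^ ν * Real.Gamma ν := by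
  rw [← integral_subKernel hν hy]
  refine norm_integral_le_of_norm_le (integrableOn_subKernel hν hy) ?_
  filter_upwards [ae_restrict_mem measurableSet_Ioi] with τ hτ
  exact norm_subKernel_mul_exp_le ν y hz hτ

lemma subKernel_add_one (ν y : ℝ) {τ : ℝ} (hτ : 0 < τ) :
    subKernel (ν + 1) y τ = subKernel ν y τ / τ := by
  unfold subKernel
  rw [show -1 - (ν + 1) = (-1 - ν) - 1 by ring, Real.rpow_sub_one hτ.ne']
  ring

/-- For `Re z > 0` the Laplace integral also converges for `-1 < ν ≤ 0`. -/
lemma integrableOn_subKernel_mul_exp' {ν y : ℝ} (hν : -1 < ν) (hy : 0 < y) {z : ℂ}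
    (hz : 0 < z.re) :
    IntegrableOn (fun τ : ℝ => (subKernel ν y τ : ℂ) * Complex.exp (-(τ * z))) (Ioi 0) := by
  refine ((integrableOn_subKernel (ν := ν + 1) (by linarith) hy).mul_const (1 / z.re)).mono'
    (aestronglyMeasurable_subKernel_mul_exp ν y z _) ?_
  filter_upwards [ae_restrict_mem measurableSet_Ioi] with τ hτ
  have hτ' : 0 < τ := hτ
  rw [norm_subKernel_mul_exp ν y z hτ, subKernel_add_one ν y hτ, div_mul_eq_mul_div, mul_div_assoc]
  refine mul_le_mul_of_nonneg_left ?_ (subKernel_nonneg ν y hτ)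
  -- The bound e^{-x} ≤ 1/x at x = τ Re z supplies a factor 1/τ, which raises ν by one and restores
  -- decay at infinity.
  rw [Real.exp_neg, div_div, one_div]
  refine inv_anti₀ (by positivity) ?_
  have := Real.add_one_le_exp (τ * z.re)
  linarith [mul_comm τ z.re]

lemma tendsto_subKernel_zero (ν : ℝ) {y : ℝ} (hy : 0 < y) :
    Tendsto (subKernel ν y) (𝓝[>] 0) (𝓝 0) := by
  have h := (tendsto_rpow_mul_exp_neg_mul_atTop_nhds_zero (1 + ν) (y ^ 2 / 4)
    (by positivity)).comp tendsto_inv_nhdsGT_zero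
  refine h.congr' ?_
  filter_upwards [self_mem_nhdsWithin] with τ hτ
  have hτ' : 0 < τ := hτ
  simp only [Function.comp, subKernel]
  rw [Real.inv_rpow hτ'.le, ← Real.rpow_neg hτ'.le]
  congr 2
  · ring
  · field_simp

lemma tendsto_subKernel_atTop {ν : ℝ} (hν : -1 < ν) (y : ℝ) :
    Tendsto (subKernel ν y) atTop (𝓝 0) := by
  refine squeeze_zero' ?_ ?_ (tendsto_rpow_neg_atTop (y := 1 + ν) (by linarith))
  · filter_upwards [eventually_gt_atTop 0] with τ hτ using subKernel_nonneg ν y hτ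
  · filter_upwards [eventually_gt_atTop 0] with τ hτ
    unfold subKernel
    rw [show -(1 + ν) = -1 - ν by ring]
    refine mul_le_of_le_one_right (by positivity) (Real.exp_le_one_iff.2 ?_)
    rw [neg_div]
    exact neg_nonpos.2 (by positivity)

lemma hasDerivAt_subKernel (ν y : ℝ) {τ : ℝ} (hτ : 0 < τ) :
    HasDerivAt (subKernel ν y)
      (-(1 + ν) * subKernel (ν + 1) y τ + y ^ 2 / 4 * subKernel (ν + 2) y τ) τ := by
  have h1 := Real.hasDerivAt_rpow_const (x := τ) (p := -1 - ν) (Or.inl hτ.ne')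
  have h2 : HasDerivAt (fun τ : ℝ => -(y ^ 2) / (4 * τ)) (y ^ 2 / (4 * τ ^ 2)) τ := by
    have h3 := ((hasDerivAt_id τ).const_mul (4 : ℝ)).inv (by simpa using hτ.ne')
    convert! h3.const_mul (-(y ^ 2)) using 1
    simp only [id]
    field_simp
  refine (h1.mul h2.exp).congr_deriv ?_
  have e2 : subKernel (ν + 2) y τ = subKernel ν y τ / τ ^ 2 := by
    rw [show ν + 2 = (ν + 1) + 1 by ring, subKernel_add_one _ _ hτ, subKernel_add_one _ _ hτ]
    field_simp
  rw [e2, subKernel_add_one ν y hτ, Real.rpow_sub_one hτ.ne']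
  unfold subKernel
  field_simp
  ring

/-- Integration by parts in the Laplace integral. -/
lemma mul_subLaplace {ν y : ℝ} (hν : -1 < ν) (hy : 0 < y) {z : ℂ} (hz : 0 < z.re) :
    z * subLaplace ν y z
      = -(1 + ν) * subLaplace (ν + 1) y z + y ^ 2 / 4 * subLaplace (ν + 2) y z := by
  have hu : ∀ τ ∈ Ioi (0 : ℝ), HasDerivAt (fun τ : ℝ => (subKernel ν y τ : ℂ))
      ((-(1 + ν) * subKernel (ν + 1) y τ + y ^ 2 / 4 * subKernel (ν + 2) y τ : ℝ) : ℂ) τ :=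
    fun τ hτ => (hasDerivAt_subKernel ν y hτ).ofReal_comp
  have hv : ∀ τ ∈ Ioi (0 : ℝ), HasDerivAt (fun τ : ℝ => Complex.exp (-(τ * z)))
      (-z * Complex.exp (-(τ * z))) τ := by
    intro τ _
    have h := ((Complex.ofRealCLM.hasDerivAt (x := τ)).mul_const z).fun_neg.cexp
    refine h.congr_deriv ?_
    simp only [Complex.ofRealCLM_apply, Complex.ofReal_one]
    ring
  have i0 := integrableOn_subKernel_mul_exp' hν hy hz
  have i1 := integrableOn_subKernel_mul_exp (ν := ν + 1) (by linarith) hy hz.le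
  have i2 := integrableOn_subKernel_mul_exp (ν := ν + 2) (by linarith) hy hz.le
  have e1 : ∀ τ : ℝ, ((-(1 + ν) * subKernel (ν + 1) y τ + y ^ 2 / 4 * subKernel (ν + 2) y τ : ℝ) : ℂ)
      * Complex.exp (-(τ * z)) = -(1 + ν) * ((subKernel (ν + 1) y τ : ℂ) * Complex.exp (-(τ * z)))
        + y ^ 2 / 4 * ((subKernel (ν + 2) y τ : ℂ) * Complex.exp (-(τ * z))) := by
    intro τ; push_cast; ring
  -- The boundary terms vanish: at 0 because of the factor e^{-y²/(4τ)}, at infinity because ν > -1.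
  have key : ∀ l : Filter ℝ, (∀ᶠ τ in l, 0 < τ) → Tendsto (subKernel ν y) l (𝓝 0) →
      Tendsto ((fun τ : ℝ => (subKernel ν y τ : ℂ)) * fun τ : ℝ => Complex.exp (-(τ * z)))
        l (𝓝 0) := by
    intro l hl ht
    refine squeeze_zero_norm' ?_ ht
    filter_upwards [hl] with τ hτ using norm_subKernel_mul_exp_le ν y hz.le hτ
  have h := integral_Ioi_mul_deriv_eq_deriv_mul hu hv
    (by
      refine (i0.const_mul (-z)).congr (Eventually.of_forall fun τ => ?_)
      simp only [Pi.mul_apply]; ring)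
    (by
      refine ((i1.const_mul (-(1 + ν : ℂ))).add (i2.const_mul (y ^ 2 / 4 : ℂ))).congr
        (Eventually.of_forall fun τ => ?_)
      simp only [Pi.mul_apply, Pi.add_apply, e1])
    (key _ self_mem_nhdsWithin (tendsto_subKernel_zero ν hy))
    (key _ (eventually_gt_atTop 0) (tendsto_subKernel_atTop hν y))
  simp only [e1, sub_zero, zero_sub] at h
  rw [integral_add (i1.const_mul _) (i2.const_mul _), integral_const_mul, integral_const_mul] at h
  have h' : ∫ τ in Ioi (0 : ℝ), (subKernel ν y τ : ℂ) * (-z * Complex.exp (-(τ * z)))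
      = -z * subLaplace ν y z := by
    rw [subLaplace, ← integral_const_mul]
    congr 1; ext τ; ring
  rw [h'] at h
  rw [subLaplace.eq_def (ν + 1), subLaplace.eq_def (ν + 2)]
  linear_combination -h

/-- Each factor |z| is absorbed by one integration by parts, at the price of replacing ν by ν+1 and
ν+2; hence the induction keeps ν general. The constant does not see Re z, so the decay is uniform up
to the imaginary axis. -/
lemma exists_norm_pow_mul_subLaplace_le {a b : ℝ} (ha : 0 < a) (k : ℕ) {ν : ℝ} (hν : 0 < ν) :
    ∃ C : ℝ, 0 ≤ C ∧ ∀ y ∈ Icc a b, ∀ z : ℂ, 0 < z.re → ‖z‖ ^ k * ‖subLaplace ν y z‖ ≤ C := by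
  induction k generalizing ν with
  | zero =>
    refine ⟨(4 / a ^ 2) ^ ν * Real.Gamma ν, ?_, fun y hy z hz => ?_⟩
    · have := Real.Gamma_pos_of_pos hν
      positivity
    · have hy0 : 0 < y := ha.trans_le hy.1
      rw [pow_zero, one_mul]
      refine (norm_subLaplace_le hν hy0 hz.le).trans ?_
      have := Real.Gamma_pos_of_pos hν
      have := hy.1
      gcongr
  | succ k ih =>
    obtain ⟨C1, h1, H1⟩ := ih (ν := ν + 1) (by linarith)
    obtain ⟨C2, h2, H2⟩ := ih (ν := ν + 2) (by linarith)
    refine ⟨(1 + ν) * C1 + b ^ 2 / 4 * C2, by positivity, fun y hy z hz => ?_⟩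
    have hy0 : 0 < y := ha.trans_le hy.1
    calc ‖z‖ ^ (k + 1) * ‖subLaplace ν y z‖ = ‖z‖ ^ k * ‖z * subLaplace ν y z‖ := by
          rw [norm_mul]; ring
      _ ≤ ‖z‖ ^ k * ((1 + ν) * ‖subLaplace (ν + 1) y z‖
            + y ^ 2 / 4 * ‖subLaplace (ν + 2) y z‖) := by
          rw [mul_subLaplace (by linarith) hy0 hz]
          gcongr
          refine (norm_add_le _ _).trans (le_of_eq ?_)
          have e : ‖(1 + ν : ℂ)‖ = 1 + ν := by
            rw [show (1 + ν : ℂ) = ((1 + ν : ℝ) : ℂ) by push_cast; ring, Complex.norm_real,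
              Real.norm_of_nonneg (by linarith)]
          simp only [norm_mul, norm_neg, e, norm_div, norm_pow, Complex.norm_real,
            Real.norm_of_nonneg hy0.le]
          norm_num
      _ = (1 + ν) * (‖z‖ ^ k * ‖subLaplace (ν + 1) y z‖)
            + y ^ 2 / 4 * (‖z‖ ^ k * ‖subLaplace (ν + 2) y z‖) := by ring
      _ ≤ _ := by
          have := H1 y hy z hz
          have := H2 y hy z hz
          have := hy.2
          gcongr

/-- Parabolic scaling. -/
lemma subLaplace_scale (ν : ℝ) {y : ℝ} (hy : 0 < y) (z : ℂ) :
    subLaplace ν y z = ((y ^ (-(2 * ν)) : ℝ) : ℂ) * subLaplace ν 1 (y ^ 2 * z) := by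
  have h := integral_comp_mul_left_Ioi' (fun τ : ℝ => (subKernel ν y τ : ℂ) * Complex.exp (-(τ * z)))
    0 (b := y ^ 2) (by positivity)
  rw [mul_zero] at h
  rw [subLaplace, ← h, subLaplace, ← integral_const_mul, ← integral_smul]
  refine setIntegral_congr_fun measurableSet_Ioi fun τ hτ => ?_
  have hτ' : 0 < τ := hτ
  have e : y ^ 2 * subKernel ν y (y ^ 2 * τ) = y ^ (-(2 * ν)) * subKernel ν 1 τ := by
    unfold subKernel
    have e1 : y ^ 2 * (y ^ 2) ^ (-1 - ν) = y ^ (-(2 * ν)) := by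
      rw [← Real.rpow_natCast y 2, ← Real.rpow_mul hy.le, ← Real.rpow_add hy]
      congr 1
      push_cast; ring
    have e2 : -(y ^ 2) / (4 * (y ^ 2 * τ)) = -(1 ^ 2) / (4 * τ) := by field_simp
    rw [Real.mul_rpow (by positivity) hτ'.le, e2, ← e1]
    ring
  simp only [Complex.real_smul]
  rw [← mul_assoc, ← mul_assoc, ← Complex.ofReal_mul, e]
  push_cast
  congr 2
  ring

lemma subKernel_antitone (ν : ℝ) {y y' τ : ℝ} (hy : 0 ≤ y) (h : y ≤ y') (hτ : 0 < τ) :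
    subKernel ν y' τ ≤ subKernel ν y τ := by
  unfold subKernel
  refine mul_le_mul_of_nonneg_left (Real.exp_le_exp.2 ?_) (by positivity)
  gcongr

lemma hasDerivAt_subKernel_left (ν y : ℝ) {τ : ℝ} (hτ : 0 < τ) :
    HasDerivAt (fun y => subKernel ν y τ) (-(y / 2) * subKernel (ν + 1) y τ) y := by
  have h := ((((hasDerivAt_id y).pow 2).neg.div_const (4 * τ)).exp).const_mul (τ ^ (-1 - ν))
  refine h.congr_deriv ?_
  rw [subKernel_add_one ν y hτ]
  unfold subKernel
  simp only [id, Pi.neg_apply, Pi.pow_apply]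
  field_simp
  norm_num
  ring

/-- Differentiation in y merely shifts ν, so the family of these Laplace transforms is closed under
∂_y. The domination on (y/2, 2y) uses that the kernel decreases in y and that y'/2 ≤ y there. -/
lemma hasDerivAt_subLaplace {ν y : ℝ} (hν : 0 < ν) (hy : 0 < y) {z : ℂ} (hz : 0 ≤ z.re) :
    HasDerivAt (fun y => subLaplace ν y z) (-(y / 2) * subLaplace (ν + 1) y z) y := by
  have h := hasDerivAt_integral_of_dominated_loc_of_deriv_le (μ := volume.restrict (Ioi (0 : ℝ)))
    (F := fun y τ => (subKernel ν y τ : ℂ) * Complex.exp (-(τ * z)))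
    (F' := fun y τ => -(y / 2) * ((subKernel (ν + 1) y τ : ℂ) * Complex.exp (-(τ * z))))
    (s := Ioo (y / 2) (2 * y)) (x₀ := y) (bound := fun τ => y * subKernel (ν + 1) (y / 2) τ)
    (Ioo_mem_nhds (by linarith) (by linarith))
    (Eventually.of_forall fun y' => aestronglyMeasurable_subKernel_mul_exp ν y' z _)
    (integrableOn_subKernel_mul_exp hν hy hz)
    ((aestronglyMeasurable_subKernel_mul_exp (ν + 1) y z _).const_mul _)
    ?_ ((integrableOn_subKernel (by linarith) (by linarith)).const_mul y) ?_
  · refine h.2.congr_deriv ?_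
    rw [integral_const_mul, subLaplace]
  · filter_upwards [ae_restrict_mem measurableSet_Ioi] with τ hτ y' hy'
    have hy0 : 0 < y' := by have := hy'.1; linarith
    rw [norm_mul]
    refine mul_le_mul ?_ ((norm_subKernel_mul_exp_le _ _ hz hτ).trans
      (subKernel_antitone _ (by linarith) hy'.1.le hτ)) (norm_nonneg _) hy.le
    rw [norm_neg, norm_div, Complex.norm_real, Real.norm_of_nonneg hy0.le]
    have := hy'.2
    norm_num
    linarith
  · filter_upwards [ae_restrict_mem measurableSet_Ioi] with τ hτ y' hy'
    refine ((hasDerivAt_subKernel_left ν y' hτ).ofReal_comp.mul_const _).congr_deriv ?_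
    push_cast
    ring

lemma stronglyMeasurable_subLaplace_integrand (ν : ℝ) :
    StronglyMeasurable fun p : (ℝ × ℂ) × ℝ =>
      (subKernel ν p.1.1 p.2 : ℂ) * Complex.exp (-((p.2 : ℂ) * p.1.2)) := by
  have h : Measurable fun p : (ℝ × ℂ) × ℝ => subKernel ν p.1.1 p.2 := by
    unfold subKernel
    fun_prop
  exact Measurable.stronglyMeasurable (by fun_prop)

/-- Joint measurability is what the exchange of the integrals in height and frequency in the energy
bound requires. -/
lemma stronglyMeasurable_subLaplace_uncurry (ν : ℝ) :
    StronglyMeasurable fun q : ℝ × ℂ => subLaplace ν q.1 q.2 := by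
  unfold subLaplace
  exact (stronglyMeasurable_subLaplace_integrand ν).integral_prod_right'
    (ν := volume.restrict (Ioi (0 : ℝ)))

lemma measurable_subLaplace (ν y : ℝ) : Measurable (subLaplace ν y) := by
  have h : Measurable fun z : ℂ => (y, z) := by fun_prop
  exact Measurable.comp (g := fun q : ℝ × ℂ => subLaplace ν q.1 q.2) (f := fun z : ℂ => (y, z))
    (stronglyMeasurable_subLaplace_uncurry ν).measurable h

/-! ### Euler's integral with a complex parameter. -/

lemma integrableOn_rpow_mul_exp {b x : ℝ} (hb : 0 < b) (hx : 0 < x) :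
    IntegrableOn (fun t : ℝ => t ^ (b - 1) * Real.exp (-(t * x))) (Ioi 0) := by
  refine .of_integral_ne_zero ?_
  have := Real.Gamma_pos_of_pos hb
  have h := Real.integral_rpow_mul_exp_neg_mul_Ioi hb hx
  simp only [mul_comm x] at h
  rw [h]
  positivity

lemma integrableOn_rpow_mul_cexp {b : ℝ} (hb : 0 < b) {z : ℂ} (hz : 0 < z.re) :
    IntegrableOn (fun t : ℝ => ((t ^ (b - 1) : ℝ) : ℂ) * Complex.exp (-(t * z))) (Ioi 0) := by
  refine (integrableOn_rpow_mul_exp hb hz).mono' (Measurable.aestronglyMeasurable (by fun_prop)) ?_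
  filter_upwards [ae_restrict_mem measurableSet_Ioi] with t ht
  have ht' : 0 < t := ht
  rw [norm_mul, Complex.norm_real, Real.norm_of_nonneg (by positivity), Complex.norm_exp]
  simp

lemma hasDerivAt_exp_neg_mul (z : ℂ) (τ : ℝ) :
    HasDerivAt (fun τ : ℝ => Complex.exp (-(τ * z))) (-z * Complex.exp (-(τ * z))) τ := by
  have h := ((Complex.ofRealCLM.hasDerivAt (x := τ)).mul_const z).fun_neg.cexp
  refine h.congr_deriv ?_
  simp only [Complex.ofRealCLM_apply, Complex.ofReal_one]
  ring

/-- Integration by parts; together with the derivative in z it yields the differential equation z F'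
= -b F for Euler's integral F. -/
lemma mul_integral_rpow_mul_cexp {b : ℝ} (hb : 0 < b) {z : ℂ} (hz : 0 < z.re) :
    z * ∫ t in Ioi (0 : ℝ), ((t ^ b : ℝ) : ℂ) * Complex.exp (-(t * z))
      = b * ∫ t in Ioi (0 : ℝ), ((t ^ (b - 1) : ℝ) : ℂ) * Complex.exp (-(t * z)) := by
  have i0 := integrableOn_rpow_mul_cexp hb hz
  have i1 := integrableOn_rpow_mul_cexp (b := b + 1) (by linarith) hz
  simp only [add_sub_cancel_right] at i1
  have hn : ∀ t : ℝ, 0 < t → ‖((t ^ b : ℝ) : ℂ) * Complex.exp (-(t * z))‖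
      = t ^ b * Real.exp (-z.re * t) := by
    intro t ht
    rw [norm_mul, Complex.norm_real, Real.norm_of_nonneg (by positivity), Complex.norm_exp]
    simp [mul_comm]
  have h := integral_Ioi_mul_deriv_eq_deriv_mul (a := 0) (a' := 0) (b' := 0)
    (u := fun t : ℝ => ((t ^ b : ℝ) : ℂ)) (u' := fun t : ℝ => ((b * t ^ (b - 1) : ℝ) : ℂ))
    (v := fun t : ℝ => Complex.exp (-(t * z))) (v' := fun t : ℝ => -z * Complex.exp (-(t * z)))
    (fun t ht => (Real.hasDerivAt_rpow_const (Or.inl (ne_of_gt ht))).ofReal_comp)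
    (fun t _ => hasDerivAt_exp_neg_mul z t)
    ((i1.const_mul (-z)).congr (Eventually.of_forall fun t => by
      simp only [Pi.mul_apply]; ring))
    ((i0.const_mul (b : ℂ)).congr (Eventually.of_forall fun t => by
      simp only [Pi.mul_apply]; push_cast; ring))
    ?_ ?_
  · have e1 : ∫ t in Ioi (0 : ℝ), ((t ^ b : ℝ) : ℂ) * (-z * Complex.exp (-(t * z)))
        = -z * ∫ t in Ioi (0 : ℝ), ((t ^ b : ℝ) : ℂ) * Complex.exp (-(t * z)) := by
      rw [← integral_const_mul]; congr 1; ext t; ring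
    have e2 : ∫ t in Ioi (0 : ℝ), ((b * t ^ (b - 1) : ℝ) : ℂ) * Complex.exp (-(t * z))
        = b * ∫ t in Ioi (0 : ℝ), ((t ^ (b - 1) : ℝ) : ℂ) * Complex.exp (-(t * z)) := by
      rw [← integral_const_mul]; congr 1; ext t; push_cast; ring
    rw [e1, e2] at h
    linear_combination -h
  · refine squeeze_zero_norm' (a := fun t : ℝ => t ^ b) ?_ ?_
    · filter_upwards [self_mem_nhdsWithin] with t ht
      have ht' : 0 < t := ht
      rw [Pi.mul_apply, hn t ht]
      refine mul_le_of_le_one_right (by positivity) (Real.exp_le_one_iff.2 ?_)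
      nlinarith [mul_pos hz ht']
    · have := (Real.continuousAt_rpow_const 0 b (Or.inr hb.le)).tendsto
      rw [Real.zero_rpow hb.ne'] at this
      exact this.mono_left nhdsWithin_le_nhds
  · refine squeeze_zero_norm' ?_ (tendsto_rpow_mul_exp_neg_mul_atTop_nhds_zero b z.re hz)
    filter_upwards [eventually_gt_atTop 0] with t ht
    exact (hn t ht).le

lemma hasDerivAt_integral_rpow_mul_cexp {b : ℝ} (hb : 0 < b) {z : ℂ} (hz : 0 < z.re) :
    HasDerivAt (fun z => ∫ t in Ioi (0 : ℝ), ((t ^ (b - 1) : ℝ) : ℂ) * Complex.exp (-(t * z)))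
      (-∫ t in Ioi (0 : ℝ), ((t ^ b : ℝ) : ℂ) * Complex.exp (-(t * z))) z := by
  have hS : {w : ℂ | z.re / 2 < w.re} ∈ 𝓝 z :=
    (isOpen_lt continuous_const Complex.continuous_re).mem_nhds (by simp; linarith)
  have i1 := integrableOn_rpow_mul_exp (b := b + 1) (x := z.re / 2) (by linarith) (by linarith)
  simp only [add_sub_cancel_right] at i1
  have h := hasDerivAt_integral_of_dominated_loc_of_deriv_le (μ := volume.restrict (Ioi (0 : ℝ)))
    (F := fun (z : ℂ) (t : ℝ) => ((t ^ (b - 1) : ℝ) : ℂ) * Complex.exp (-(t * z)))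
    (F' := fun (z : ℂ) (t : ℝ) => -(((t ^ b : ℝ) : ℂ) * Complex.exp (-(t * z))))
    (x₀ := z) (bound := fun t => t ^ b * Real.exp (-(t * (z.re / 2)))) hS
    (Eventually.of_forall fun _ => Measurable.aestronglyMeasurable (by fun_prop))
    (integrableOn_rpow_mul_cexp hb hz)
    (Measurable.aestronglyMeasurable (by fun_prop)) ?_ i1 ?_
  · exact h.2.congr_deriv (integral_neg _)
  · filter_upwards [ae_restrict_mem measurableSet_Ioi] with t ht w hw
    have ht' : 0 < t := ht
    rw [norm_neg, norm_mul, Complex.norm_real, Real.norm_of_nonneg (by positivity),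
      Complex.norm_exp]
    refine mul_le_mul_of_nonneg_left (Real.exp_le_exp.2 ?_) (by positivity)
    have hw' : z.re / 2 < w.re := hw
    simp
    nlinarith
  · filter_upwards [ae_restrict_mem measurableSet_Ioi] with t ht w hw
    have ht' : 0 < t := ht
    refine (((((hasDerivAt_id w).const_mul (t : ℂ)).fun_neg).cexp).const_mul
      ((t ^ (b - 1) : ℝ) : ℂ)).congr_deriv ?_
    have e : t ^ b = t ^ (b - 1) * t := by
      rw [← Real.rpow_add_one ht'.ne']; congr 1; ring
    rw [e]
    simp only [id]
    push_cast
    ring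

/-- Euler's integral with a complex scaling parameter. -/
lemma integral_rpow_mul_cexp {b : ℝ} (hb : 0 < b) {z : ℂ} (hz : 0 < z.re) :
    ∫ t in Ioi (0 : ℝ), ((t ^ (b - 1) : ℝ) : ℂ) * Complex.exp (-(t * z))
      = Real.Gamma b * z ^ (-b : ℂ) := by
  set F : ℂ → ℂ := fun z => ∫ t in Ioi (0 : ℝ), ((t ^ (b - 1) : ℝ) : ℂ) * Complex.exp (-(t * z))
    with hF
  -- The product z^b F(z) has zero derivative on the right half-plane, so it is constant; its value
  -- at z = 1 is the real Euler integral Γ(b).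
  have hd : ∀ w ∈ {w : ℂ | 0 < w.re}, HasDerivAt (fun w => w ^ (b : ℂ) * F w) 0 w := by
    intro w hw
    have hw' : 0 < w.re := hw
    have hw0 : w ≠ 0 := by rintro rfl; simp at hw'
    have h1 : HasDerivAt (fun w : ℂ => w ^ (b : ℂ)) (b * w ^ ((b : ℂ) - 1)) w := by
      simpa using (hasDerivAt_id w).cpow_const (c := (b : ℂ)) (Or.inl hw')
    refine (h1.mul (hasDerivAt_integral_rpow_mul_cexp hb hw')).congr_deriv ?_
    rw [Complex.cpow_sub _ _ hw0, Complex.cpow_one]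
    have := mul_integral_rpow_mul_cexp hb hw'
    linear_combination (exp := 1) (-(w ^ (b : ℂ)) / w) * this + w ^ (b : ℂ) * (∫ t in Ioi (0 : ℝ),
      ((t ^ b : ℝ) : ℂ) * Complex.exp (-(t * w))) * mul_inv_cancel₀ hw0
  have hc := (isOpen_lt continuous_const Complex.continuous_re).is_const_of_deriv_eq_zero
    (convex_halfSpace_re_gt 0).isPreconnected
    (fun w hw => (hd w hw).differentiableAt.differentiableWithinAt)
    (fun w hw => (hd w hw).deriv) hz (show (1 : ℂ) ∈ {w : ℂ | 0 < w.re} by simp)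
  have h1 : F 1 = Real.Gamma b := by
    have := Real.integral_rpow_mul_exp_neg_mul_Ioi hb one_pos
    simp only [div_one, Real.one_rpow, one_mul] at this
    rw [← this, ← integral_complex_ofReal]
    simp only [hF]
    congr 1; ext t; push_cast; simp
  have hz0 : z ≠ 0 := by rintro rfl; simp at hz
  simp only [Complex.one_cpow, one_mul, h1] at hc
  rw [← hc, Complex.cpow_neg]
  have : z ^ (b : ℂ) ≠ 0 := by simp [Complex.cpow_eq_zero_iff, hz0]
  field_simp
  rfl

/-! ### Behaviour of the Laplace transform as y → 0 and up to the imaginary axis. -/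

lemma subKernel_le_rpow (ν y : ℝ) {τ : ℝ} (hτ : 0 < τ) : subKernel ν y τ ≤ τ ^ (-1 - ν) := by
  unfold subKernel
  refine mul_le_of_le_one_right (by positivity) (Real.exp_le_one_iff.2 ?_)
  rw [neg_div]
  exact neg_nonpos.2 (by positivity)

lemma tendsto_subKernel_left (ν τ : ℝ) :
    Tendsto (fun y => subKernel ν y τ) (𝓝[>] 0) (𝓝 (τ ^ (-1 - ν))) := by
  have h : Continuous fun y => subKernel ν y τ := by unfold subKernel; fun_prop
  have := h.tendsto 0
  simp only [subKernel, ne_eq, OfNat.ofNat_ne_zero, not_false_eq_true, zero_pow, neg_zero,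
    zero_div, Real.exp_zero, mul_one] at this
  exact this.mono_left nhdsWithin_le_nhds

/-- For `-1 < ν < 0` the Laplace transform tends, as `y → 0`, to the one of `τ^{-1-ν}`. -/
lemma tendsto_subLaplace_zero {ν : ℝ} (hν : ν < 0) {z : ℂ} (hz : 0 < z.re) :
    Tendsto (fun y => subLaplace ν y z) (𝓝[>] 0) (𝓝 (Real.Gamma (-ν) * z ^ (ν : ℂ))) := by
  have e := integral_rpow_mul_cexp (b := -ν) (by linarith) hz
  rw [show ((ν : ℝ) : ℂ) = -((-ν : ℝ) : ℂ) by push_cast; ring, ← e]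
  refine tendsto_integral_filter_of_dominated_convergence
    (fun t => t ^ (-ν - 1) * Real.exp (-(t * z.re)))
    (Eventually.of_forall fun y => aestronglyMeasurable_subKernel_mul_exp ν y z _) ?_
    (integrableOn_rpow_mul_exp (by linarith) hz) ?_
  · refine Eventually.of_forall fun y => ?_
    filter_upwards [ae_restrict_mem measurableSet_Ioi] with t ht
    rw [norm_subKernel_mul_exp ν y z ht, show -ν - 1 = -1 - ν by ring]
    exact mul_le_mul_of_nonneg_right (subKernel_le_rpow ν y ht) (Real.exp_nonneg _)
  · refine Eventually.of_forall fun t => ?_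
    rw [show -ν - 1 = -1 - ν by ring]
    exact ((Complex.continuous_ofReal.tendsto _).comp (tendsto_subKernel_left ν t)).mul_const _

/-- The integrand is ρ^{-s} near 0, where s < 1 is needed, and ρ^{-1-s} near infinity, where s > 0
is needed. -/
lemma integrableOn_rpow_mul_min {s : ℝ} (hs0 : 0 < s) (hs1 : s < 1) :
    IntegrableOn (fun ρ : ℝ => ρ ^ (-1 - s) * min 1 ρ) (Ioi 0) := by
  rw [← Ioc_union_Ioi_eq_Ioi zero_le_one]
  refine IntegrableOn.union ?_ ?_
  · have h : IntegrableOn (fun ρ : ℝ => ρ ^ (-s)) (Ioc 0 1) :=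
      (intervalIntegrable_iff_integrableOn_Ioc_of_le zero_le_one).1
        (intervalIntegral.intervalIntegrable_rpow' (by linarith))
    refine h.congr_fun (fun ρ hρ => ?_) measurableSet_Ioc
    simp only
    rw [min_eq_right hρ.2, ← Real.rpow_add_one hρ.1.ne']
    congr 1; ring
  · refine (integrableOn_Ioi_rpow_of_lt (a := -1 - s) (by linarith) one_pos).congr_fun
      (fun ρ hρ => ?_) measurableSet_Ioi
    simp only
    rw [min_eq_left (le_of_lt hρ), mul_one]

lemma norm_exp_neg_sub_one_le {τ : ℝ} (hτ : 0 < τ) {w : ℂ} (hw : 0 ≤ w.re) :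
    ‖Complex.exp (-(τ * w)) - 1‖ ≤ 2 * min 1 (τ * ‖w‖) := by
  have hn : ‖-((τ : ℂ) * w)‖ = τ * ‖w‖ := by
    rw [norm_neg, norm_mul, Complex.norm_real, Real.norm_of_nonneg hτ.le]
  rcases le_total (τ * ‖w‖) 1 with h | h
  · rw [min_eq_right h, ← hn]
    exact Complex.norm_exp_sub_one_le (by rwa [hn])
  · rw [min_eq_left h, mul_one]
    refine (norm_sub_le _ _).trans ?_
    rw [Complex.norm_exp, norm_one]
    have : Real.exp (-((τ : ℂ) * w)).re ≤ 1 := by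
      rw [Real.exp_le_one_iff]
      simp
      positivity
    linarith

/-- The bound `|w 𝓛(w)| ≤ C |w|^s`, uniformly up to the imaginary axis. -/
lemma exists_norm_mul_subLaplace_le_rpow {s : ℝ} (hs0 : 0 < s) (hs1 : s < 1) :
    ∃ C : ℝ, 0 ≤ C ∧ ∀ w : ℂ, 0 < w.re → ‖w * subLaplace (s - 1) 1 w‖ ≤ C * ‖w‖ ^ s := by
  set K : ℝ := ∫ ρ in Ioi (0 : ℝ), ρ ^ (-1 - s) * min 1 ρ
  have hK : 0 ≤ K := setIntegral_nonneg measurableSet_Ioi fun ρ hρ => by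
    have : 0 < ρ := hρ
    positivity
  refine ⟨2 * (s + 1) * K, by positivity, fun w hw => ?_⟩
  have hw0 : 0 < ‖w‖ := norm_pos_iff.2 (by rintro rfl; simp at hw)
  have hi := integrableOn_subKernel (ν := s) hs0 one_pos
  have hi' := integrableOn_subKernel (ν := s + 1) (by linarith) one_pos
  have j := integrableOn_subKernel_mul_exp (ν := s) hs0 one_pos hw.le
  have j' := integrableOn_subKernel_mul_exp (ν := s + 1) (by linarith) one_pos hw.le
  -- The integrand is the τ-derivative of the kernel with ν = s-1 and y = 1, which vanishes at both
  -- ends; here its zero integral is read off from the explicit masses. Therefore 1 may be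
  -- subtracted from e^{-τw} in the formula for w L_{s-1}(1, w), which gains the factor min(1,
  -- τ|w|).
  have e0 : ∫ τ in Ioi (0 : ℝ), (-s * subKernel s 1 τ + 1 / 4 * subKernel (s + 1) 1 τ) = 0 := by
    rw [integral_add (hi.const_mul _) (hi'.const_mul _), integral_const_mul, integral_const_mul,
      integral_subKernel hs0 one_pos, integral_subKernel (by linarith) one_pos,
      Real.Gamma_add_one hs0.ne', Real.rpow_add (by norm_num)]
    norm_num
    ring
  have e1 : w * subLaplace (s - 1) 1 w = ∫ τ in Ioi (0 : ℝ),
      ((-s * subKernel s 1 τ + 1 / 4 * subKernel (s + 1) 1 τ : ℝ) : ℂ)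
        * (Complex.exp (-(τ * w)) - 1) := by
    rw [mul_subLaplace (by linarith) one_pos hw]
    have e2 : ∀ τ : ℝ, ((-s * subKernel s 1 τ + 1 / 4 * subKernel (s + 1) 1 τ : ℝ) : ℂ)
        * (Complex.exp (-(τ * w)) - 1)
        = (-s * ((subKernel s 1 τ : ℂ) * Complex.exp (-(τ * w)))
          + 1 / 4 * ((subKernel (s + 1) 1 τ : ℂ) * Complex.exp (-(τ * w))))
        - ((-s * subKernel s 1 τ + 1 / 4 * subKernel (s + 1) 1 τ : ℝ) : ℂ) := by
      intro τ; push_cast; ring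
    simp only [e2]
    have i3 : IntegrableOn (fun τ => -s * subKernel s 1 τ + 1 / 4 * subKernel (s + 1) 1 τ) (Ioi 0) :=
      (hi.const_mul _).add (hi'.const_mul _)
    have i4 : IntegrableOn (fun τ : ℝ => -s * ((subKernel s 1 τ : ℂ) * Complex.exp (-(τ * w)))
          + 1 / 4 * ((subKernel (s + 1) 1 τ : ℂ) * Complex.exp (-(τ * w)))) (Ioi 0) :=
      (j.const_mul _).add (j'.const_mul _)
    have i5 : IntegrableOn (fun τ =>
        ((-s * subKernel s 1 τ + 1 / 4 * subKernel (s + 1) 1 τ : ℝ) : ℂ)) (Ioi 0) := i3.ofReal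
    rw [integral_sub i4 i5, integral_complex_ofReal, e0,
      integral_add (j.const_mul _) (j'.const_mul _), integral_const_mul, integral_const_mul]
    simp only [subLaplace]
    rw [show s - 1 + 1 = s by ring, show s - 1 + 2 = s + 1 by ring]
    push_cast
    ring
  -- The substitution ρ = τ|w| extracts exactly |w|^s.
  have hsc : ∫ τ in Ioi (0 : ℝ), τ ^ (-1 - s) * min 1 (τ * ‖w‖) = ‖w‖ ^ s * K := by
    have h := integral_comp_mul_left_Ioi' (fun ρ : ℝ => ρ ^ (-1 - s) * min 1 ρ) 0 hw0
    rw [mul_zero] at h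
    change _ = ‖w‖ ^ s * ∫ ρ in Ioi (0 : ℝ), ρ ^ (-1 - s) * min 1 ρ
    rw [← h, smul_eq_mul, ← mul_assoc, ← integral_const_mul]
    refine setIntegral_congr_fun measurableSet_Ioi fun τ hτ => ?_
    have hτ' : 0 < τ := hτ
    rw [Real.mul_rpow hw0.le hτ'.le, Real.rpow_sub hw0, Real.rpow_neg_one, mul_comm ‖w‖ τ]
    field_simp
  have hint : IntegrableOn (fun τ : ℝ => τ ^ (-1 - s) * min 1 (τ * ‖w‖)) (Ioi 0) := by
    have h := (integrableOn_Ioi_comp_mul_left_iff (fun ρ : ℝ => ρ ^ (-1 - s) * min 1 ρ) 0 hw0).2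
      (by rw [mul_zero]; exact integrableOn_rpow_mul_min hs0 hs1)
    refine IntegrableOn.congr_fun (h.const_mul (‖w‖ ^ (1 + s))) (fun τ hτ => ?_) measurableSet_Ioi
    have hτ' : 0 < τ := hτ
    rw [Real.mul_rpow hw0.le hτ'.le, mul_comm ‖w‖ τ, ← mul_assoc, ← mul_assoc,
      ← Real.rpow_add hw0, show 1 + s + (-1 - s) = 0 by ring, Real.rpow_zero, one_mul]
  rw [e1]
  calc _ ≤ ∫ τ in Ioi (0 : ℝ), 2 * (s + 1) * (τ ^ (-1 - s) * min 1 (τ * ‖w‖)) := by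
        refine norm_integral_le_of_norm_le (hint.const_mul _) ?_
        filter_upwards [ae_restrict_mem measurableSet_Ioi] with τ hτ
        have hτ' : 0 < τ := hτ
        rw [norm_mul, Complex.norm_real]
        -- The extra 1/τ in the kernel with index s+1 is absorbed by e^{-x} ≤ 1/x at x = 1/(4τ); the
        -- 4 cancels against the coefficient 1/4.
        have hb : subKernel (s + 1) 1 τ ≤ 4 * τ ^ (-1 - s) := by
          rw [subKernel_add_one s 1 hτ']
          unfold subKernel
          rw [mul_div_assoc, mul_comm 4 (τ ^ (-1 - s))]
          refine mul_le_mul_of_nonneg_left ?_ (Real.rpow_nonneg hτ'.le _)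
          rw [one_pow, neg_div, Real.exp_neg, div_le_iff₀ hτ']
          have h1 := Real.add_one_le_exp (1 / (4 * τ))
          have h2 : 1 / (4 * τ) ≤ Real.exp (1 / (4 * τ)) := by linarith
          have h3 := inv_anti₀ (by positivity : 0 < 1 / (4 * τ)) h2
          refine h3.trans (le_of_eq ?_)
          field_simp
        have hb' : ‖-s * subKernel s 1 τ + 1 / 4 * subKernel (s + 1) 1 τ‖
            ≤ (s + 1) * τ ^ (-1 - s) := by
          have h0 := subKernel_nonneg s 1 hτ'
          have h0' := subKernel_nonneg (s + 1) 1 hτ'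
          have h1 := mul_le_mul_of_nonneg_left (subKernel_le_rpow s 1 hτ') hs0.le
          have h2 := mul_nonneg hs0.le h0
          rw [Real.norm_eq_abs, abs_le]
          constructor <;> nlinarith
        calc _ ≤ ((s + 1) * τ ^ (-1 - s)) * (2 * min 1 (τ * ‖w‖)) :=
              mul_le_mul hb' (norm_exp_neg_sub_one_le hτ' hw.le) (norm_nonneg _) (by positivity)
          _ = _ := by ring
    _ = _ := by rw [integral_const_mul, hsc]; ring

/-! ### Fourier transforms of functions in `L¹ ∩ L²` -/

lemma lintegral_enorm_sq_eq_eLpNorm {α F : Type*} [NormedAddCommGroup F] [MeasurableSpace α] {m : Measure α} (f : α → F) :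
    ∫⁻ x, ‖f x‖ₑ ^ 2 ∂m = eLpNorm f 2 m ^ 2 := by
  rw [eLpNorm_eq_lintegral_rpow_enorm_toReal (by norm_num) (by norm_num), ← ENNReal.rpow_natCast,
    ← ENNReal.rpow_mul]
  norm_num

section General

variable {E F : Type*} [NormedAddCommGroup E] [InnerProductSpace ℝ E]

lemma neg_innerl_flip : (-innerₗ E).flip = -innerₗ E := by
  ext x y
  simp [real_inner_comm]

lemma continuous_neg_innerl : Continuous fun p : E × E => (-innerₗ E) p.1 p.2 := by
  simp only [LinearMap.neg_apply, innerₗ_apply_apply]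
  fun_prop

variable [FiniteDimensional ℝ E] [MeasurableSpace E] [BorelSpace E] [NormedAddCommGroup F]
  [InnerProductSpace ℂ F]

lemma continuous_fourierInv {g : E → F} (hg : Integrable g) : Continuous (𝓕⁻ g) :=
  VectorFourier.fourierIntegral_continuous (L := -innerₗ E)
    Real.continuous_fourierChar continuous_neg_innerl hg

variable [CompleteSpace F]

/-- The multiplication formula for vector Fourier integrals, for the pairing -⟨x, ξ⟩, which equals
its own flip. -/
lemma integral_fourierInv_smul_eq {f : E → ℂ} {g : E → F} (hf : Integrable f)
    (hg : Integrable g) : ∫ ξ, 𝓕⁻ f ξ • g ξ = ∫ x, f x • 𝓕⁻ g x := by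
  have h := VectorFourier.integral_fourierIntegral_smul_eq_flip (L := -innerₗ E)
    Real.continuous_fourierChar continuous_neg_innerl hf hg
  rw [neg_innerl_flip] at h
  exact h

/-- The `L²` inverse Fourier transform of a function in `L¹ ∩ L²` is given by the integral. -/
lemma fourierInv_toLp_ae_eq {R : E → F} (h1 : Integrable R) (h2 : MemLp R 2 volume) :
    (𝓕⁻ (h2.toLp R) : Lp F 2 (volume : Measure E)) =ᵐ[volume] 𝓕⁻ R := by
  -- Both sides are locally integrable, so it is enough to compare them against compactly supported
  -- smooth functions. These are Schwartz functions, and on them the L² transform is the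
  -- distributional one.
  refine ae_eq_of_integral_contDiff_smul_eq
    ((Lp.memLp _).locallyIntegrable (by norm_num))
    (continuous_fourierInv h1).locallyIntegrable fun g hg hgc => ?_
  have hg₁ : HasCompactSupport (Complex.ofRealCLM ∘ g) := hgc.comp_left rfl
  have hg₂ : ContDiff ℝ (⊤ : ℕ∞) (Complex.ofRealCLM ∘ g) := by fun_prop
  set φ : 𝓢(E, ℂ) := hg₁.toSchwartzMap hg₂
  have hφ : ∀ x, φ x = (g x : ℂ) := fun x => rfl
  calc ∫ x, g x • (𝓕⁻ (h2.toLp R) : Lp F 2 (volume : Measure E)) x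
      = ((𝓕⁻ (h2.toLp R) : Lp F 2 (volume : Measure E)) : 𝓢'(E, F)) φ := by
        rw [Lp.toTemperedDistribution_apply]
        simp only [hφ, Complex.coe_smul]
    _ = ((h2.toLp R : Lp F 2 (volume : Measure E)) : 𝓢'(E, F)) (𝓕⁻ φ) := by
        rw [← Lp.fourierInv_toTemperedDistribution_eq, TemperedDistribution.fourierInv_apply]
    _ = ∫ ξ, 𝓕⁻ φ ξ • R ξ := by
        rw [Lp.toTemperedDistribution_apply]
        refine integral_congr_ae ?_
        filter_upwards [h2.coeFn_toLp] with ξ hξ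
        rw [hξ]
    _ = ∫ x, φ x • 𝓕⁻ R x := by
        rw [← integral_fourierInv_smul_eq φ.integrable h1, SchwartzMap.fourierInv_coe]
    _ = _ := by simp only [hφ, Complex.coe_smul]

lemma memLp_fourierInv {R : E → F} (h1 : Integrable R) (h2 : MemLp R 2 volume) :
    MemLp (𝓕⁻ R) 2 volume :=
  (Lp.memLp _).ae_eq (fourierInv_toLp_ae_eq h1 h2)

lemma toLp_fourierInv {R : E → F} (h1 : Integrable R) (h2 : MemLp R 2 volume) :
    (memLp_fourierInv h1 h2).toLp (𝓕⁻ R) = 𝓕⁻ (h2.toLp R) :=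
  Lp.ext ((memLp_fourierInv h1 h2).coeFn_toLp.trans (fourierInv_toLp_ae_eq h1 h2).symm)

/-- Plancherel in `Lp`, carried over to the pointwise defined integral because that integral
represents the L² class. -/
lemma lintegral_enorm_fourierInv_sq {R : E → F} (h1 : Integrable R) (h2 : MemLp R 2 volume) :
    ∫⁻ x, ‖𝓕⁻ R x‖ₑ ^ 2 = ∫⁻ ξ, ‖R ξ‖ₑ ^ 2 := by
  rw [lintegral_enorm_sq_eq_eLpNorm, lintegral_enorm_sq_eq_eLpNorm]
  have h : ‖(memLp_fourierInv h1 h2).toLp (𝓕⁻ R)‖ₑ = ‖h2.toLp R‖ₑ := by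
    rw [toLp_fourierInv h1 h2, ← ofReal_norm, ← ofReal_norm,
      ← Lp.norm_fourier_eq, FourierTransform.fourier_fourierInv_eq]
  rw [Lp.enorm_def, Lp.enorm_def, eLpNorm_congr_ae (MemLp.coeFn_toLp _),
    eLpNorm_congr_ae h2.coeFn_toLp] at h
  rw [h]

end General

variable {n : ℕ}

lemma MemLp.fourierL2_eq {f : SpaceTime n → Val n} (h : MemLp f 2 volume) :
    fourierL2 f = ⇑(𝓕 (h.toLp f) : Lp (Val n) 2 (volume : Measure (SpaceTime n))) :=
  dif_pos h

lemma memLp_fourierL2 (f : SpaceTime n → Val n) : MemLp (fourierL2 f) 2 volume := by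
  by_cases h : MemLp f 2 volume
  · rw [MemLp.fourierL2_eq h]; exact Lp.memLp _
  · rw [fourierL2, dif_neg h]; exact MemLp.zero

lemma toDist_eq {f : SpaceTime n → Val n} (h : MemLp f 2 volume) :
    toDist f = Lp.toTemperedDistribution (h.toLp f) :=
  dif_pos h

lemma fourierL2_fourierInv_ae_eq {R : SpaceTime n → Val n} (h1 : Integrable R)
    (h2 : MemLp R 2 volume) : fourierL2 (𝓕⁻ R) =ᵐ[volume] R := by
  rw [MemLp.fourierL2_eq (memLp_fourierInv h1 h2), toLp_fourierInv h1 h2,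
    FourierTransform.fourier_fourierInv_eq]
  exact h2.coeFn_toLp

lemma lintegral_enorm_fourierL2_sq {f : SpaceTime n → Val n} (h : MemLp f 2 volume) :
    ∫⁻ ζ, ‖fourierL2 f ζ‖ₑ ^ 2 = eLpNorm f 2 volume ^ 2 := by
  rw [MemLp.fourierL2_eq h, lintegral_enorm_sq_eq_eLpNorm, ← Lp.enorm_def, ← ofReal_norm,
    Lp.norm_fourier_eq, ofReal_norm, Lp.enorm_def, eLpNorm_congr_ae h.coeFn_toLp]

lemma integrable_schwartz_smul {g : SpaceTime n → Val n} (hg : MemLp g 2 volume)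
    (φ : 𝓢(SpaceTime n, ℂ)) : Integrable (fun ζ => φ ζ • g ζ) volume :=
  memLp_one_iff_integrable.1 (hg.smul (φ.memLp 2))

lemma hasFourierDensity_toDist {f : SpaceTime n → Val n} (h : MemLp f 2 volume) :
    HasFourierDensity (toDist f) (fourierL2 f) := by
  refine ⟨(memLp_fourierL2 f).1, fun φ => ⟨integrable_schwartz_smul (memLp_fourierL2 f) φ, ?_⟩⟩
  rw [toDist_eq h, Lp.fourier_toTemperedDistribution_eq, Lp.toTemperedDistribution_apply,
    MemLp.fourierL2_eq h]

/-! ### Tempered distributions whose Fourier transform is a function. -/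

namespace HasFourierDensity

variable {T T' : 𝓢'(SpaceTime n, Val n)} {g g' : SpaceTime n → Val n}

lemma add (h : HasFourierDensity T g) (h' : HasFourierDensity T' g') :
    HasFourierDensity (T + T') (g + g') := by
  refine ⟨h.1.add h'.1, fun φ => ⟨?_, ?_⟩⟩
  · simpa only [Pi.add_apply, smul_add] using! (h.2 φ).1.add (h'.2 φ).1
  · simp only [Pi.add_apply, smul_add]
    rw [integral_add (h.2 φ).1 (h'.2 φ).1, ← (h.2 φ).2, ← (h'.2 φ).2,
      FourierTransform.fourier_add]
    rfl

lemma sub (h : HasFourierDensity T g) (h' : HasFourierDensity T' g') :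
    HasFourierDensity (T - T') (g - g') := by
  refine ⟨h.1.sub h'.1, fun φ => ⟨?_, ?_⟩⟩
  · simpa only [Pi.sub_apply, smul_sub] using! (h.2 φ).1.sub (h'.2 φ).1
  · simp only [Pi.sub_apply, smul_sub]
    rw [integral_sub (h.2 φ).1 (h'.2 φ).1, ← (h.2 φ).2, ← (h'.2 φ).2]
    rfl

lemma congr (h : HasFourierDensity T g) (hg : g =ᵐ[volume] g') : HasFourierDensity T g' := by
  refine ⟨h.1.congr hg, fun φ => ?_⟩
  have e : (fun ζ => φ ζ • g ζ) =ᵐ[volume] fun ζ => φ ζ • g' ζ := by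
    filter_upwards [hg] with ζ hζ
    rw [hζ]
  exact ⟨(h.2 φ).1.congr e, by rw [(h.2 φ).2, integral_congr_ae e]⟩

/-- Testing with a bump function equal to 1 on a ball gives integrability on that ball. This is the
hypothesis under which a function is determined by its integrals against test functions. -/
lemma locallyIntegrable (h : HasFourierDensity T g) : LocallyIntegrable g volume := by
  intro x
  let b : ContDiffBump x := ⟨1, 2, one_pos, one_lt_two⟩
  have hg₁ : HasCompactSupport (Complex.ofRealCLM ∘ b) := b.hasCompactSupport.comp_left rfl
  have hg₂ : ContDiff ℝ (⊤ : ℕ∞) (Complex.ofRealCLM ∘ b) := Complex.ofRealCLM.contDiff.comp b.contDiff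
  refine ⟨Metric.closedBall x 1, Metric.closedBall_mem_nhds x one_pos, ?_⟩
  refine IntegrableOn.congr_fun (h.2 (hg₁.toSchwartzMap hg₂)).1.integrableOn (fun ζ hζ => ?_)
    Metric.isClosed_closedBall.measurableSet
  have : b ζ = 1 := b.one_of_mem_closedBall hζ
  change (Complex.ofRealCLM (b ζ)) • g ζ = g ζ
  simp [this]

/-- The Fourier density of a distribution is unique. -/
lemma unique (h : HasFourierDensity T g) (h' : HasFourierDensity T g') : g =ᵐ[volume] g' := by
  refine ae_eq_of_integral_contDiff_smul_eq h.locallyIntegrable h'.locallyIntegrable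
    fun f hf hfc => ?_
  have hg₁ : HasCompactSupport (Complex.ofRealCLM ∘ f) := hfc.comp_left rfl
  have hg₂ : ContDiff ℝ (⊤ : ℕ∞) (Complex.ofRealCLM ∘ f) := by fun_prop
  have e := (h.2 (hg₁.toSchwartzMap hg₂)).2.symm.trans (h'.2 (hg₁.toSchwartzMap hg₂)).2
  exact e

/-- Uniqueness of the density makes all competitors in the infimum defining `sobolevNorm` agree
almost everywhere, so any density computes the norm. -/
lemma sobolevNorm_eq (h : HasFourierDensity T g) (r : ℝ) :
    sobolevNorm r T = (∫⁻ ζ, ENNReal.ofReal (weight ζ ^ (r / 2)) * ‖g ζ‖ₑ ^ 2) ^ (1 / 2 : ℝ) := by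
  refine le_antisymm (iInf₂_le g h) (le_iInf₂ fun g' h' => ?_)
  refine le_of_eq (congrArg (· ^ (1 / 2 : ℝ)) (lintegral_congr_ae ?_))
  filter_upwards [h.unique h'] with ζ hζ
  rw [hζ]

lemma sobolevNorm_sq (h : HasFourierDensity T g) (r : ℝ) :
    sobolevNorm r T ^ 2 = ∫⁻ ζ, ENNReal.ofReal (weight ζ ^ (r / 2)) * ‖g ζ‖ₑ ^ 2 := by
  rw [h.sobolevNorm_eq, ← ENNReal.rpow_natCast, ← ENNReal.rpow_mul]
  norm_num

lemma sobolevNorm_lt_top (h : HasFourierDensity T g) {r : ℝ}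
    (hr : ∫⁻ ζ, ENNReal.ofReal (weight ζ ^ (r / 2)) * ‖g ζ‖ₑ ^ 2 < ⊤) : sobolevNorm r T < ⊤ := by
  rw [h.sobolevNorm_eq]
  exact ENNReal.rpow_lt_top_of_nonneg (by norm_num) hr.ne

lemma lintegral_lt_top (h : HasFourierDensity T g) {r : ℝ} (hr : sobolevNorm r T < ⊤) :
    ∫⁻ ζ, ENNReal.ofReal (weight ζ ^ (r / 2)) * ‖g ζ‖ₑ ^ 2 < ⊤ := by
  rw [← h.sobolevNorm_sq]
  exact ENNReal.pow_lt_top hr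

end HasFourierDensity

/-- A function `g` with `(1 + |ζ|²)⁻¹ g ∈ L²` is the Fourier density of a tempered distribution. -/
lemma exists_hasFourierDensity {g : SpaceTime n → Val n}
    (hg : MemLp (fun ζ => ((1 + ‖ζ‖ ^ 2)⁻¹ : ℝ) • g ζ) 2 volume) :
    ∃ T, HasFourierDensity T g := by
  set h : SpaceTime n → Val n := fun ζ => ((1 + ‖ζ‖ ^ 2)⁻¹ : ℝ) • g ζ with hh
  set w : SpaceTime n → ℂ := fun ζ => ((1 + ‖ζ‖ ^ 2 : ℝ) : ℂ) with hw
  have hwt : w.HasTemperateGrowth := by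
    have : (fun ζ : SpaceTime n => 1 + ‖ζ‖ ^ 2).HasTemperateGrowth := by
      simpa using Function.hasTemperateGrowth_one_add_norm_sq_rpow (SpaceTime n) 1
    exact Function.Complex.hasTemperateGrowth_ofReal.comp this
  have hgh : ∀ ζ, g ζ = w ζ • h ζ := by
    intro ζ
    simp only [hh, hw, Complex.coe_smul, smul_smul]
    rw [mul_inv_cancel₀ (by positivity), one_smul]
  have hφ : ∀ (φ : 𝓢(SpaceTime n, ℂ)) ζ, φ ζ • g ζ = SchwartzMap.smulLeftCLM ℂ w φ ζ • h ζ := by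
    intro φ ζ
    rw [SchwartzMap.smulLeftCLM_apply_apply hwt, hgh, smul_smul, smul_eq_mul, mul_comm]
  -- The witness: regard the weighted function as an L² distribution, multiply the weight 1 + |ζ|²
  -- of temperate growth back, and invert the Fourier transform.
  refine ⟨𝓕⁻ (TemperedDistribution.smulLeftCLM (Val n) w
    (Lp.toTemperedDistribution (hg.toLp h))), ?_, fun φ => ?_⟩
  · have : g = fun ζ => w ζ • h ζ := funext hgh
    rw [this]
    exact Continuous.aestronglyMeasurable (f := w) (by simp only [hw]; fun_prop) |>.smul hg.1
  · simp only [hφ]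
    refine ⟨integrable_schwartz_smul hg _, ?_⟩
    rw [FourierTransform.fourier_fourierInv_eq, TemperedDistribution.smulLeftCLM_apply_apply,
      Lp.toTemperedDistribution_apply]
    refine integral_congr_ae ?_
    filter_upwards [hg.coeFn_toLp] with ζ hζ
    rw [hζ]

variable {n : ℕ}

/-! ### The scalar parabolic symbols -/

/-- The symbol `κ|ξ|² + iσ` of `∂ₜ - κΔ` at the frequency `(ξ, σ) = 2πζ`. -/
def parSymbol (κ : ℝ) (ζ : SpaceTime n) : ℂ :=
  ((κ * ‖(2 * Real.pi) • ζ.fst‖ ^ 2 : ℝ) : ℂ) + Complex.I * ((2 * Real.pi * ζ.snd : ℝ) : ℂ)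

lemma parSymbol_re (κ : ℝ) (ζ : SpaceTime n) :
    (parSymbol κ ζ).re = κ * ‖(2 * Real.pi) • ζ.fst‖ ^ 2 := by
  simp [parSymbol, -Complex.ofReal_mul, -Complex.ofReal_pow]

lemma parSymbol_im (κ : ℝ) (ζ : SpaceTime n) : (parSymbol κ ζ).im = 2 * Real.pi * ζ.snd := by
  simp [parSymbol, -Complex.ofReal_mul, -Complex.ofReal_pow]

lemma continuous_parSymbol (κ : ℝ) : Continuous (parSymbol κ : SpaceTime n → ℂ) := by
  unfold parSymbol
  have h1 : Continuous fun ζ : SpaceTime n => ζ.fst := WithLp.continuous_fst 2 _ _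
  have h2 : Continuous fun ζ : SpaceTime n => ζ.snd := WithLp.continuous_snd 2 _ _
  fun_prop

lemma norm_two_pi_smul_sq (v : Space n) :
    ‖(2 * Real.pi) • v‖ ^ 2 = (2 * Real.pi) ^ 2 * ‖v‖ ^ 2 := by
  rw [norm_smul, Real.norm_of_nonneg (by positivity), mul_pow]

/-- The frequencies with ξ = 0 form a proper subspace because n ≥ 1, hence a null set. Off this set
both scalar symbols have positive real part. -/
lemma ae_fst_ne_zero (hn : 1 ≤ n) : ∀ᵐ ζ : SpaceTime n, ζ.fst ≠ 0 := by
  let L : SpaceTime n →ₗ[ℝ] Space n := (WithLp.fstL 2 ℝ (Space n) ℝ).toLinearMap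
  have hL : LinearMap.ker L ≠ ⊤ := by
    intro h
    have : WithLp.toLp 2 ((EuclideanSpace.single (⟨0, hn⟩ : Fin n) (1 : ℝ) : Space n), (0 : ℝ))
      ∈ LinearMap.ker L := by rw [h]; trivial
    have h0 : (EuclideanSpace.single (⟨0, hn⟩ : Fin n) (1 : ℝ) : Space n) = 0 := this
    simpa using congrArg norm h0
  have := Measure.addHaar_submodule (volume : Measure (SpaceTime n)) _ hL
  rw [ae_iff]
  simpa using! this

lemma parSymbol_re_pos {κ : ℝ} (hκ : 0 < κ) {ζ : SpaceTime n} (hζ : ζ.fst ≠ 0) :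
    0 < (parSymbol κ ζ).re := by
  rw [parSymbol_re, norm_two_pi_smul_sq]
  have := norm_pos_iff.2 hζ
  positivity

lemma parSymbol_re_nonneg {κ : ℝ} (hκ : 0 ≤ κ) (ζ : SpaceTime n) :
    0 ≤ (parSymbol κ ζ).re := by
  rw [parSymbol_re]
  positivity

lemma ae_parSymbol_re_pos (hn : 1 ≤ n) {κ : ℝ} (hκ : 0 < κ) :
    ∀ᵐ ζ : SpaceTime n, 0 < (parSymbol κ ζ).re :=
  (ae_fst_ne_zero hn).mono fun _ h => parSymbol_re_pos hκ h

/-- Parabolic scaling: |ξ|² is bounded by a multiple of |z|, whereas σ² is only bounded by |z|²,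
which explains the square on the right. It converts decay in z into decay in ζ. -/
lemma exists_one_add_norm_sq_le {κ : ℝ} (hκ : 0 < κ) :
    ∃ C : ℝ, 0 < C ∧ ∀ ζ : SpaceTime n, 1 + ‖ζ‖ ^ 2 ≤ C * (1 + ‖parSymbol κ ζ‖) ^ 2 := by
  refine ⟨1 + 1 / κ, by positivity, fun ζ => ?_⟩
  have h1 := Complex.abs_re_le_norm (parSymbol κ ζ)
  have h2 := Complex.abs_im_le_norm (parSymbol κ ζ)
  rw [parSymbol_re, norm_two_pi_smul_sq, abs_of_nonneg (by positivity)] at h1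
  rw [parSymbol_im, abs_mul, abs_of_pos (by positivity)] at h2
  have hpi := Real.pi_gt_three
  set w := ‖parSymbol κ ζ‖
  have hw : 0 ≤ w := norm_nonneg _
  have hpi2 : 1 ≤ (2 * Real.pi) ^ 2 := by nlinarith
  have h3 : ‖ζ.fst‖ ^ 2 ≤ 1 / κ * w := by
    rw [one_div, inv_mul_eq_div, le_div_iff₀ hκ]
    nlinarith [mul_nonneg hκ.le (sq_nonneg ‖ζ.fst‖)]
  have h4 : ‖ζ.snd‖ ^ 2 ≤ w ^ 2 := by
    rw [Real.norm_eq_abs]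
    refine pow_le_pow_left₀ (abs_nonneg _) ?_ 2
    nlinarith [abs_nonneg ζ.snd]
  rw [WithLp.prod_norm_sq_eq_of_L2]
  have : 0 < 1 / κ := by positivity
  nlinarith [mul_nonneg this.le hw, mul_nonneg this.le (sq_nonneg w)]

lemma norm_parSymbol_le {κ : ℝ} (hκ : 0 ≤ κ) (ζ : SpaceTime n) :
    ‖parSymbol κ ζ‖ ≤ (κ + 1) * (2 * Real.pi) ^ 2 * (1 + ‖ζ‖ ^ 2) := by
  have h := Complex.norm_le_abs_re_add_abs_im (parSymbol κ ζ)
  rw [parSymbol_re, norm_two_pi_smul_sq, abs_of_nonneg (by positivity), parSymbol_im, abs_mul,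
    abs_of_pos (by positivity : 0 < 2 * Real.pi)] at h
  rw [WithLp.prod_norm_sq_eq_of_L2, Real.norm_eq_abs]
  have hpi := Real.pi_gt_three
  have h1 : 2 * Real.pi ≤ (2 * Real.pi) ^ 2 := by nlinarith
  have h2 : |ζ.snd| ≤ 1 + |ζ.snd| ^ 2 := by nlinarith [sq_nonneg (|ζ.snd| - 1), abs_nonneg ζ.snd]
  have h3 : 2 * Real.pi * |ζ.snd| ≤ (2 * Real.pi) ^ 2 * (1 + |ζ.snd| ^ 2) :=
    mul_le_mul h1 h2 (abs_nonneg _) (by positivity)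
  have h4 : 0 ≤ (2 * Real.pi) ^ 2 * ‖ζ.fst‖ ^ 2 := by positivity
  have h5 : 0 ≤ κ * ((2 * Real.pi) ^ 2 * (1 + |ζ.snd| ^ 2)) := by positivity
  nlinarith

/-- The real parts are proportional and the imaginary parts equal. With κ' = 1 this compares both
Lamé symbols with the one in the Sobolev weight. -/
lemma norm_parSymbol_le_mul {κ κ' : ℝ} (hκ : 0 ≤ κ) (hκ' : 0 < κ') (ζ : SpaceTime n) :
    ‖parSymbol κ ζ‖ ≤ (κ / κ' + 1) * ‖parSymbol κ' ζ‖ := by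
  have h := Complex.norm_le_abs_re_add_abs_im (parSymbol κ ζ)
  have h1 := Complex.abs_re_le_norm (parSymbol κ' ζ)
  have h2 := Complex.abs_im_le_norm (parSymbol κ' ζ)
  rw [parSymbol_re, parSymbol_im, abs_of_nonneg (by positivity)] at h
  rw [parSymbol_re, abs_of_nonneg (by positivity)] at h1
  rw [parSymbol_im] at h2
  have : κ * ‖(2 * Real.pi) • ζ.fst‖ ^ 2 = κ / κ' * (κ' * ‖(2 * Real.pi) • ζ.fst‖ ^ 2) := by
    field_simp
  have h3 := mul_le_mul_of_nonneg_left h1 (by positivity : 0 ≤ κ / κ')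
  linarith

lemma weight_eq (ζ : SpaceTime n) : weight ζ = 1 + ‖parSymbol 1 ζ‖ ^ 2 := by
  unfold weight parSymbol
  rw [one_mul]

lemma one_le_weight (ζ : SpaceTime n) : 1 ≤ weight ζ := by
  rw [weight_eq]
  nlinarith [sq_nonneg ‖parSymbol 1 ζ‖]

lemma measurable_weight : Measurable (weight : SpaceTime n → ℝ) := by
  have : (weight : SpaceTime n → ℝ) = fun ζ => 1 + ‖parSymbol 1 ζ‖ ^ 2 := funext weight_eq
  rw [this]
  have := (continuous_parSymbol (n := n) 1).measurable
  fun_prop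

/-- As (1 + |ζ|²)^N is at most a constant times (1 + |z|)^{2N}, the decay of orders 0 and 2N in z
suffices. -/
lemma exists_pow_mul_norm_subLaplace_le {κ : ℝ} (hκ : 0 < κ) {ν a b : ℝ} (hν : 0 < ν)
    (ha : 0 < a) (N : ℕ) :
    ∃ C : ℝ, 0 ≤ C ∧ ∀ y ∈ Icc a b, ∀ ζ : SpaceTime n, 0 < (parSymbol κ ζ).re →
      (1 + ‖ζ‖ ^ 2) ^ N * ‖subLaplace ν y (parSymbol κ ζ)‖ ≤ C := by
  obtain ⟨D, hD, H⟩ := exists_one_add_norm_sq_le (n := n) hκ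
  obtain ⟨C0, h0, H0⟩ := exists_norm_pow_mul_subLaplace_le (b := b) ha 0 hν
  obtain ⟨C1, h1, H1⟩ := exists_norm_pow_mul_subLaplace_le (b := b) ha (2 * N) hν
  refine ⟨D ^ N * (2 ^ (2 * N - 1) * (C0 + C1)), by positivity, fun y hy ζ hζ => ?_⟩
  set w := parSymbol κ ζ
  calc (1 + ‖ζ‖ ^ 2) ^ N * ‖subLaplace ν y w‖
      ≤ (D * (1 + ‖w‖) ^ 2) ^ N * ‖subLaplace ν y w‖ := by gcongr; exact H ζ
    _ = D ^ N * ((1 + ‖w‖) ^ (2 * N) * ‖subLaplace ν y w‖) := by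
        rw [mul_pow, ← pow_mul]; ring
    _ ≤ D ^ N * (2 ^ (2 * N - 1) * (1 ^ (2 * N) + ‖w‖ ^ (2 * N)) * ‖subLaplace ν y w‖) := by
        gcongr
        exact add_pow_le zero_le_one (norm_nonneg _) _
    _ = D ^ N * (2 ^ (2 * N - 1) * (‖w‖ ^ 0 * ‖subLaplace ν y w‖
          + ‖w‖ ^ (2 * N) * ‖subLaplace ν y w‖)) := by
        rw [one_pow, pow_zero]; ring
    _ ≤ _ := by
        have := H0 y hy w hζ
        have := H1 y hy w hζ
        gcongr

/-! ### Polynomially weighted `L²` functions -/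

/-- `h` is square integrable after division by some power of `1 + |ζ|²`. -/
def ModerateL2 (h : SpaceTime n → Val n) : Prop :=
  ∃ N : ℕ, MemLp (fun ζ => (((1 + ‖ζ‖ ^ 2) ^ N)⁻¹ : ℝ) • h ζ) 2 volume

lemma MemLp.moderateL2 {h : SpaceTime n → Val n} (hh : MemLp h 2 volume) : ModerateL2 h :=
  ⟨0, by simpa using hh⟩

lemma ModerateL2.aestronglyMeasurable {h : SpaceTime n → Val n} (hh : ModerateL2 h) :
    AEStronglyMeasurable h volume := by
  obtain ⟨N, hN⟩ := hh
  have e : h = fun ζ => ((1 + ‖ζ‖ ^ 2) ^ N : ℝ) • ((((1 + ‖ζ‖ ^ 2) ^ N)⁻¹ : ℝ) • h ζ) := by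
    ext1 ζ
    rw [smul_smul, mul_inv_cancel₀ (by positivity), one_smul]
  have hc : Continuous fun ζ : SpaceTime n => (1 + ‖ζ‖ ^ 2) ^ N := by fun_prop
  rw [e]
  exact hc.aestronglyMeasurable.smul hN.1

/-- The reason for working with this class: derivatives multiply the density by polynomials of
degree at most two, which costs one more power of 1 + |ζ|² and nothing else. -/
lemma ModerateL2.smul {h : SpaceTime n → Val n} (hh : ModerateL2 h) {q : SpaceTime n → ℂ}
    (hq : AEStronglyMeasurable q volume) {C : ℝ} (hC : ∀ ζ, ‖q ζ‖ ≤ C * (1 + ‖ζ‖ ^ 2)) :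
    ModerateL2 fun ζ => q ζ • h ζ := by
  have hm := hh.aestronglyMeasurable
  obtain ⟨N, hN⟩ := hh
  refine ⟨N + 1, hN.of_le_mul (c := C) ?_ (Eventually.of_forall fun ζ => ?_)⟩
  · have : Continuous fun ζ : SpaceTime n => (((1 + ‖ζ‖ ^ 2) ^ (N + 1))⁻¹ : ℝ) :=
      Continuous.inv₀ (by fun_prop) fun ζ => by positivity
    exact this.aestronglyMeasurable.smul (hq.smul hm)
  · have hp : 0 < 1 + ‖ζ‖ ^ 2 := by positivity
    rw [norm_smul, norm_smul, norm_smul, Real.norm_of_nonneg (by positivity),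
      Real.norm_of_nonneg (by positivity), pow_succ, mul_inv]
    calc _ ≤ ((1 + ‖ζ‖ ^ 2) ^ N)⁻¹ * (1 + ‖ζ‖ ^ 2)⁻¹ * ((C * (1 + ‖ζ‖ ^ 2)) * ‖h ζ‖) := by
          gcongr; exact hC ζ
      _ = _ := by field_simp

lemma memLp_inv_pow_one_add_norm_sq :
    ∃ M : ℕ, MemLp (fun ζ : SpaceTime n => ((1 + ‖ζ‖ ^ 2) ^ M)⁻¹) 2 volume := by
  refine ⟨Module.finrank ℝ (SpaceTime n) + 1, ?_⟩
  set d := Module.finrank ℝ (SpaceTime n)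
  have hc : Continuous fun ζ : SpaceTime n => (((1 + ‖ζ‖ ^ 2) ^ (d + 1))⁻¹ : ℝ) :=
    Continuous.inv₀ (by fun_prop) fun ζ => by positivity
  rw [memLp_two_iff_integrable_sq_norm hc.aestronglyMeasurable]
  -- The square of the weight is (1 + |ζ|²)^{-r/2} with r = 4(d+1), well above the dimension d.
  have h := integrable_rpow_neg_one_add_norm_sq (E := SpaceTime n) (μ := volume)
    (r := 4 * (d + 1)) (by
      have : (0 : ℝ) ≤ d := by positivity
      change (d : ℝ) < _
      linarith)
  refine h.congr (Eventually.of_forall fun ζ => ?_)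
  have hp : 0 < 1 + ‖ζ‖ ^ 2 := by positivity
  simp only
  rw [Real.norm_of_nonneg (by positivity), ← inv_pow, ← pow_mul, inv_pow,
    ← Real.rpow_natCast _ ((d + 1) * 2), ← Real.rpow_neg hp.le]
  congr 1
  push_cast
  ring

/-- Multiplication by the rapidly decaying symbols maps moderate functions to `L¹ ∩ L²`, locally
uniformly in `y > 0`. -/
lemma ModerateL2.exists_bound (hn : 1 ≤ n) {κ : ℝ} (hκ : 0 < κ) {ν a b : ℝ} (hν : 0 < ν)
    (ha : 0 < a) {h : SpaceTime n → Val n} (hh : ModerateL2 h) :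
    ∃ B : SpaceTime n → ℝ, Integrable B volume ∧ MemLp B 2 volume ∧
      ∀ᵐ ζ, ∀ y ∈ Icc a b, ‖subLaplace ν y (parSymbol κ ζ) • h ζ‖ ≤ B ζ := by
  obtain ⟨N, hN⟩ := hh
  obtain ⟨M, hM⟩ := memLp_inv_pow_one_add_norm_sq (n := n)
  -- Decay of order N brings h into L²; the further order M supplies a second L² factor, so that the
  -- product is also in L¹.
  obtain ⟨C, hC, H⟩ := exists_pow_mul_norm_subLaplace_le (n := n) (b := b) hκ hν ha (N + M)
  refine ⟨fun ζ => C * (((1 + ‖ζ‖ ^ 2) ^ M)⁻¹ * ‖(((1 + ‖ζ‖ ^ 2) ^ N)⁻¹ : ℝ) • h ζ‖), ?_, ?_, ?_⟩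
  · exact (memLp_one_iff_integrable.1 (hN.norm.smul hM)).const_mul C
  · refine (hN.norm.of_le_mul (c := 1) (hM.1.mul hN.norm.1) (Eventually.of_forall fun ζ => ?_)).const_mul C
    have hp : 1 ≤ 1 + ‖ζ‖ ^ 2 := by nlinarith [sq_nonneg ‖ζ‖]
    change ‖((1 + ‖ζ‖ ^ 2) ^ M)⁻¹ * ‖(((1 + ‖ζ‖ ^ 2) ^ N)⁻¹ : ℝ) • h ζ‖‖ ≤ _
    rw [norm_mul, Real.norm_of_nonneg (by positivity)]
    gcongr
    exact inv_le_one_of_one_le₀ (one_le_pow₀ hp)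
  · filter_upwards [ae_parSymbol_re_pos hn hκ] with ζ hζ y hy
    have hp : 0 < 1 + ‖ζ‖ ^ 2 := by positivity
    have h1 := H y hy ζ hζ
    rw [norm_smul, norm_smul, Real.norm_of_nonneg (by positivity)]
    calc _ = ((1 + ‖ζ‖ ^ 2) ^ (N + M) * ‖subLaplace ν y (parSymbol κ ζ)‖) *
          (((1 + ‖ζ‖ ^ 2) ^ M)⁻¹ * (((1 + ‖ζ‖ ^ 2) ^ N)⁻¹ * ‖h ζ‖)) := by
          rw [pow_add]; field_simp
      _ ≤ _ := by gcongr

lemma aestronglyMeasurable_subLaplace_smul (κ ν y : ℝ) {h : SpaceTime n → Val n}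
    (hh : AEStronglyMeasurable h volume) :
    AEStronglyMeasurable (fun ζ => subLaplace ν y (parSymbol κ ζ) • h ζ) volume :=
  ((measurable_subLaplace ν y).comp (continuous_parSymbol κ).measurable).aestronglyMeasurable.smul hh

lemma ModerateL2.integrable (hn : 1 ≤ n) {κ : ℝ} (hκ : 0 < κ) {ν y : ℝ} (hν : 0 < ν) (hy : 0 < y)
    {h : SpaceTime n → Val n} (hh : ModerateL2 h) :
    Integrable (fun ζ => subLaplace ν y (parSymbol κ ζ) • h ζ) volume := by
  obtain ⟨B, hB, -, H⟩ := hh.exists_bound hn hκ hν hy (b := y)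
  exact hB.mono' (aestronglyMeasurable_subLaplace_smul κ ν y hh.aestronglyMeasurable)
    (H.mono fun ζ hζ => hζ y ⟨le_rfl, le_rfl⟩)

lemma ModerateL2.memLp (hn : 1 ≤ n) {κ : ℝ} (hκ : 0 < κ) {ν y : ℝ} (hν : 0 < ν) (hy : 0 < y)
    {h : SpaceTime n → Val n} (hh : ModerateL2 h) :
    MemLp (fun ζ => subLaplace ν y (parSymbol κ ζ) • h ζ) 2 volume := by
  obtain ⟨B, -, hB, H⟩ := hh.exists_bound hn hκ hν hy (b := y)
  refine hB.of_le (aestronglyMeasurable_subLaplace_smul κ ν y hh.aestronglyMeasurable) ?_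
  filter_upwards [H] with ζ hζ
  exact (hζ y ⟨le_rfl, le_rfl⟩).trans (le_abs_self _)

/-! ### Inverse Fourier transforms of the rapidly decaying symbols -/

/-- The inverse Fourier transform of `𝓛_ν(y, κ|ξ|² + iσ) h`. -/
def invFourier (κ ν : ℝ) (h : SpaceTime n → Val n) (q : SpaceTime n × ℝ) : Val n :=
  𝓕⁻ (fun ζ => subLaplace ν q.2 (parSymbol κ ζ) • h ζ) q.1

/-- The character `e^{2πi⟨ζ, p⟩}`. -/
def wave (ζ p : SpaceTime n) : ℂ := Complex.exp ((2 * Real.pi * inner ℝ ζ p : ℝ) * Complex.I)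

lemma norm_wave (ζ p : SpaceTime n) : ‖wave ζ p‖ = 1 := Complex.norm_exp_ofReal_mul_I _

lemma continuous_wave (p : SpaceTime n) : Continuous fun ζ => wave ζ p := by
  unfold wave; fun_prop

lemma fourierInv_eq_wave {F : Type*} [NormedAddCommGroup F] [NormedSpace ℂ F]
    (g : SpaceTime n → F) (p : SpaceTime n) : 𝓕⁻ g p = ∫ ζ, wave ζ p • g ζ := by
  rw [Real.fourierInv_eq']
  rfl

lemma hasFDerivAt_wave (ζ p : SpaceTime n) :
    HasFDerivAt (wave ζ) ((innerSL ℝ ζ).smulRight (2 * Real.pi * Complex.I * wave ζ p)) p := by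
  have h1 : HasFDerivAt (fun p => ((2 * Real.pi * inner ℝ ζ p : ℝ) : ℂ) * Complex.I)
      ((innerSL ℝ ζ).smulRight (2 * Real.pi * Complex.I)) p := by
    have e : (fun p => ((2 * Real.pi * inner ℝ ζ p : ℝ) : ℂ) * Complex.I)
        = (innerSL ℝ ζ).smulRight (2 * Real.pi * Complex.I) := by
      ext1 p
      simp only [ContinuousLinearMap.smulRight_apply, innerSL_apply_apply, Complex.real_smul]
      push_cast
      ring
    rw [e]
    exact ContinuousLinearMap.hasFDerivAt _
  refine h1.cexp.congr_fderiv ?_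
  ext v
  simp only [ContinuousLinearMap.smulRight_apply, smul_apply, wave,
    smul_eq_mul, Complex.real_smul]
  ring

lemma moderateL2_inner_smul {h : SpaceTime n → Val n} (hh : ModerateL2 h) (v : SpaceTime n) :
    ModerateL2 fun ζ => (2 * Real.pi * Complex.I * (inner ℝ ζ v : ℝ) : ℂ) • h ζ := by
  refine hh.smul (C := 2 * Real.pi * ‖v‖) (Continuous.aestronglyMeasurable (by fun_prop))
    fun ζ => ?_
  rw [norm_mul, norm_mul, norm_mul, Complex.norm_I, Complex.norm_real, Complex.norm_real,
    Real.norm_of_nonneg Real.pi_pos.le, Complex.norm_ofNat, mul_one, mul_assoc (2 * Real.pi)]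
  refine mul_le_mul_of_nonneg_left ((norm_inner_le_norm ζ v).trans ?_) (by positivity)
  rw [mul_comm]
  refine mul_le_mul_of_nonneg_left ?_ (norm_nonneg _)
  nlinarith [sq_nonneg (‖ζ‖ - 1), norm_nonneg ζ]

/-- The norm `|ζ|` times `h`. -/
lemma moderateL2_norm_smul {h : SpaceTime n → Val n} (hh : ModerateL2 h) :
    ModerateL2 fun ζ => ((‖ζ‖ : ℝ) : ℂ) • h ζ := by
  refine hh.smul (C := 1) (Continuous.aestronglyMeasurable (by fun_prop)) fun ζ => ?_
  rw [Complex.norm_real, norm_norm]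
  nlinarith [sq_nonneg (‖ζ‖ - 1), norm_nonneg ζ]

/-- `invFourier κ ν h` is differentiable in `(p, y)` on `{y > 0}`; its partial derivatives are
functions of the same kind. -/
lemma exists_hasFDerivAt_invFourier (hn : 1 ≤ n) {κ : ℝ} (hκ : 0 < κ) {ν : ℝ} (hν : 0 < ν)
    {h : SpaceTime n → Val n} (hh : ModerateL2 h) {q : SpaceTime n × ℝ} (hq : 0 < q.2) :
    ∃ L : SpaceTime n × ℝ →L[ℝ] Val n, HasFDerivAt (invFourier κ ν h) L q ∧
      ∀ v, L v = invFourier κ ν (fun ζ => (2 * Real.pi * Complex.I * (inner ℝ ζ v.1 : ℝ) : ℂ) • h ζ) q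
        - (v.2 * (q.2 / 2)) • invFourier κ (ν + 1) h q := by
  obtain ⟨p, y⟩ := q
  have hy : 0 < y := hq
  have hm := hh.aestronglyMeasurable
  set v1 : SpaceTime n × ℝ → SpaceTime n → Val n := fun q ζ =>
    (2 * Real.pi * Complex.I * wave ζ q.1) • subLaplace ν q.2 (parSymbol κ ζ) • h ζ with hv1
  set v2 : SpaceTime n × ℝ → SpaceTime n → Val n := fun q ζ =>
    (-(q.2 / 2) * wave ζ q.1 : ℂ) • subLaplace (ν + 1) q.2 (parSymbol κ ζ) • h ζ with hv2
  set fstL : SpaceTime n × ℝ →L[ℝ] SpaceTime n := ContinuousLinearMap.fst ℝ (SpaceTime n) ℝ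
  set sndL : SpaceTime n × ℝ →L[ℝ] ℝ := ContinuousLinearMap.snd ℝ (SpaceTime n) ℝ
  set F' : SpaceTime n × ℝ → SpaceTime n → SpaceTime n × ℝ →L[ℝ] Val n := fun q ζ =>
    ((innerSL ℝ ζ).comp fstL).smulRight (v1 q ζ) + sndL.smulRight (v2 q ζ) with hF'
  -- A derivative in p falls on the wave and costs |ζ|, hence the bound for |ζ| h; a derivative in y
  -- raises ν, hence the second bound with ν + 1.
  obtain ⟨B1, hB1, -, H1⟩ := (moderateL2_norm_smul hh).exists_bound hn hκ hν
    (a := y / 2) (b := 2 * y) (by linarith)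
  obtain ⟨B2, hB2, -, H2⟩ := hh.exists_bound hn hκ (ν := ν + 1) (by linarith)
    (a := y / 2) (b := 2 * y) (by linarith)
  have hS : (univ ×ˢ Ioo (y / 2) (2 * y) : Set (SpaceTime n × ℝ)) ∈ 𝓝 (p, y) :=
    prod_mem_nhds univ_mem (Ioo_mem_nhds (by linarith) (by linarith))
  have hF'm : AEStronglyMeasurable (F' (p, y)) volume := by
    have m1 : AEStronglyMeasurable (v1 (p, y)) volume :=
      (Continuous.aestronglyMeasurable ((continuous_wave p).const_mul _)).smul
        (aestronglyMeasurable_subLaplace_smul κ ν y hm)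
    have m2 : AEStronglyMeasurable (v2 (p, y)) volume :=
      (Continuous.aestronglyMeasurable ((continuous_wave p).const_mul _)).smul
        (aestronglyMeasurable_subLaplace_smul κ (ν + 1) y hm)
    have c : Continuous fun ζ : SpaceTime n => (innerSL ℝ ζ).comp fstL := by fun_prop
    have s1 := (ContinuousLinearMap.smulRightL ℝ (SpaceTime n × ℝ)
      (Val n)).aestronglyMeasurable_comp₂ c.aestronglyMeasurable m1
    have s2 := (ContinuousLinearMap.smulRightL ℝ (SpaceTime n × ℝ)
      (Val n)).aestronglyMeasurable_comp₂
      (aestronglyMeasurable_const (b := sndL)) m2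
    exact s1.add s2
  have hbound : ∀ᵐ ζ, ∀ q ∈ (univ ×ˢ Ioo (y / 2) (2 * y) : Set (SpaceTime n × ℝ)),
      ‖F' q ζ‖ ≤ 2 * Real.pi * B1 ζ + y * B2 ζ := by
    filter_upwards [H1, H2] with ζ h1 h2 q hq
    have hq2 : q.2 ∈ Icc (y / 2) (2 * y) := Ioo_subset_Icc_self hq.2
    have hq0 : 0 < q.2 := by have := hq.2.1; linarith
    have h1 := h1 q.2 hq2
    have h2 := h2 q.2 hq2
    have hf : ‖fstL‖ ≤ 1 := ContinuousLinearMap.norm_fst_le ℝ (SpaceTime n) ℝ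
    have hs : ‖sndL‖ ≤ 1 := ContinuousLinearMap.norm_snd_le ℝ (SpaceTime n) ℝ
    have b1 : ‖(innerSL ℝ ζ).comp fstL‖ ≤ ‖ζ‖ := by
      refine (ContinuousLinearMap.opNorm_comp_le _ _).trans ?_
      rw [innerSL_apply_norm]
      exact mul_le_of_le_one_right (norm_nonneg _) hf
    refine (norm_add_le _ _).trans (add_le_add ?_ ?_)
    · rw [ContinuousLinearMap.norm_smulRight_apply]
      refine (mul_le_mul_of_nonneg_right b1 (norm_nonneg _)).trans (le_of_eq_of_le ?_
        (mul_le_mul_of_nonneg_left h1 (by positivity : 0 ≤ 2 * Real.pi)))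
      simp only [hv1, norm_smul, norm_mul, norm_wave, Complex.norm_I, Complex.norm_real, norm_norm,
        Real.norm_of_nonneg Real.pi_pos.le, Complex.norm_ofNat]
      ring
    · rw [ContinuousLinearMap.norm_smulRight_apply]
      have e : ‖v2 q ζ‖ = q.2 / 2 * ‖subLaplace (ν + 1) q.2 (parSymbol κ ζ) • h ζ‖ := by
        simp only [hv2]
        rw [norm_smul, norm_mul, norm_neg, norm_wave, norm_div, Complex.norm_real,
          Real.norm_of_nonneg hq0.le, Complex.norm_ofNat, mul_one]
      rw [e]
      have := hq2.2
      calc _ ≤ 1 * (y * B2 ζ) := by gcongr; linarith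
        _ = _ := one_mul _
  have hdiff : ∀ᵐ ζ, ∀ q ∈ (univ ×ˢ Ioo (y / 2) (2 * y) : Set (SpaceTime n × ℝ)),
      HasFDerivAt (fun q : SpaceTime n × ℝ => wave ζ q.1 • subLaplace ν q.2 (parSymbol κ ζ) • h ζ)
        (F' q ζ) q := by
    refine Eventually.of_forall fun ζ q hq => ?_
    have hq0 : 0 < q.2 := by have := hq.2.1; linarith
    have d1 : HasFDerivAt (fun q : SpaceTime n × ℝ => wave ζ q.1) _ q :=
      (hasFDerivAt_wave ζ q.1).comp q fstL.hasFDerivAt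
    have d2 : HasFDerivAt (fun q : SpaceTime n × ℝ => subLaplace ν q.2 (parSymbol κ ζ)) _ q :=
      (hasDerivAt_subLaplace hν hq0 (parSymbol_re_nonneg hκ.le ζ)).hasFDerivAt.comp q
        sndL.hasFDerivAt
    have d3 := (d1.mul d2).smul_const (h ζ)
    have e : (fun q : SpaceTime n × ℝ => wave ζ q.1 • subLaplace ν q.2 (parSymbol κ ζ) • h ζ)
        = fun q => (wave ζ q.1 * subLaplace ν q.2 (parSymbol κ ζ)) • h ζ := by
      ext1 q; rw [smul_smul]
    rw [e]
    refine d3.congr_fderiv ?_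
    refine ContinuousLinearMap.ext fun v => ?_
    simp only [hF', hv1, hv2, ContinuousLinearMap.smulRight_apply, add_apply,
      smul_apply, ContinuousLinearMap.comp_apply, innerSL_apply_apply,
      ContinuousLinearMap.toSpanSingleton_apply, smul_eq_mul, Complex.real_smul]
    simp only [← Complex.coe_smul, smul_smul, ← add_smul]
    congr 1
    ring
  have hmeas : ∀ᶠ q in 𝓝 (p, y), AEStronglyMeasurable
      (fun ζ => wave ζ q.1 • subLaplace ν q.2 (parSymbol κ ζ) • h ζ) volume :=
    Eventually.of_forall fun q => (continuous_wave q.1).aestronglyMeasurable.smul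
      (aestronglyMeasurable_subLaplace_smul κ ν q.2 hm)
  have int_wave : ∀ {g : SpaceTime n → Val n}, Integrable g volume →
      Integrable (fun ζ => wave ζ p • g ζ) volume := fun hg =>
    hg.bdd_smul 1 (continuous_wave p).aestronglyMeasurable
      (Eventually.of_forall fun ζ => (norm_wave ζ p).le)
  have hBint : Integrable (fun ζ => 2 * Real.pi * B1 ζ + y * B2 ζ) volume :=
    (hB1.const_mul _).add (hB2.const_mul _)
  have key := hasFDerivAt_integral_of_dominated_of_fderiv_le hS hmeas
    (int_wave (hh.integrable hn hκ hν hy)) hF'm hbound hBint hdiff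
  have hF'i : Integrable (F' (p, y)) volume := by
    refine hBint.mono' hF'm ?_
    filter_upwards [hbound] with ζ hζ
    exact hζ (p, y) (mem_of_mem_nhds hS)
  refine ⟨∫ ζ, F' (p, y) ζ, ?_, fun v => ?_⟩
  · refine key.congr_of_eventuallyEq (Eventually.of_forall fun q => ?_)
    rw [invFourier, fourierInv_eq_wave]
  · rw [ContinuousLinearMap.integral_apply hF'i]
    have i1 := int_wave ((moderateL2_inner_smul hh v.1).integrable hn hκ hν hy)
    have i2 := int_wave (hh.integrable hn hκ (ν := ν + 1) (by linarith) hy)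
    have i3 : Integrable (fun ζ => (v.2 * (y / 2)) • wave ζ p •
        subLaplace (ν + 1) y (parSymbol κ ζ) • h ζ) volume := i2.smul (v.2 * (y / 2))
    simp only [invFourier, fourierInv_eq_wave]
    rw [← integral_smul, ← integral_sub i1 i3]
    refine integral_congr_ae (Eventually.of_forall fun ζ => ?_)
    simp only [hF', hv1, hv2, ContinuousLinearMap.smulRight_apply, add_apply,
      ContinuousLinearMap.comp_apply, innerSL_apply_apply]
    simp only [← Complex.coe_smul, smul_smul, ← add_smul, ← sub_smul]
    congr 1
    change ((inner ℝ ζ v.1 : ℝ) : ℂ) * _ + ((v.2 : ℝ) : ℂ) * _ = _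
    push_cast
    ring

instance : ContinuousSMul ℝ (SpaceTime n) :=
  @IsBoundedSMul.continuousSMul ℝ (SpaceTime n) _ _ _ _ _ NormedSpace.toIsBoundedSMul

instance : ContinuousSMul ℝ (SpaceTime n × ℝ) :=
  @Prod.continuousSMul ℝ (SpaceTime n) ℝ _ _ _ _ _ inferInstance inferInstance

lemma differentiableOn_invFourier (hn : 1 ≤ n) {κ : ℝ} (hκ : 0 < κ) {ν : ℝ} (hν : 0 < ν)
    {h : SpaceTime n → Val n} (hh : ModerateL2 h) :
    DifferentiableOn ℝ (invFourier κ ν h) {q | 0 < q.2} := by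
  intro q hq
  obtain ⟨L, hL, -⟩ := exists_hasFDerivAt_invFourier hn hκ hν hh (q := q) hq
  exact hL.differentiableAt.differentiableWithinAt

lemma fderiv_invFourier_apply (hn : 1 ≤ n) {κ : ℝ} (hκ : 0 < κ) {ν : ℝ} (hν : 0 < ν)
    {h : SpaceTime n → Val n} (hh : ModerateL2 h) {q : SpaceTime n × ℝ} (hq : 0 < q.2)
    (v : SpaceTime n × ℝ) :
    fderiv ℝ (invFourier κ ν h) q v
      = invFourier κ ν (fun ζ => (2 * Real.pi * Complex.I * (inner ℝ ζ v.1 : ℝ) : ℂ) • h ζ) q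
        - (v.2 * (q.2 / 2)) • invFourier κ (ν + 1) h q := by
  obtain ⟨L, hL, H⟩ := exists_hasFDerivAt_invFourier hn hκ hν hh hq
  rw [hL.fderiv, H]

/-- The partial derivatives are again of this kind, with a polynomial multiple of h or with ν + 1,
so the regularity bootstraps once ν and h are kept general in the induction. -/
lemma contDiffOn_invFourier (hn : 1 ≤ n) {κ : ℝ} (hκ : 0 < κ) (k : ℕ) :
    ∀ {ν : ℝ}, 0 < ν → ∀ {h : SpaceTime n → Val n}, ModerateL2 h →
      ContDiffOn ℝ k (invFourier κ ν h) {q | 0 < q.2} := by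
  have hopen : IsOpen {q : SpaceTime n × ℝ | 0 < q.2} := isOpen_lt continuous_const continuous_snd
  induction k with
  | zero =>
    intro ν hν h hh
    have hc := (differentiableOn_invFourier hn hκ hν hh).continuousOn
    rw [Nat.cast_zero]
    exact contDiffOn_zero.2 hc
  | succ k ih =>
    intro ν hν h hh
    rw [Nat.cast_add, Nat.cast_one]
    refine (contDiffOn_succ_iff_fderiv_of_isOpen hopen).2
      ⟨differentiableOn_invFourier hn hκ hν hh, by simp, contDiffOn_clm_apply.2 fun v => ?_⟩
    have h1 := ih hν (moderateL2_inner_smul hh v.1)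
    have h2 := ih (ν := ν + 1) (by linarith) hh
    have h3 : ContDiffOn ℝ k (fun q : SpaceTime n × ℝ => v.2 * (q.2 / 2)) {q | 0 < q.2} :=
      ContDiff.contDiffOn (by fun_prop)
    exact (h1.sub (h3.smul h2)).congr fun q hq => fderiv_invFourier_apply hn hκ hν hh hq v

/-! ### The projection onto the direction of the frequency -/

/-- The orthogonal projection `ξ ⊗ ξ / |ξ|²`. -/
def dirProj (ξ : Space n) : Matrix (Fin n) (Fin n) ℂ :=
  Matrix.of fun j k => ((ξ j * ξ k / ‖ξ‖ ^ 2 : ℝ) : ℂ)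

lemma dirProj_apply (ξ : Space n) (j k : Fin n) :
    dirProj ξ j k = ((ξ j * ξ k / ‖ξ‖ ^ 2 : ℝ) : ℂ) := rfl

lemma dirProj_smul {c : ℝ} (hc : c ≠ 0) (ξ : Space n) : dirProj (c • ξ) = dirProj ξ := by
  ext j k
  rw [dirProj_apply, dirProj_apply, norm_smul, mul_pow, Real.norm_eq_abs, sq_abs,
    PiLp.smul_apply, PiLp.smul_apply, smul_eq_mul, smul_eq_mul]
  congr 1
  rw [show c * ξ j * (c * ξ k) = c ^ 2 * (ξ j * ξ k) by ring, mul_div_mul_left _ _ (by positivity)]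

/-- At ξ = 0 division by zero makes the matrix zero, which is still idempotent, so no frequency has
to be excluded. -/
lemma dirProj_mul_self (ξ : Space n) : dirProj ξ * dirProj ξ = dirProj ξ := by
  ext j k
  simp only [Matrix.mul_apply, dirProj_apply, ← Complex.ofReal_mul, ← Complex.ofReal_sum]
  congr 1
  by_cases h : ξ = 0
  · simp [h]
  have h0 : ‖ξ‖ ^ 2 ≠ 0 := by simpa using h
  have e : ∀ l, ξ j * ξ l / ‖ξ‖ ^ 2 * (ξ l * ξ k / ‖ξ‖ ^ 2)
      = ξ j * ξ k / (‖ξ‖ ^ 2 * ‖ξ‖ ^ 2) * ξ l ^ 2 := fun l => by field_simp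
  simp only [e]
  rw [← Finset.mul_sum, ← EuclideanSpace.real_norm_sq_eq]
  field_simp

lemma norm_dirProj_apply_le (ξ : Space n) (j k : Fin n) : ‖dirProj ξ j k‖ ≤ 1 := by
  rw [dirProj_apply, Complex.norm_real, norm_div, norm_mul, norm_pow, norm_norm]
  refine div_le_one_of_le₀ ?_ (by positivity)
  rw [sq]
  exact mul_le_mul (PiLp.norm_apply_le ξ j) (PiLp.norm_apply_le ξ k) (norm_nonneg _) (norm_nonneg _)

lemma measurable_dirProj_apply (j k : Fin n) : Measurable fun ξ : Space n => dirProj ξ j k := by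
  simp only [dirProj_apply]
  have h : ∀ i : Fin n, Measurable fun ξ : Space n => ξ i := fun i =>
    (EuclideanSpace.proj (𝕜 := ℝ) i).continuous.measurable
  have := h j
  have := h k
  fun_prop

/-! ### The action of matrices -/

lemma act_apply (A : Matrix (Fin n) (Fin n) ℂ) (v : Val n) (j : Fin n) :
    act A v j = ∑ k, A j k * v k := rfl

lemma act_add (A B : Matrix (Fin n) (Fin n) ℂ) (v : Val n) :
    act (A + B) v = act A v + act B v := by
  simp only [act, Matrix.add_mulVec, WithLp.toLp_add]

lemma act_smul (c : ℂ) (A : Matrix (Fin n) (Fin n) ℂ) (v : Val n) :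
    act (c • A) v = c • act A v := by
  simp only [act, Matrix.smul_mulVec, WithLp.toLp_smul]

lemma act_one (v : Val n) : act 1 v = v := by
  simp [act]

lemma act_mul (A B : Matrix (Fin n) (Fin n) ℂ) (v : Val n) : act (A * B) v = act A (act B v) := by
  simp only [act, Matrix.mulVec_mulVec]

/-- The complexification of a real vector. -/
def complexify (ξ : Space n) : Val n := WithLp.toLp 2 fun j => (ξ j : ℂ)

lemma norm_complexify (ξ : Space n) : ‖complexify ξ‖ = ‖ξ‖ := by
  rw [EuclideanSpace.norm_eq, EuclideanSpace.norm_eq]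
  simp [complexify]

lemma inner_complexify (ξ : Space n) (v : Val n) :
    inner ℂ (complexify ξ) v = ∑ k, (ξ k : ℂ) * v k := by
  simp [PiLp.inner_apply, complexify, mul_comm]

lemma act_dirProj (ξ : Space n) (v : Val n) :
    act (dirProj ξ) v = (inner ℂ (complexify ξ) v / (‖ξ‖ ^ 2 : ℝ) : ℂ) • complexify ξ := by
  ext j
  rw [act_apply, PiLp.smul_apply, inner_complexify, smul_eq_mul, Finset.sum_div, Finset.sum_mul]
  refine Finset.sum_congr rfl fun k _ => ?_
  simp only [dirProj_apply, complexify]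
  push_cast
  ring

lemma norm_act_dirProj_le (ξ : Space n) (v : Val n) : ‖act (dirProj ξ) v‖ ≤ ‖v‖ := by
  rw [act_dirProj, norm_smul, norm_complexify, norm_div, Complex.norm_real, norm_pow, norm_norm]
  rcases (norm_nonneg ξ).eq_or_lt with h | h
  · rw [← h, mul_zero]
    exact norm_nonneg v
  · have h1 := norm_inner_le_norm (𝕜 := ℂ) (complexify ξ) v
    rw [norm_complexify] at h1
    rw [div_mul_eq_mul_div, div_le_iff₀ (by positivity)]
    nlinarith

lemma aestronglyMeasurable_act {α : Type*} [MeasurableSpace α] {m : Measure α}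
    {A : α → Matrix (Fin n) (Fin n) ℂ} (hA : ∀ j k, AEMeasurable (fun a => A a j k) m)
    {v : α → Val n} (hv : AEStronglyMeasurable v m) :
    AEStronglyMeasurable (fun a => act (A a) (v a)) m := by
  have hv' : ∀ k, AEMeasurable (fun a => v a k) m := fun k =>
    (EuclideanSpace.proj (𝕜 := ℂ) k).continuous.measurable.comp_aemeasurable hv.aemeasurable
  refine AEMeasurable.aestronglyMeasurable ?_
  refine (WithLp.measurable_toLp 2 (Fin n → ℂ)).comp_aemeasurable (aemeasurable_pi_iff.2 fun j => ?_)
  change AEMeasurable (fun a => ∑ k, A a j k * v a k) m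
  exact Finset.aemeasurable_fun_sum _ fun k _ => (hA j k).mul (hv' k)

/-! ### The symbol of the Lamé operator and its exponential -/

/-- This spectral decomposition splits the system into two scalar heat equations with diffusion
constants μ and 2μ + λ. At ξ = 0 both sides vanish. -/
lemma lameSymbol_eq (μ lam : ℝ) (ξ : Space n) :
    lameSymbol μ lam ξ = ((μ * ‖ξ‖ ^ 2 : ℝ) : ℂ) • (1 - dirProj ξ)
      + (((2 * μ + lam) * ‖ξ‖ ^ 2 : ℝ) : ℂ) • dirProj ξ := by
  ext j k
  obtain ⟨p, hp, e⟩ : ∃ p, ξ j * ξ k / ‖ξ‖ ^ 2 = p ∧ ξ j * ξ k = ‖ξ‖ ^ 2 * p := by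
    refine ⟨_, rfl, ?_⟩
    by_cases h : ξ = 0
    · simp [h]
    · have h0 : ‖ξ‖ ^ 2 ≠ 0 := by simpa using h
      field_simp
  simp only [lameSymbol, Matrix.of_apply, Matrix.add_apply, Matrix.smul_apply, Matrix.sub_apply,
    Matrix.one_apply, dirProj_apply, smul_eq_mul]
  rw [hp, e]
  split_ifs <;> push_cast <;> ring

/-- The matrices 1 - P and P are complementary idempotents, so powers, and hence the exponential
series, act on the two coefficients separately. -/
lemma exp_smul_add_smul {m : Type*} [Fintype m] [DecidableEq m] {P : Matrix m m ℂ}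
    (hP : P * P = P) (a b : ℂ) :
    NormedSpace.exp (a • (1 - P) + b • P) = Complex.exp a • (1 - P) + Complex.exp b • P := by
  have hQ : (1 - P) * (1 - P) = 1 - P := by rw [mul_sub, sub_mul, sub_mul, hP]; simp
  have hQP : (1 - P) * P = 0 := by rw [sub_mul, hP, one_mul, sub_self]
  have hPQ : P * (1 - P) = 0 := by rw [mul_sub, hP, mul_one, sub_self]
  have hpow : ∀ k : ℕ, (a • (1 - P) + b • P) ^ k = a ^ k • (1 - P) + b ^ k • P := by
    intro k
    induction k with
    | zero => simp
    | succ k ih =>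
      rw [pow_succ, ih]
      simp only [mul_add, add_mul, smul_mul_assoc, mul_smul_comm, hQ, hP, hQP, hPQ, smul_zero,
        add_zero, zero_add, smul_smul, pow_succ, mul_comm]
  have hexp : ∀ z : ℂ, HasSum (fun k : ℕ => (k.factorial : ℂ)⁻¹ • z ^ k) (Complex.exp z) := by
    intro z
    rw [Complex.exp_eq_exp_ℂ]
    exact NormedSpace.exp_series_hasSum_exp' z
  rw [NormedSpace.exp_eq_tsum ℂ]
  refine HasSum.tsum_eq ?_
  have h := ((hexp a).smul_const (1 - P)).add ((hexp b).smul_const P)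
  refine h.congr_fun ?_
  intro k
  simp only [hpow, smul_add, smul_assoc]

lemma exp_lameSymbol (μ lam : ℝ) (ξ : Space n) (t : ℝ) :
    NormedSpace.exp (-(t : ℂ) • lameSymbol μ lam ξ)
      = Complex.exp (-(t * ((μ * ‖ξ‖ ^ 2 : ℝ) : ℂ))) • (1 - dirProj ξ)
        + Complex.exp (-(t * (((2 * μ + lam) * ‖ξ‖ ^ 2 : ℝ) : ℂ))) • dirProj ξ := by
  rw [lameSymbol_eq, smul_add, smul_smul, smul_smul, neg_mul, neg_mul,
    exp_smul_add_smul (dirProj_mul_self ξ)]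

/-! ### The space-time kernels -/

/-- Fourier inversion in time for the subordination kernels. -/
lemma fourierInv_subLaplace_line {ν y r : ℝ} (hν : 0 < ν) (hy : 0 < y) (hr : 0 < r) {τ : ℝ}
    (hτ : τ ≠ 0) :
    𝓕⁻ (fun σ : ℝ => subLaplace ν y ((r : ℂ) + Complex.I * ((2 * Real.pi * σ : ℝ) : ℂ))) τ
      = if 0 < τ then (subKernel ν y τ : ℂ) * Complex.exp (-(τ * (r : ℂ))) else 0 := by
  set f0 : ℝ → ℂ := fun τ => (subKernel ν y τ : ℂ) * Complex.exp (-(τ * (r : ℂ))) with hf0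
  set f : ℝ → ℂ := (Ioi (0 : ℝ)).indicator f0 with hf
  have hre : ∀ σ : ℝ, ((r : ℂ) + Complex.I * ((2 * Real.pi * σ : ℝ) : ℂ)).re = r := by
    intro σ
    simp [-Complex.ofReal_mul]
  have him : ∀ σ : ℝ, ((r : ℂ) + Complex.I * ((2 * Real.pi * σ : ℝ) : ℂ)).im
      = 2 * Real.pi * σ := by
    intro σ
    simp [-Complex.ofReal_mul]
  have hfi : Integrable f :=
    (integrable_indicator_iff measurableSet_Ioi).2
      (integrableOn_subKernel_mul_exp hν hy (by simpa using hr.le))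
  have hF : 𝓕 f
      = fun σ : ℝ => subLaplace ν y ((r : ℂ) + Complex.I * ((2 * Real.pi * σ : ℝ) : ℂ)) := by
    ext1 σ
    rw [Real.fourier_real_eq_integral_exp_smul, subLaplace, ← integral_indicator measurableSet_Ioi]
    refine integral_congr_ae (Eventually.of_forall fun v => ?_)
    simp only [hf, indicator_apply]
    split_ifs
    · simp only [hf0, smul_eq_mul]
      rw [mul_comm, mul_assoc, ← Complex.exp_add]
      congr 2
      push_cast
      ring
    · simp
  -- Decay of orders 0 and 2 in z gives the integrable majorant 1/(1 + σ²).
  have hFi : Integrable (𝓕 f) := by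
    obtain ⟨C0, -, H0⟩ := exists_norm_pow_mul_subLaplace_le (b := y) hy 0 hν
    obtain ⟨C2, -, H2⟩ := exists_norm_pow_mul_subLaplace_le (b := y) hy 2 hν
    rw [hF]
    refine (integrable_inv_one_add_sq.const_mul (C0 + C2)).mono' ?_
      (Eventually.of_forall fun σ => ?_)
    · exact ((measurable_subLaplace ν y).comp (by fun_prop)).aestronglyMeasurable
    · set z := (r : ℂ) + Complex.I * ((2 * Real.pi * σ : ℝ) : ℂ) with hz
      have hzr : 0 < z.re := by rw [hre]; exact hr
      have h0 := H0 y ⟨le_rfl, le_rfl⟩ z hzr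
      have h2 := H2 y ⟨le_rfl, le_rfl⟩ z hzr
      have h1 : σ ^ 2 ≤ ‖z‖ ^ 2 := by
        rw [← sq_abs σ]
        refine pow_le_pow_left₀ (abs_nonneg _) (le_trans ?_ (Complex.abs_im_le_norm z)) 2
        rw [him, abs_mul, abs_of_pos (by positivity : 0 < 2 * Real.pi)]
        nlinarith [Real.pi_gt_three, abs_nonneg σ]
      rw [pow_zero, one_mul] at h0
      rw [← div_eq_mul_inv, le_div_iff₀ (by positivity)]
      nlinarith [mul_le_mul_of_nonneg_right h1 (norm_nonneg (subLaplace ν y z))]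
  -- Away from τ = 0 the cutoff to positive times is locally constant, so Fourier inversion holds at
  -- the point τ.
  have hc : ContinuousAt f τ := by
    rcases hτ.lt_or_gt with h | h
    · refine continuousAt_const.congr (f := fun _ => (0 : ℂ)) ?_
      filter_upwards [Iio_mem_nhds h] with t ht
      exact (indicator_of_notMem (by simpa using le_of_lt ht) _).symm
    · have : ContinuousAt f0 τ := by
        refine ContinuousAt.mul ?_ (by fun_prop)
        exact (hasDerivAt_subKernel ν y h).ofReal_comp.continuousAt
      refine this.congr ?_
      filter_upwards [Ioi_mem_nhds h] with t ht
      exact (indicator_of_mem ht _).symm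
  have key := hfi.fourierInv_fourier_eq hFi hc
  rw [hF] at key
  rw [key, hf, indicator_apply]
  rfl

lemma moderateL2_of_bounded {h : SpaceTime n → Val n} (hm : AEStronglyMeasurable h volume) {C : ℝ}
    (hC : ∀ ζ, ‖h ζ‖ ≤ C) : ModerateL2 h := by
  obtain ⟨M, hM⟩ := memLp_inv_pow_one_add_norm_sq (n := n)
  refine ⟨M, hM.of_le_mul (c := C) (hM.1.smul hm) (Eventually.of_forall fun ζ => ?_)⟩
  rw [norm_smul, mul_comm]
  exact mul_le_mul_of_nonneg_right (hC ζ) (norm_nonneg _)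

lemma wave_toLp (ξ x : Space n) (σ τ : ℝ) :
    wave (WithLp.toLp 2 (ξ, σ)) (WithLp.toLp 2 (x, τ))
      = Complex.exp ((2 * Real.pi * inner ℝ ξ x : ℝ) * Complex.I)
        * Complex.exp ((2 * Real.pi * inner ℝ σ τ : ℝ) * Complex.I) := by
  rw [wave, ← Complex.exp_add, WithLp.prod_inner_apply]
  congr 1
  push_cast
  ring

/-- By Fubini the integral in σ comes first. For ξ ≠ 0 it is the inversion of the Laplace transform
on the line Re z = κ|2πξ|², and what remains is the spatial inverse transform of a Gaussian
multiplier. -/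
lemma fourierInv_subLaplace_smul (hn : 1 ≤ n) {κ : ℝ} (hκ : 0 < κ) {ν y : ℝ} (hν : 0 < ν)
    (hy : 0 < y) {φ : Space n → Val n} (hφ : Measurable φ) {C : ℝ} (hC : ∀ ξ, ‖φ ξ‖ ≤ C)
    (x : Space n) {τ : ℝ} (hτ : τ ≠ 0) :
    𝓕⁻ (fun ζ : SpaceTime n => subLaplace ν y (parSymbol κ ζ) • φ ζ.fst) (WithLp.toLp 2 (x, τ))
      = if 0 < τ then (subKernel ν y τ : ℂ) • 𝓕⁻ (fun ξ : Space n =>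
          Complex.exp (-(τ * ((κ * ‖(2 * Real.pi) • ξ‖ ^ 2 : ℝ) : ℂ))) • φ ξ) x else 0 := by
  have hfst : Measurable fun ζ : SpaceTime n => ζ.fst := (WithLp.continuous_fst 2 _ _).measurable
  have hmod : ModerateL2 fun ζ : SpaceTime n => φ ζ.fst :=
    moderateL2_of_bounded (hφ.comp hfst).aestronglyMeasurable fun ζ => hC ζ.fst
  have hint := hmod.integrable hn hκ hν hy
  have hmp := WithLp.volume_preserving_toLp (Space n) ℝ
  have hemb : MeasurableEmbedding (WithLp.toLp 2 : Space n × ℝ → SpaceTime n) :=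
    (MeasurableEquiv.toLp 2 (Space n × ℝ)).measurableEmbedding
  have hint2 : Integrable (fun ζ => wave ζ (WithLp.toLp 2 (x, τ)) •
      subLaplace ν y (parSymbol κ ζ) • φ ζ.fst) volume :=
    hint.bdd_smul 1 (continuous_wave _).aestronglyMeasurable
      (Eventually.of_forall fun ζ => (norm_wave ζ _).le)
  have hint3 := (hmp.integrable_comp_emb hemb).2 hint2
  rw [Measure.volume_eq_prod] at hint3
  rw [fourierInv_eq_wave, ← hmp.integral_comp hemb, Measure.volume_eq_prod]
  refine (integral_prod _ hint3).trans ?_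
  have : Nonempty (Fin n) := ⟨⟨0, hn⟩⟩
  have hne : ∀ᵐ ξ : Space n, ξ ≠ 0 := by
    rw [ae_iff]
    simp
  have hinner : ∀ᵐ ξ : Space n, ∫ σ : ℝ, wave (WithLp.toLp 2 (ξ, σ)) (WithLp.toLp 2 (x, τ)) •
        subLaplace ν y (parSymbol κ (WithLp.toLp 2 (ξ, σ))) • φ (WithLp.toLp 2 (ξ, σ)).fst
      = Complex.exp ((2 * Real.pi * inner ℝ ξ x : ℝ) * Complex.I) •
        (if 0 < τ then (subKernel ν y τ : ℂ) * Complex.exp (-(τ * ((κ * ‖(2 * Real.pi) • ξ‖ ^ 2 : ℝ) : ℂ)))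
          else 0) • φ ξ := by
    filter_upwards [hne] with ξ hξ
    have hr : 0 < κ * ‖(2 * Real.pi) • ξ‖ ^ 2 := by
      rw [norm_two_pi_smul_sq]
      have := norm_pos_iff.2 hξ
      positivity
    rw [← fourierInv_subLaplace_line hν hy hr hτ, Real.fourierInv_eq', ← integral_smul_const,
      ← integral_smul]
    refine integral_congr_ae (Eventually.of_forall fun σ => ?_)
    simp only [wave_toLp, smul_smul, smul_eq_mul]
    rw [mul_assoc (Complex.exp _)]
    rfl
  change ∫ ξ, ∫ σ, wave (WithLp.toLp 2 (ξ, σ)) (WithLp.toLp 2 (x, τ)) •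
        subLaplace ν y (parSymbol κ (WithLp.toLp 2 (ξ, σ))) • φ (WithLp.toLp 2 (ξ, σ)).fst = _
  rw [integral_congr_ae hinner]
  split_ifs with h
  · rw [Real.fourierInv_eq', ← integral_smul]
    refine integral_congr_ae (Eventually.of_forall fun ξ => ?_)
    simp only [smul_smul]
    congr 1
    ring
  · simp

/-! ### Pairing with an `L²` function -/

/-- Componentwise complex conjugation. -/
def conjVal (v : Val n) : Val n := WithLp.toLp 2 fun k => (starRingEnd ℂ) (v k)

lemma conjVal_apply (v : Val n) (k : Fin n) : conjVal v k = (starRingEnd ℂ) (v k) := rfl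

lemma norm_conjVal (v : Val n) : ‖conjVal v‖ = ‖v‖ := by
  rw [EuclideanSpace.norm_eq, EuclideanSpace.norm_eq]
  simp [conjVal]

lemma continuous_conjVal : Continuous (conjVal : Val n → Val n) := by
  refine (PiLp.continuous_toLp 2 _).comp (continuous_pi fun k => ?_)
  exact Complex.continuous_conj.comp (EuclideanSpace.proj (𝕜 := ℂ) k).continuous

lemma inner_conjVal (v w : Val n) : inner ℂ (conjVal v) w = ∑ k, v k * w k := by
  simp [PiLp.inner_apply, conjVal, mul_comm]

lemma integrable_wave_smul {F : Type*} [NormedAddCommGroup F] [NormedSpace ℂ F]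
    {g : SpaceTime n → F} (hg : Integrable g volume) (p : SpaceTime n) :
    Integrable (fun ζ => wave ζ p • g ζ) volume :=
  hg.bdd_smul 1 (continuous_wave p).aestronglyMeasurable
    (Eventually.of_forall fun ζ => (norm_wave ζ p).le)

lemma fourierInv_apply {R : SpaceTime n → Val n} (hR : Integrable R volume) (p : SpaceTime n)
    (k : Fin n) : 𝓕⁻ R p k = ∫ ζ, wave ζ p * R ζ k := by
  rw [fourierInv_eq_wave]
  exact eval_integral_piLp (fun i => (integrable_wave_smul hR p).eval_piLp i) k

lemma conj_wave_mul (ζ p q : SpaceTime n) :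
    (starRingEnd ℂ) (wave ζ (p - q)) = wave ζ q * (starRingEnd ℂ) (wave ζ p) := by
  simp only [wave]
  rw [← Complex.exp_conj, ← Complex.exp_conj, ← Complex.exp_add, inner_sub_right]
  congr 1
  simp only [map_mul, Complex.conj_ofReal, Complex.conj_I]
  push_cast
  ring

/-- Parseval's identity for the convolution of an inverse Fourier transform with an `L²`
function. -/
lemma integral_fourierInv_mul {R : SpaceTime n → Val n} (h1 : Integrable R volume)
    (h2 : MemLp R 2 volume) {u : SpaceTime n → Val n} (hu : MemLp u 2 volume) (p : SpaceTime n) :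
    Integrable (fun q => ∑ k, 𝓕⁻ R (p - q) k * u q k) volume ∧
    ∫ q, ∑ k, 𝓕⁻ R (p - q) k * u q k = ∫ ζ, wave ζ p * ∑ k, R ζ k * fourierL2 u ζ k := by
  -- The conjugations and the modulation are chosen so that 𝓕⁻ R' at q is the conjugate of 𝓕⁻ R at p
  -- - q; the L² inner product with u is then the bilinear convolution.
  set R' : SpaceTime n → Val n := fun ζ => (starRingEnd ℂ) (wave ζ p) • conjVal (R ζ) with hR'
  have hnorm : ∀ ζ, ‖R' ζ‖ = ‖R ζ‖ := by
    intro ζ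
    rw [hR', norm_smul, RCLike.norm_conj, norm_wave, one_mul, norm_conjVal]
  have hm : AEStronglyMeasurable R' volume :=
    (Complex.continuous_conj.comp (continuous_wave p)).aestronglyMeasurable.smul
      (continuous_conjVal.comp_aestronglyMeasurable h1.1)
  have h1' : Integrable R' volume :=
    h1.mono hm (Eventually.of_forall fun ζ => (hnorm ζ).le)
  have h2' : MemLp R' 2 volume := h2.of_le hm (Eventually.of_forall fun ζ => (hnorm ζ).le)
  have hf : ∀ q, 𝓕⁻ R' q = conjVal (𝓕⁻ R (p - q)) := by
    intro q
    ext k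
    rw [conjVal_apply, fourierInv_apply h1', fourierInv_apply h1, ← integral_conj]
    refine integral_congr_ae (Eventually.of_forall fun ζ => ?_)
    simp only [hR', map_mul, conj_wave_mul, PiLp.smul_apply, conjVal_apply, smul_eq_mul, mul_assoc]
  have hinner : ∀ q, inner ℂ (𝓕⁻ R' q) (u q) = ∑ k, 𝓕⁻ R (p - q) k * u q k := fun q => by
    rw [hf, inner_conjVal]
  have hinner' : ∀ ζ, inner ℂ (R' ζ) (fourierL2 u ζ)
      = wave ζ p * ∑ k, R ζ k * fourierL2 u ζ k := fun ζ => by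
    rw [hR', inner_smul_left, Complex.conj_conj, inner_conjVal]
  have hfm := memLp_fourierInv h1' h2'
  have e1 : (fun q => inner ℂ (hfm.toLp _ q) (hu.toLp _ q)) =ᵐ[volume]
      fun q => ∑ k, 𝓕⁻ R (p - q) k * u q k := by
    filter_upwards [hfm.coeFn_toLp, hu.coeFn_toLp] with q a b
    rw [a, b, hinner]
  refine ⟨(L2.integrable_inner (𝕜 := ℂ) (hfm.toLp _) (hu.toLp _)).congr e1, ?_⟩
  rw [← integral_congr_ae e1, ← L2.inner_def, ← Lp.inner_fourier_eq, toLp_fourierInv h1' h2',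
    FourierTransform.fourier_fourierInv_eq, L2.inner_def]
  refine integral_congr_ae ?_
  rw [← MemLp.fourierL2_eq hu]
  filter_upwards [h2'.coeFn_toLp] with ζ a
  rw [a, hinner']

/-! ### The Poisson kernel as an inverse Fourier transform -/

/-- The rows of a matrix. -/
def rowVec (A : Matrix (Fin n) (Fin n) ℂ) (j : Fin n) : Val n := WithLp.toLp 2 (A j)

lemma rowVec_apply (A : Matrix (Fin n) (Fin n) ℂ) (j k : Fin n) : rowVec A j k = A j k := rfl

lemma measurable_rowVec {α : Type*} [MeasurableSpace α] {A : α → Matrix (Fin n) (Fin n) ℂ}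
    (hA : ∀ j k, Measurable fun a => A a j k) (j : Fin n) : Measurable fun a => rowVec (A a) j :=
  (WithLp.measurable_toLp 2 (Fin n → ℂ)).comp (measurable_pi_iff.2 fun k => hA j k)

lemma norm_rowVec_le {A : Matrix (Fin n) (Fin n) ℂ} {C : ℝ} (hC : ∀ j k, ‖A j k‖ ≤ C)
    (j : Fin n) : ‖rowVec A j‖ ≤ n * C := by
  have : rowVec A j = ∑ k, EuclideanSpace.single k (A j k) := by
    ext i
    simp [rowVec]
  rw [this]
  refine (norm_sum_le _ _).trans ?_
  simp only [PiLp.norm_single]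
  exact (Finset.sum_le_sum fun k _ => hC j k).trans (by simp)

lemma measurable_one_sub_dirProj (j k : Fin n) :
    Measurable fun ξ : Space n => (1 - dirProj ξ) j k :=
  measurable_const.sub (measurable_dirProj_apply j k)

lemma norm_one_sub_dirProj_apply_le (ξ : Space n) (j k : Fin n) :
    ‖(1 - dirProj ξ) j k‖ ≤ 2 := by
  rw [Matrix.sub_apply, Matrix.one_apply]
  have h := norm_dirProj_apply_le ξ j k
  refine (norm_sub_le _ _).trans ?_
  have : ‖(if j = k then 1 else 0 : ℂ)‖ ≤ 1 := by split_ifs <;> simp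
  linarith

/-- The rows of the Fourier transform in space-time of the Poisson kernel, up to a factor. -/
def kernelSymbol (μ lam s y : ℝ) (j : Fin n) (ζ : SpaceTime n) : Val n :=
  subLaplace s y (parSymbol μ ζ) • rowVec (1 - dirProj ζ.fst) j
    + subLaplace s y (parSymbol (2 * μ + lam) ζ) • rowVec (dirProj ζ.fst) j

/-- The Poisson kernel as a function on space-time, up to a factor. -/
def stKernel (μ lam s y : ℝ) (p : SpaceTime n) : Matrix (Fin n) (Fin n) ℂ :=
  Matrix.of fun j k => 𝓕⁻ (kernelSymbol μ lam s y j) p k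

lemma moderateL2_row_dirProj (j : Fin n) :
    ModerateL2 fun ζ : SpaceTime n => rowVec (dirProj ζ.fst) j :=
  moderateL2_of_bounded ((measurable_rowVec measurable_dirProj_apply j).comp
    (WithLp.continuous_fst 2 _ _).measurable).aestronglyMeasurable
    fun ζ => norm_rowVec_le (norm_dirProj_apply_le ζ.fst) j

lemma moderateL2_row_one_sub_dirProj (j : Fin n) :
    ModerateL2 fun ζ : SpaceTime n => rowVec (1 - dirProj ζ.fst) j :=
  moderateL2_of_bounded ((measurable_rowVec measurable_one_sub_dirProj j).comp
    (WithLp.continuous_fst 2 _ _).measurable).aestronglyMeasurable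
    fun ζ => norm_rowVec_le (norm_one_sub_dirProj_apply_le ζ.fst) j

lemma integrable_kernelSymbol (hn : 1 ≤ n) {μ lam s y : ℝ} (hμ : 0 < μ)
    (hlam : 0 < 2 * μ + lam) (hs : 0 < s) (hy : 0 < y) (j : Fin n) :
    Integrable (kernelSymbol μ lam s y j) volume :=
  ((moderateL2_row_one_sub_dirProj j).integrable hn hμ hs hy).add
    ((moderateL2_row_dirProj j).integrable hn hlam hs hy)

lemma memLp_kernelSymbol (hn : 1 ≤ n) {μ lam s y : ℝ} (hμ : 0 < μ)
    (hlam : 0 < 2 * μ + lam) (hs : 0 < s) (hy : 0 < y) (j : Fin n) :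
    MemLp (kernelSymbol μ lam s y j) 2 volume :=
  ((moderateL2_row_one_sub_dirProj j).memLp hn hμ hs hy).add
    ((moderateL2_row_dirProj j).memLp hn hlam hs hy)

lemma integrable_gaussian_smul {κ τ : ℝ} (hκ : 0 < κ) (hτ : 0 < τ) {φ : Space n → Val n}
    (hφ : Measurable φ) {C : ℝ} (hC : ∀ ξ, ‖φ ξ‖ ≤ C) :
    Integrable fun ξ : Space n =>
      Complex.exp (-(τ * ((κ * ‖(2 * Real.pi) • ξ‖ ^ 2 : ℝ) : ℂ))) • φ ξ := by
  have h := GaussianFourier.integrable_cexp_neg_mul_sq_norm_add (V := Space n)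
    (b := ((τ * κ * (2 * Real.pi) ^ 2 : ℝ) : ℂ)) (by rw [Complex.ofReal_re]; positivity) 0 0
  have h' : Integrable fun ξ : Space n =>
      Complex.exp (-(τ * ((κ * ‖(2 * Real.pi) • ξ‖ ^ 2 : ℝ) : ℂ))) := by
    refine h.congr (Eventually.of_forall fun ξ => ?_)
    simp only
    rw [norm_two_pi_smul_sq]
    congr 1
    push_cast
    ring
  exact h'.smul_bdd C hφ.aestronglyMeasurable (Eventually.of_forall hC)

/-- The exponential of the symbol splits along the projection, which is unaffected by the factor 2π
in the frequency. -/
lemma heatKernel_apply {μ lam : ℝ} (hμ : 0 < μ) (hlam : 0 < 2 * μ + lam) (x : Space n) {τ : ℝ}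
    (hτ : 0 < τ) (j k : Fin n) :
    heatKernel μ lam x τ j k
      = 𝓕⁻ (fun ξ : Space n => Complex.exp (-(τ * ((μ * ‖(2 * Real.pi) • ξ‖ ^ 2 : ℝ) : ℂ))) •
          rowVec (1 - dirProj ξ) j) x k
        + 𝓕⁻ (fun ξ : Space n =>
          Complex.exp (-(τ * (((2 * μ + lam) * ‖(2 * Real.pi) • ξ‖ ^ 2 : ℝ) : ℂ))) •
          rowVec (dirProj ξ) j) x k := by
  have key : ∀ {g : Space n → Val n}, Integrable g → Integrable (fun ξ =>
      Complex.exp ((2 * Real.pi * inner ℝ ξ x : ℝ) * Complex.I) • g ξ) := fun hg =>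
    hg.bdd_smul 1 (Continuous.aestronglyMeasurable (by fun_prop))
      (Eventually.of_forall fun ξ => (Complex.norm_exp_ofReal_mul_I _).le)
  have i1 := key (integrable_gaussian_smul hμ hτ (measurable_rowVec measurable_one_sub_dirProj j)
    fun ξ => norm_rowVec_le (norm_one_sub_dirProj_apply_le ξ) j)
  have i2 := key (integrable_gaussian_smul hlam hτ (measurable_rowVec measurable_dirProj_apply j)
    fun ξ => norm_rowVec_le (norm_dirProj_apply_le ξ) j)
  rw [heatKernel, Matrix.of_apply, Real.fourierInv_eq', Real.fourierInv_eq', Real.fourierInv_eq',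
    eval_integral_piLp (fun i => i1.eval_piLp i), eval_integral_piLp (fun i => i2.eval_piLp i),
    ← integral_add (i1.eval_piLp k) (i2.eval_piLp k)]
  refine integral_congr_ae (Eventually.of_forall fun ξ => ?_)
  simp only [exp_lameSymbol, dirProj_smul (by positivity : 2 * Real.pi ≠ 0), Matrix.add_apply,
    Matrix.smul_apply, PiLp.smul_apply, rowVec_apply, smul_add]

lemma fourierInv_kernelSymbol (hn : 1 ≤ n) {μ lam s y : ℝ} (hμ : 0 < μ)
    (hlam : 0 < 2 * μ + lam) (hs : 0 < s) (hy : 0 < y) (j : Fin n) (p : SpaceTime n) :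
    𝓕⁻ (kernelSymbol μ lam s y j) p
      = 𝓕⁻ (fun ζ => subLaplace s y (parSymbol μ ζ) • rowVec (1 - dirProj ζ.fst) j) p
        + 𝓕⁻ (fun ζ => subLaplace s y (parSymbol (2 * μ + lam) ζ) • rowVec (dirProj ζ.fst) j) p := by
  rw [fourierInv_eq_wave, fourierInv_eq_wave, fourierInv_eq_wave, ← integral_add
    (integrable_wave_smul ((moderateL2_row_one_sub_dirProj j).integrable hn hμ hs hy) p)
    (integrable_wave_smul ((moderateL2_row_dirProj j).integrable hn hlam hs hy) p)]
  simp only [kernelSymbol, smul_add]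

/-- The kernel is causal: it vanishes for τ < 0. This is why the Poisson integral over positive τ is
a convolution over all of space-time, to which Parseval applies. -/
lemma stKernel_apply (hn : 1 ≤ n) {μ lam s y : ℝ} (hμ : 0 < μ)
    (hlam : 0 < 2 * μ + lam) (hs : 0 < s) (hy : 0 < y) (x : Space n) {τ : ℝ} (hτ : τ ≠ 0) :
    stKernel μ lam s y (WithLp.toLp 2 (x, τ))
      = if 0 < τ then (subKernel s y τ : ℂ) • heatKernel μ lam x τ else 0 := by
  ext j k
  rw [stKernel, Matrix.of_apply, fourierInv_kernelSymbol hn hμ hlam hs hy,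
    fourierInv_subLaplace_smul hn hμ hs hy (measurable_rowVec measurable_one_sub_dirProj j)
      (fun ξ => norm_rowVec_le (norm_one_sub_dirProj_apply_le ξ) j) x hτ,
    fourierInv_subLaplace_smul hn hlam hs hy (measurable_rowVec measurable_dirProj_apply j)
      (fun ξ => norm_rowVec_le (norm_dirProj_apply_le ξ) j) x hτ]
  split_ifs with h
  · rw [Matrix.smul_apply, heatKernel_apply hμ hlam x h, PiLp.add_apply, PiLp.smul_apply,
      PiLp.smul_apply, smul_add]
  · simp

/-- The normalizing constant of the Poisson kernel. -/
def poissonConst (s : ℝ) : ℝ := 1 / ((2 : ℝ) ^ (2 * s) * Real.Gamma s)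

lemma poissonKernel_eq (hn : 1 ≤ n) {μ lam s y : ℝ} (hμ : 0 < μ)
    (hlam : 0 < 2 * μ + lam) (hs : 0 < s) (hy : 0 < y) (x z : Space n) {τ : ℝ} (hτ : 0 < τ) :
    poissonKernel μ lam s y x z τ
      = ((poissonConst s * y ^ (2 * s) : ℝ) : ℂ) •
        stKernel μ lam s y (WithLp.toLp 2 (x - z, τ)) := by
  rw [stKernel_apply hn hμ hlam hs hy _ hτ.ne', if_pos hτ, poissonKernel, smul_smul,
    ← Complex.ofReal_mul]
  congr 2
  rw [poissonConst, subKernel, show -1 - s = -(1 + s) by ring, Real.rpow_neg hτ.le]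
  ring

/-- The longitudinal part of the Fourier transform of `u`. -/
def longPart (u : SpaceTime n → Val n) (ζ : SpaceTime n) : Val n :=
  act (dirProj ζ.fst) (fourierL2 u ζ)

/-- The transversal part of the Fourier transform of `u`. -/
def transPart (u : SpaceTime n → Val n) (ζ : SpaceTime n) : Val n :=
  act (1 - dirProj ζ.fst) (fourierL2 u ζ)

lemma transPart_add_longPart (u : SpaceTime n → Val n) (ζ : SpaceTime n) :
    transPart u ζ + longPart u ζ = fourierL2 u ζ := by
  rw [transPart, longPart, ← act_add, sub_add_cancel, act_one]

lemma norm_longPart_le (u : SpaceTime n → Val n) (ζ : SpaceTime n) :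
    ‖longPart u ζ‖ ≤ ‖fourierL2 u ζ‖ := norm_act_dirProj_le _ _

/-- The factor 2 is just the triangle inequality; orthogonality would give 1, but constants play no
role. -/
lemma norm_transPart_le (u : SpaceTime n → Val n) (ζ : SpaceTime n) :
    ‖transPart u ζ‖ ≤ 2 * ‖fourierL2 u ζ‖ := by
  rw [eq_sub_of_add_eq (transPart_add_longPart u ζ)]
  linarith [norm_sub_le (fourierL2 u ζ) (longPart u ζ), norm_longPart_le u ζ]

lemma memLp_longPart (u : SpaceTime n → Val n) : MemLp (longPart u) 2 volume :=
  (memLp_fourierL2 u).of_le (aestronglyMeasurable_act (fun j k =>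
    ((measurable_dirProj_apply j k).comp (WithLp.continuous_fst 2 _ _).measurable).aemeasurable)
    (memLp_fourierL2 u).1) (Eventually.of_forall (norm_longPart_le u))

lemma memLp_transPart (u : SpaceTime n → Val n) : MemLp (transPart u) 2 volume := by
  have : transPart u = fourierL2 u - longPart u :=
    funext fun ζ => eq_sub_of_add_eq (transPart_add_longPart u ζ)
  rw [this]
  exact (memLp_fourierL2 u).sub (memLp_longPart u)

/-- The map `(τ, z) ↦ (z, t - τ)`. -/
def reflectTime (n : ℕ) (t : ℝ) : ℝ × Space n ≃ᵐ SpaceTime n :=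
  ((MeasurableEquiv.subLeft t).prodCongr (MeasurableEquiv.refl (Space n))).trans
    (MeasurableEquiv.prodComm.trans (MeasurableEquiv.toLp 2 (Space n × ℝ)))

lemma reflectTime_apply (t : ℝ) (q : ℝ × Space n) :
    reflectTime n t q = WithLp.toLp 2 (q.2, t - q.1) := rfl

lemma measurePreserving_reflectTime (t : ℝ) :
    MeasurePreserving (reflectTime n t) (volume.prod volume) volume := by
  have h1 : MeasurePreserving (Prod.map (fun τ : ℝ => t - τ) (id : Space n → Space n))
      (volume.prod volume) (volume.prod volume) :=
    (Measure.measurePreserving_sub_left volume t).prod (MeasurePreserving.id volume)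
  have h2 := (Measure.measurePreserving_swap (μ := (volume : Measure ℝ))
    (ν := (volume : Measure (Space n)))).comp h1
  exact (WithLp.volume_preserving_toLp (Space n) ℝ).comp h2

/-- The absolute convergence of the Poisson integral, and its Fourier representation. -/
lemma poisson_representation (hn : 1 ≤ n) {μ lam s y : ℝ} (hμ : 0 < μ)
    (hlam : 0 < 2 * μ + lam) (hs : 0 < s) (hy : 0 < y) {u : SpaceTime n → Val n}
    (hu : MemLp u 2 volume) (x : Space n) (t : ℝ) :
    Integrable (Function.uncurry (poissonIntegrand μ lam s u x y t))
      ((volume.restrict (Ioi (0 : ℝ))).prod volume) ∧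
    extension μ lam s u x y t = (poissonConst s * y ^ (2 * s)) •
      (invFourier μ s (transPart u) (WithLp.toLp 2 (x, t), y)
        + invFourier (2 * μ + lam) s (longPart u) (WithLp.toLp 2 (x, t), y)) := by
  set p : SpaceTime n := WithLp.toLp 2 (x, t) with hp
  set c : ℝ := poissonConst s * y ^ (2 * s) with hc
  set G : SpaceTime n → Val n := fun q => (c : ℂ) • act (stKernel μ lam s y (p - q)) (u q) with hG
  -- Each row of the kernel has a transform in L¹ ∩ L², so Parseval with u ∈ L² gives absolute
  -- convergence at every point p together with the Fourier representation.
  have pair := fun j : Fin n => integral_fourierInv_mul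
    (integrable_kernelSymbol hn hμ hlam hs hy j) (memLp_kernelSymbol hn hμ hlam hs hy j) hu p
  have hGint : Integrable G volume :=
    (Integrable.of_eval_piLp fun j => (pair j).1).smul (c : ℂ)
  have hGsum : ∫ q, G q = (c : ℂ) • (invFourier μ s (transPart u) (p, y)
        + invFourier (2 * μ + lam) s (longPart u) (p, y)) := by
    rw [hG, integral_smul]
    congr 1
    ext j
    have i1 := (MemLp.moderateL2 (memLp_transPart u)).integrable hn hμ hs hy
    have i2 := (MemLp.moderateL2 (memLp_longPart u)).integrable hn hlam hs hy
    rw [eval_integral_piLp fun j => (pair j).1, PiLp.add_apply, invFourier, invFourier,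
      fourierInv_apply i1, fourierInv_apply i2, ← integral_add]
    · refine ((pair j).2).trans (integral_congr_ae (Eventually.of_forall fun ζ => ?_))
      simp only [kernelSymbol, PiLp.add_apply, PiLp.smul_apply, rowVec_apply, smul_eq_mul,
        transPart, longPart, act_apply, add_mul, Finset.sum_add_distrib, mul_assoc, ← mul_add,
        ← Finset.mul_sum]
    · exact (integrable_wave_smul i1 p).eval_piLp j
    · exact (integrable_wave_smul i2 p).eval_piLp j
  have hmp := measurePreserving_reflectTime (n := n) t
  have hFint : Integrable (G ∘ reflectTime n t) ((volume : Measure ℝ).prod volume) :=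
    (hmp.integrable_comp_emb (reflectTime n t).measurableEmbedding).2 hGint
  have hpq : ∀ q : ℝ × Space n, p - reflectTime n t q = WithLp.toLp 2 (x - q.2, q.1) := by
    intro q
    rw [reflectTime_apply, hp, ← WithLp.toLp_sub, Prod.mk_sub_mk, sub_sub_cancel]
  have hpos : ∀ q : ℝ × Space n, 0 < q.1 → (G ∘ reflectTime n t) q
      = Function.uncurry (poissonIntegrand μ lam s u x y t) q := by
    rintro ⟨τ, z⟩ hτ
    simp only [Function.comp, hG, hpq, Function.uncurry, poissonIntegrand]
    rw [poissonKernel_eq hn hμ hlam hs hy x z hτ, act_smul]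
    rfl
  have hneg : ∀ q : ℝ × Space n, q.1 < 0 → (G ∘ reflectTime n t) q = 0 := by
    rintro ⟨τ, z⟩ hτ
    have hτ' : τ < 0 := hτ
    simp only [Function.comp, hG, hpq]
    rw [stKernel_apply hn hμ hlam hs hy _ hτ'.ne, if_neg hτ'.not_gt]
    simp [act]
  have hS : (volume.restrict (Ioi (0 : ℝ))).prod (volume : Measure (Space n))
      = (volume.prod volume).restrict (Ioi (0 : ℝ) ×ˢ univ) := by
    rw [← Measure.prod_restrict, Measure.restrict_univ]
  have hmeas : MeasurableSet (Ioi (0 : ℝ) ×ˢ (univ : Set (Space n))) :=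
    measurableSet_Ioi.prod MeasurableSet.univ
  have hae : (G ∘ reflectTime n t) =ᵐ[(volume.restrict (Ioi (0 : ℝ))).prod volume]
      Function.uncurry (poissonIntegrand μ lam s u x y t) := by
    rw [hS]
    filter_upwards [ae_restrict_mem hmeas] with q hq
    exact hpos q hq.1
  have hint : Integrable (Function.uncurry (poissonIntegrand μ lam s u x y t))
      ((volume.restrict (Ioi (0 : ℝ))).prod volume) := by
    refine Integrable.congr ?_ hae
    rw [hS]
    exact hFint.integrableOn
  refine ⟨hint, ?_⟩
  have e := integral_prod _ hint
  simp only [Function.uncurry] at e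
  rw [extension, ← Complex.coe_smul, ← hGsum, ← hmp.integral_comp (reflectTime n t).measurableEmbedding, ← e]
  refine (integral_congr_ae hae).symm.trans ?_
  rw [hS]
  -- Negative times contribute nothing by causality, and τ = 0 is a null set.
  refine setIntegral_eq_integral_of_ae_compl_eq_zero ?_
  have hz : ∀ᵐ q : ℝ × Space n ∂(volume.prod volume), q.1 ≠ 0 := by
    refine Measure.quasiMeasurePreserving_fst.ae (p := fun τ : ℝ => τ ≠ 0) ?_
    rw [ae_iff]
    simp
  filter_upwards [hz] with q hq hq'
  refine hneg q (lt_of_le_of_ne (not_lt.1 fun h => hq' ⟨h, mem_univ _⟩) hq)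

/-! ### Derivatives of the extension -/

/-- Multiplication by the symbol `2πi⟨ζ, v⟩` of the directional derivative along `v`. -/
def dirMul (v : SpaceTime n) (h : SpaceTime n → Val n) (ζ : SpaceTime n) : Val n :=
  (2 * Real.pi * Complex.I * (inner ℝ ζ v : ℝ) : ℂ) • h ζ

lemma ModerateL2.dirMul {h : SpaceTime n → Val n} (hh : ModerateL2 h) (v : SpaceTime n) :
    ModerateL2 (dirMul v h) := moderateL2_inner_smul hh v

/-- The map `(x, y, t) ↦ ((x, t), y)`. -/
def coordMap (n : ℕ) : Space n × ℝ × ℝ →L[ℝ] SpaceTime n × ℝ :=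
  (((WithLp.prodContinuousLinearEquiv 2 ℝ (Space n) ℝ).symm : Space n × ℝ →L[ℝ] SpaceTime n).comp
    ((ContinuousLinearMap.fst ℝ (Space n) (ℝ × ℝ)).prod
      ((ContinuousLinearMap.snd ℝ ℝ ℝ).comp (ContinuousLinearMap.snd ℝ (Space n) (ℝ × ℝ))))).prod
    ((ContinuousLinearMap.fst ℝ ℝ ℝ).comp (ContinuousLinearMap.snd ℝ (Space n) (ℝ × ℝ)))

lemma coordMap_apply (x : Space n) (y t : ℝ) :
    coordMap n (x, y, t) = ((WithLp.toLp 2 (x, t) : SpaceTime n), y) := rfl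

lemma hasFDerivAt_invFourier_space (hn : 1 ≤ n) {κ : ℝ} (hκ : 0 < κ) {ν : ℝ} (hν : 0 < ν)
    {h : SpaceTime n → Val n} (hh : ModerateL2 h) (x : Space n) {y : ℝ} (hy : 0 < y) (t : ℝ) :
    ∃ L : Space n →L[ℝ] Val n,
      HasFDerivAt (fun x => invFourier κ ν h (WithLp.toLp 2 (x, t), y)) L x ∧
      ∀ v, L v = invFourier κ ν (dirMul (WithLp.toLp 2 (v, 0)) h) (WithLp.toLp 2 (x, t), y) := by
  obtain ⟨L, hL, H⟩ := exists_hasFDerivAt_invFourier hn hκ hν hh (q := coordMap n (x, y, t)) hy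
  have h1 := (hL.comp (x, y, t) (coordMap n).hasFDerivAt).comp x
    (hasFDerivAt_prodMk_left (𝕜 := ℝ) x (y, t))
  refine ⟨_, h1, fun v => ?_⟩
  change L (coordMap n (v, 0, 0)) = _
  rw [H, coordMap_apply, zero_mul, zero_smul, sub_zero]
  rfl

lemma hasDerivAt_invFourier_time (hn : 1 ≤ n) {κ : ℝ} (hκ : 0 < κ) {ν : ℝ} (hν : 0 < ν)
    {h : SpaceTime n → Val n} (hh : ModerateL2 h) (x : Space n) {y : ℝ} (hy : 0 < y) (t : ℝ) :
    HasDerivAt (fun t => invFourier κ ν h (WithLp.toLp 2 (x, t), y))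
      (invFourier κ ν (dirMul (WithLp.toLp 2 (0, 1)) h) (WithLp.toLp 2 (x, t), y)) t := by
  obtain ⟨L, hL, H⟩ := exists_hasFDerivAt_invFourier hn hκ hν hh (q := coordMap n (x, y, t)) hy
  have h1 := (hL.comp (x, y, t) (coordMap n).hasFDerivAt).comp t
    ((hasFDerivAt_prodMk_right (𝕜 := ℝ) x (y, t)).comp t (hasFDerivAt_prodMk_right (𝕜 := ℝ) y t))
  refine h1.hasDerivAt.congr_deriv ?_
  change L (coordMap n (0, 0, 1)) = _
  rw [H, coordMap_apply, zero_mul, zero_smul, sub_zero]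
  rfl

lemma hasDerivAt_invFourier_y (hn : 1 ≤ n) {κ : ℝ} (hκ : 0 < κ) {ν : ℝ} (hν : 0 < ν)
    {h : SpaceTime n → Val n} (hh : ModerateL2 h) (p : SpaceTime n) {y : ℝ} (hy : 0 < y) :
    HasDerivAt (fun y => invFourier κ ν h (p, y)) (-(y / 2) • invFourier κ (ν + 1) h (p, y)) y := by
  obtain ⟨L, hL, H⟩ := exists_hasFDerivAt_invFourier hn hκ hν hh (q := (p, y)) hy
  have h1 := hL.comp y (hasFDerivAt_prodMk_right (𝕜 := ℝ) p y)
  refine h1.hasDerivAt.congr_deriv ?_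
  change L (0, 1) = _
  rw [H, one_mul, invFourier, invFourier, fourierInv_eq_wave]
  simp [neg_smul]

lemma contDiff_invFourier_space (hn : 1 ≤ n) {κ : ℝ} (hκ : 0 < κ) {ν : ℝ} (hν : 0 < ν)
    {h : SpaceTime n → Val n} (hh : ModerateL2 h) {y : ℝ} (hy : 0 < y) (t : ℝ) (k : ℕ) :
    ContDiff ℝ k fun x : Space n => invFourier κ ν h (WithLp.toLp 2 (x, t), y) := by
  have h1 : ContDiff ℝ k fun x : Space n => coordMap n (x, y, t) :=
    (coordMap n).contDiff.comp (contDiff_id.prodMk contDiff_const)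
  exact (contDiffOn_invFourier hn hκ k hν hh).comp_contDiff h1 fun x => hy

lemma contDiffOn_invFourier_coord (hn : 1 ≤ n) {κ : ℝ} (hκ : 0 < κ) {ν : ℝ} (hν : 0 < ν)
    {h : SpaceTime n → Val n} (hh : ModerateL2 h) (k : ℕ) :
    ContDiffOn ℝ k (fun q : Space n × ℝ × ℝ =>
      invFourier κ ν h (WithLp.toLp 2 (q.1, q.2.2), q.2.1)) {q | 0 < q.2.1} :=
  (contDiffOn_invFourier hn hκ k hν hh).comp (coordMap n).contDiff.contDiffOn fun _ hq => hq

/-! ### The Lamé operator in terms of iterated partial derivatives -/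

/-- Here `D2 i j` stands for ∂ⱼ∂ᵢF, so `D2 j i x j` in the second term is ∂ᵢ∂ⱼFⱼ. The C² hypothesis
is what allows the first partial derivatives to be differentiated again. -/
lemma lameOp_eq {μ lam : ℝ} {F : Space n → Val n} (hF : ContDiff ℝ 2 F)
    {D : Fin n → Space n → Val n} (hD : ∀ i x, fderiv ℝ F x (EuclideanSpace.single i 1) = D i x)
    {D2 : Fin n → Fin n → Space n → Val n}
    (hD2 : ∀ i j x, fderiv ℝ (D i) x (EuclideanSpace.single j 1) = D2 i j x) (x : Space n) :
    lameOp μ lam F x = μ • ∑ i, D2 i i x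
      + (μ + lam) • (WithLp.toLp 2 fun i => ∑ j, D2 j i x j : Val n) := by
  have hfd : Differentiable ℝ (fderiv ℝ F) :=
    (hF.fderiv_right (m := 1) (by norm_num)).differentiable one_ne_zero
  have hD' : ∀ i, D i = fun x => fderiv ℝ F x (EuclideanSpace.single i 1) := fun i =>
    funext fun x => (hD i x).symm
  have hDd : ∀ i, Differentiable ℝ (D i) := fun i => by
    rw [hD']
    exact hfd.clm_apply (differentiable_const _)
  have hlap : Δ F x = ∑ i, D2 i i x := by
    rw [InnerProductSpace.laplacian_eq_iteratedFDeriv_orthonormalBasis F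
      (EuclideanSpace.basisFun (Fin n) ℝ)]
    refine Finset.sum_congr rfl fun i _ => ?_
    rw [iteratedFDeriv_two_apply, EuclideanSpace.basisFun_apply, ← hD2, hD',
      fderiv_clm_apply (hfd x) (differentiableAt_const _)]
    simp
  have hdiv : divergence F = fun x => ∑ j, D j x j := by
    ext1 x
    simp only [divergence, hD]
  have hgrad : grad (divergence F) x = WithLp.toLp 2 fun i => ∑ j, D2 j i x j := by
    rw [hdiv, grad]
    congr 1
    ext1 i
    have hj : ∀ j, HasFDerivAt (fun x => D j x j)
        (((EuclideanSpace.proj (𝕜 := ℂ) j).restrictScalars ℝ).comp (fderiv ℝ (D j) x)) x := fun j =>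
      ((EuclideanSpace.proj (𝕜 := ℂ) j).restrictScalars ℝ).hasFDerivAt.comp x
        (hDd j x).hasFDerivAt
    rw [(HasFDerivAt.fun_sum fun j _ => hj j).fderiv, _root_.sum_apply]
    refine Finset.sum_congr rfl fun j _ => ?_
    rw [← hD2]
    rfl
  rw [lameOp, hlap, hgrad]

/-! ### The extension equation -/

/-- Multiplication by the symbol `2πiξᵢ` of the partial derivative `∂ᵢ`. -/
def partialMul (i : Fin n) (h : SpaceTime n → Val n) : SpaceTime n → Val n :=
  dirMul (WithLp.toLp 2 (EuclideanSpace.single i 1, 0)) h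

lemma partialMul_apply (i : Fin n) (h : SpaceTime n → Val n) (ζ : SpaceTime n) :
    partialMul i h ζ = (2 * Real.pi * Complex.I * (ζ.fst i : ℝ) : ℂ) • h ζ := by
  rw [partialMul, dirMul, WithLp.prod_inner_apply]
  simp [EuclideanSpace.inner_single_right]

lemma ModerateL2.partialMul {h : SpaceTime n → Val n} (hh : ModerateL2 h) (i : Fin n) :
    ModerateL2 (partialMul i h) := hh.dirMul _

lemma timeMul_apply (h : SpaceTime n → Val n) (ζ : SpaceTime n) :
    dirMul (WithLp.toLp 2 (0, 1)) h ζ = (2 * Real.pi * Complex.I * (ζ.snd : ℝ) : ℂ) • h ζ := by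
  rw [dirMul, WithLp.prod_inner_apply]
  simp

/-- Multiplication by the symbol `-κ|ξ|²` of `κΔ`. -/
def laplaceMul (κ : ℝ) (h : SpaceTime n → Val n) (ζ : SpaceTime n) : Val n :=
  ((-(κ * ‖(2 * Real.pi) • ζ.fst‖ ^ 2) : ℝ) : ℂ) • h ζ

lemma ModerateL2.laplaceMul {h : SpaceTime n → Val n} (hh : ModerateL2 h) (κ : ℝ) :
    ModerateL2 (laplaceMul κ h) := by
  have hfst : Continuous fun ζ : SpaceTime n => ζ.fst := WithLp.continuous_fst 2 _ _
  refine hh.smul (C := |κ| * (2 * Real.pi) ^ 2) (Continuous.aestronglyMeasurable (by fun_prop))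
    fun ζ => ?_
  rw [Complex.norm_real, norm_neg, norm_mul, Real.norm_eq_abs, norm_pow, norm_norm,
    norm_two_pi_smul_sq, ← mul_assoc, WithLp.prod_norm_sq_eq_of_L2]
  refine mul_le_mul_of_nonneg_left ?_ (by positivity)
  linarith [sq_nonneg ‖ζ.snd‖]

lemma norm_sq_mul_act_dirProj (ξ : Space n) (v : Val n) (i : Fin n) :
    ((‖ξ‖ ^ 2 : ℝ) : ℂ) * act (dirProj ξ) v i = ξ i * ∑ j, (ξ j : ℂ) * v j := by
  by_cases h : ξ = 0
  · simp [h]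
  have h0 : (‖ξ‖ : ℂ) ≠ 0 := by simpa using h
  rw [act_apply, Finset.mul_sum, Finset.mul_sum]
  refine Finset.sum_congr rfl fun j _ => ?_
  rw [dirProj_apply]
  push_cast
  field_simp

/-- On the range and on the kernel of the projection onto the direction of the frequency the Lamé
operator acts like a multiple of the Laplacian. -/
lemma lame_invFourier (hn : 1 ≤ n) {κ : ℝ} (hκ : 0 < κ) {ν : ℝ} (hν : 0 < ν)
    {g : SpaceTime n → Val n} (hg : ModerateL2 g) {ε : ℝ}
    (hP : ∀ ζ : SpaceTime n, act (dirProj ζ.fst) (g ζ) = (ε : ℂ) • g ζ) {μ lam : ℝ}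
    {q : SpaceTime n × ℝ} (hq : 0 < q.2) :
    μ • ∑ i, invFourier κ ν (partialMul i (partialMul i g)) q
      + (μ + lam) •
        (WithLp.toLp 2 fun i => ∑ j, invFourier κ ν (partialMul i (partialMul j g)) q j : Val n)
      = invFourier κ ν (laplaceMul (μ + (μ + lam) * ε) g) q := by
  have int : ∀ {h : SpaceTime n → Val n}, ModerateL2 h →
      Integrable (fun ζ => subLaplace ν q.2 (parSymbol κ ζ) • h ζ) volume := fun hh =>
    hh.integrable hn hκ hν hq
  have inti : ∀ {h : SpaceTime n → Val n}, ModerateL2 h → ∀ i, Integrable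
      (fun ζ => wave ζ q.1 * (subLaplace ν q.2 (parSymbol κ ζ) • h ζ) i) volume := fun hh i =>
    (integrable_wave_smul (int hh) q.1).eval_piLp i
  ext i
  simp only [PiLp.add_apply, PiLp.smul_apply, WithLp.ofLp_sum, Finset.sum_apply,
    Complex.real_smul]
  simp only [invFourier, fourierInv_apply (int (hg.laplaceMul _)),
    fourierInv_apply (int ((hg.partialMul _).partialMul _))]
  rw [← integral_finsetSum _ fun j _ => inti ((hg.partialMul j).partialMul j) i,
    ← integral_finsetSum _ fun j _ => inti ((hg.partialMul j).partialMul i) j,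
    ← integral_const_mul, ← integral_const_mul, ← integral_add
      ((integrable_finsetSum _ fun j _ => inti ((hg.partialMul j).partialMul j) i).const_mul _)
      ((integrable_finsetSum _ fun j _ => inti ((hg.partialMul j).partialMul i) j).const_mul _)]
  refine integral_congr_ae (Eventually.of_forall fun ζ => ?_)
  simp only [PiLp.smul_apply, partialMul_apply, laplaceMul, smul_eq_mul]
  have hI := Complex.I_sq
  have h1 : ∑ j, (2 * Real.pi * Complex.I * (ζ.fst j : ℝ) : ℂ) *
      ((2 * Real.pi * Complex.I * (ζ.fst j : ℝ)) * g ζ i)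
      = -((2 * Real.pi) ^ 2 * ((‖ζ.fst‖ ^ 2 : ℝ) : ℂ)) * g ζ i := by
    rw [EuclideanSpace.real_norm_sq_eq, Complex.ofReal_sum, Finset.mul_sum, ← Finset.sum_neg_distrib,
      Finset.sum_mul]
    refine Finset.sum_congr rfl fun j _ => ?_
    push_cast
    linear_combination (2 * Real.pi * (ζ.fst j : ℂ)) ^ 2 * g ζ i * hI
  -- By the hypothesis on the projection, ξᵢ⟨ξ, g⟩ = |ξ|² (Pg)ᵢ = ε|ξ|² gᵢ; the sign comes from i² =
  -- -1.
  have h2 : ∑ j, (2 * Real.pi * Complex.I * (ζ.fst i : ℝ) : ℂ) *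
      ((2 * Real.pi * Complex.I * (ζ.fst j : ℝ)) * g ζ j)
      = -((2 * Real.pi) ^ 2 * ((‖ζ.fst‖ ^ 2 : ℝ) : ℂ)) * (ε * g ζ i) := by
    have e := norm_sq_mul_act_dirProj ζ.fst (g ζ) i
    rw [hP, PiLp.smul_apply, smul_eq_mul, Finset.mul_sum] at e
    rw [neg_mul, mul_assoc (_ ^ 2), e, Finset.mul_sum, ← Finset.sum_neg_distrib]
    refine Finset.sum_congr rfl fun j _ => ?_
    linear_combination (2 * Real.pi) ^ 2 * (ζ.fst i : ℂ) * ζ.fst j * g ζ j * hI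
  simp only [mul_left_comm _ (subLaplace ν q.2 (parSymbol κ ζ))]
  rw [← Finset.mul_sum, ← Finset.mul_sum, ← Finset.mul_sum, ← Finset.mul_sum, h1, h2,
    norm_two_pi_smul_sq]
  push_cast
  ring

/-- The symbol of ∂ₜ is iσ = z - κ|ξ|², and z L_ν is given by the recursion `mul_subLaplace`. -/
lemma timeMul_eq (hn : 1 ≤ n) {κ : ℝ} (hκ : 0 < κ) {ν : ℝ} (hν : 0 < ν)
    {g : SpaceTime n → Val n} (hg : ModerateL2 g) {q : SpaceTime n × ℝ} (hq : 0 < q.2) :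
    invFourier κ ν (dirMul (WithLp.toLp 2 (0, 1)) g) q
      = (-(1 + ν)) • invFourier κ (ν + 1) g q + (q.2 ^ 2 / 4) • invFourier κ (ν + 2) g q
        + invFourier κ ν (laplaceMul κ g) q := by
  have i1 := (integrable_wave_smul (hg.integrable hn hκ (ν := ν + 1) (by linarith) hq) q.1).smul
    (-(1 + ν))
  have i2 := (integrable_wave_smul (hg.integrable hn hκ (ν := ν + 2) (by linarith) hq) q.1).smul
    (q.2 ^ 2 / 4)
  have i3 := integrable_wave_smul ((hg.laplaceMul κ).integrable hn hκ hν hq) q.1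
  simp only [invFourier, fourierInv_eq_wave]
  rw [← integral_smul, ← integral_smul]
  refine Eq.trans (integral_congr_ae ?_) ((integral_add (i1.add i2) i3).trans
    (congrArg (· + _) (integral_add i1 i2)))
  filter_upwards [ae_parSymbol_re_pos hn hκ] with ζ hζ
  have h := mul_subLaplace (ν := ν) (by linarith) hq hζ
  simp only [timeMul_apply, laplaceMul, Pi.smul_apply, Pi.add_apply, ← Complex.coe_smul, smul_smul,
    ← add_smul]
  congr 1
  simp only [parSymbol] at h ⊢
  push_cast at h ⊢
  linear_combination wave ζ q.1 * h

section Profile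

variable {F : Type*} [NormedAddCommGroup F] [NormedSpace ℝ F] {A B D : ℝ → F}

lemma hasDerivAt_rpow_smul (s c : ℝ) {y : ℝ} (hy : 0 < y)
    (hA : HasDerivAt A (-(y / 2) • B y) y) :
    HasDerivAt (fun y => (c * y ^ (2 * s)) • A y)
      ((2 * s * c * y ^ (2 * s - 1)) • A y - (c / 2 * y ^ (2 * s + 1)) • B y) y := by
  refine (((Real.hasDerivAt_rpow_const (p := 2 * s) (Or.inl hy.ne')).const_mul c).smul
    hA).congr_deriv ?_
  rw [Real.rpow_add_one hy.ne']
  module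

/-- The Bessel operator `∂_y² + ((1 - 2s) / y) ∂_y` applied to `y^{2s} A`. -/
lemma bessel_rpow_smul (s c : ℝ) (hA : ∀ y, 0 < y → HasDerivAt A (-(y / 2) • B y) y)
    (hB : ∀ y, 0 < y → HasDerivAt B (-(y / 2) • D y) y) {y : ℝ} (hy : 0 < y) :
    iteratedDeriv 2 (fun y => (c * y ^ (2 * s)) • A y) y
        + ((1 - 2 * s) / y) • deriv (fun y => (c * y ^ (2 * s)) • A y) y
      = (c * y ^ (2 * s)) • ((-(1 + s)) • B y + (y ^ 2 / 4) • D y) := by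
  have e1 : deriv (fun y => (c * y ^ (2 * s)) • A y) =ᶠ[𝓝 y] fun y =>
      (2 * s * c * y ^ (2 * s - 1)) • A y - (c / 2 * y ^ (2 * s + 1)) • B y := by
    filter_upwards [Ioi_mem_nhds hy] with r hr
    exact (hasDerivAt_rpow_smul s c hr (hA r hr)).deriv
  have h1 := ((Real.hasDerivAt_rpow_const (p := 2 * s - 1) (Or.inl hy.ne')).const_mul
    (2 * s * c)).smul (hA y hy)
  have h2 := ((Real.hasDerivAt_rpow_const (p := 2 * s + 1) (Or.inl hy.ne')).const_mul
    (c / 2)).smul (hB y hy)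
  rw [iteratedDeriv_succ, iteratedDeriv_one, e1.deriv_eq, HasDerivAt.deriv (f := fun y => (2 * s * c * y ^ (2 * s - 1)) • A y -
    (c / 2 * y ^ (2 * s + 1)) • B y) (h1.sub h2), e1.eq_of_nhds]
  simp only [add_sub_cancel_right, Real.rpow_add_one hy.ne', Real.rpow_sub_one hy.ne']
  set p := y ^ (2 * s)
  -- The function y^{2s} is annihilated by the Bessel operator, so the terms containing A cancel.
  match_scalars <;> field_simp <;> ring

end Profile

lemma act_dirProj_longPart (u : SpaceTime n → Val n) (ζ : SpaceTime n) :
    act (dirProj ζ.fst) (longPart u ζ) = ((1 : ℝ) : ℂ) • longPart u ζ := by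
  rw [longPart, ← act_mul, dirProj_mul_self, Complex.ofReal_one, one_smul]

lemma act_dirProj_transPart (u : SpaceTime n → Val n) (ζ : SpaceTime n) :
    act (dirProj ζ.fst) (transPart u ζ) = ((0 : ℝ) : ℂ) • transPart u ζ := by
  rw [transPart, ← act_mul, mul_sub, mul_one, dirProj_mul_self, sub_self, Complex.ofReal_zero,
    zero_smul]
  simp [act]

/-- The sum of the inverse Fourier transforms of the two components. -/
def lameInv (μ lam ν : ℝ) (g₁ g₂ : SpaceTime n → Val n) (q : SpaceTime n × ℝ) : Val n :=
  invFourier μ ν g₁ q + invFourier (2 * μ + lam) ν g₂ q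

section Equation

variable {μ lam : ℝ} {g₁ g₂ : SpaceTime n → Val n}

lemma hasDerivAt_lameInv_y (hn : 1 ≤ n) (hμ : 0 < μ) (hlam : 0 < 2 * μ + lam) {ν : ℝ} (hν : 0 < ν)
    (h₁ : ModerateL2 g₁) (h₂ : ModerateL2 g₂) (p : SpaceTime n) {y : ℝ} (hy : 0 < y) :
    HasDerivAt (fun y => lameInv μ lam ν g₁ g₂ (p, y))
      (-(y / 2) • lameInv μ lam (ν + 1) g₁ g₂ (p, y)) y := by
  refine ((hasDerivAt_invFourier_y hn hμ hν h₁ p hy).add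
    (hasDerivAt_invFourier_y hn hlam hν h₂ p hy)).congr_deriv ?_
  rw [lameInv, smul_add]

lemma hasDerivAt_lameInv_time (hn : 1 ≤ n) (hμ : 0 < μ) (hlam : 0 < 2 * μ + lam) {ν : ℝ}
    (hν : 0 < ν) (h₁ : ModerateL2 g₁) (h₂ : ModerateL2 g₂) (x : Space n) {y : ℝ} (hy : 0 < y)
    (t : ℝ) : HasDerivAt (fun t => lameInv μ lam ν g₁ g₂ (WithLp.toLp 2 (x, t), y))
      (lameInv μ lam ν (dirMul (WithLp.toLp 2 (0, 1)) g₁) (dirMul (WithLp.toLp 2 (0, 1)) g₂)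
        (WithLp.toLp 2 (x, t), y)) t :=
  (hasDerivAt_invFourier_time hn hμ hν h₁ x hy t).add
    (hasDerivAt_invFourier_time hn hlam hν h₂ x hy t)

lemma hasFDerivAt_lameInv_space (hn : 1 ≤ n) (hμ : 0 < μ) (hlam : 0 < 2 * μ + lam) {ν : ℝ}
    (hν : 0 < ν) (h₁ : ModerateL2 g₁) (h₂ : ModerateL2 g₂) (x : Space n) {y : ℝ} (hy : 0 < y)
    (t c : ℝ) (i : Fin n) :
    fderiv ℝ (fun x => c • lameInv μ lam ν g₁ g₂ (WithLp.toLp 2 (x, t), y)) x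
        (EuclideanSpace.single i 1)
      = c • lameInv μ lam ν (partialMul i g₁) (partialMul i g₂) (WithLp.toLp 2 (x, t), y) := by
  obtain ⟨L₁, hL₁, H₁⟩ := hasFDerivAt_invFourier_space hn hμ hν h₁ x hy t
  obtain ⟨L₂, hL₂, H₂⟩ := hasFDerivAt_invFourier_space hn hlam hν h₂ x hy t
  have h := ((hL₁.add hL₂).const_smul c).fderiv
  refine (DFunLike.congr_fun h _).trans ?_
  change c • (L₁ _ + L₂ _) = _
  rw [H₁, H₂]
  rfl

/-- Since the projection acts as 0 on the first density and as 1 on the second, 𝕃 is μΔ on one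
summand and (2μ + λ)Δ on the other. In each case this is the diffusion constant in the accompanying
Laplace transform, as the cancellation with ∂ₜ demands. -/
lemma lameOp_lameInv (hn : 1 ≤ n) (hμ : 0 < μ) (hlam : 0 < 2 * μ + lam) {ν : ℝ}
    (hν : 0 < ν) (h₁ : ModerateL2 g₁) (h₂ : ModerateL2 g₂)
    (hP₁ : ∀ ζ : SpaceTime n, act (dirProj ζ.fst) (g₁ ζ) = ((0 : ℝ) : ℂ) • g₁ ζ)
    (hP₂ : ∀ ζ : SpaceTime n, act (dirProj ζ.fst) (g₂ ζ) = ((1 : ℝ) : ℂ) • g₂ ζ)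
    (x : Space n) {y : ℝ} (hy : 0 < y) (t c : ℝ) :
    lameOp μ lam (fun x => c • lameInv μ lam ν g₁ g₂ (WithLp.toLp 2 (x, t), y)) x
      = c • lameInv μ lam ν (laplaceMul μ g₁) (laplaceMul (2 * μ + lam) g₂)
          (WithLp.toLp 2 (x, t), y) := by
  have hC : ContDiff ℝ 2 fun x : Space n => c • lameInv μ lam ν g₁ g₂ (WithLp.toLp 2 (x, t), y) :=
    (contDiff_const (c := c)).smul ((contDiff_invFourier_space hn hμ hν h₁ hy t 2).add
      (contDiff_invFourier_space hn hlam hν h₂ hy t 2))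
  rw [lameOp_eq hC
    (fun i x => hasFDerivAt_lameInv_space hn hμ hlam hν h₁ h₂ x hy t c i)
    (fun i j x => hasFDerivAt_lameInv_space hn hμ hlam hν (h₁.partialMul i) (h₂.partialMul i)
      x hy t c j)]
  have e₁ := lame_invFourier hn hμ hν h₁ hP₁ (μ := μ) (lam := lam)
    (q := (WithLp.toLp 2 (x, t), y)) hy
  have e₂ := lame_invFourier hn hlam hν h₂ hP₂ (μ := μ) (lam := lam)
    (q := (WithLp.toLp 2 (x, t), y)) hy
  rw [show μ + (μ + lam) * 0 = μ by ring] at e₁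
  rw [show μ + (μ + lam) * 1 = 2 * μ + lam by ring] at e₂
  rw [lameInv, ← e₁, ← e₂]
  ext k
  simp only [lameInv, PiLp.add_apply, PiLp.smul_apply, WithLp.ofLp_sum, Finset.sum_apply,
    Finset.sum_add_distrib, ← Finset.smul_sum, smul_add, smul_comm c]
  abel

end Equation

lemma extension_eq (hn : 1 ≤ n) {μ lam s : ℝ} (hμ : 0 < μ) (hlam : 0 < 2 * μ + lam) (hs : 0 < s)
    {u : SpaceTime n → Val n} (hu : MemLp u 2 volume) (x : Space n) {y : ℝ} (hy : 0 < y) (t : ℝ) :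
    extension μ lam s u x y t = (poissonConst s * y ^ (2 * s)) •
      lameInv μ lam s (transPart u) (longPart u) (WithLp.toLp 2 (x, t), y) :=
  (poisson_representation hn hμ hlam hs hy hu x t).2

lemma extension_eventuallyEq (hn : 1 ≤ n) {μ lam s : ℝ} (hμ : 0 < μ) (hlam : 0 < 2 * μ + lam)
    (hs : 0 < s) {u : SpaceTime n → Val n} (hu : MemLp u 2 volume) (x : Space n) {y : ℝ}
    (hy : 0 < y) (t : ℝ) :
    (fun y => extension μ lam s u x y t) =ᶠ[𝓝 y] fun y => (poissonConst s * y ^ (2 * s)) •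
      lameInv μ lam s (transPart u) (longPart u) (WithLp.toLp 2 (x, t), y) := by
  filter_upwards [Ioi_mem_nhds hy] with r hr
  exact extension_eq hn hμ hlam hs hu x hr t

/-- The recursion writes ∂ₜ as 𝕃 plus a combination of the transforms with ν = s+1 and ν = s+2. The
same combination results from the Bessel operator applied to the profile y^{2s} L_s. -/
lemma solvesExtensionEquation (hn : 1 ≤ n) {μ lam s : ℝ} (hμ : 0 < μ) (hlam : 0 < 2 * μ + lam)
    (hs : 0 < s) {u : SpaceTime n → Val n} (hu : MemLp u 2 volume) :
    SolvesExtensionEquation μ lam s (extension μ lam s u) := by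
  have m₁ : ModerateL2 (transPart u) := MemLp.moderateL2 (memLp_transPart u)
  have m₂ : ModerateL2 (longPart u) := MemLp.moderateL2 (memLp_longPart u)
  constructor
  · have h1 : ContDiffOn ℝ 2 (fun q : Space n × ℝ × ℝ => poissonConst s * q.2.1 ^ (2 * s))
        {q | 0 < q.2.1} := by
      refine contDiffOn_const.mul (ContDiffOn.rpow_const_of_ne ?_ fun q hq => ?_)
      · exact ContDiff.contDiffOn (by fun_prop)
      · exact (show 0 < q.2.1 from hq).ne'
    refine (h1.smul ((contDiffOn_invFourier_coord hn hμ hs m₁ 2).add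
      (contDiffOn_invFourier_coord hn hlam hs m₂ 2))).congr fun q hq => ?_
    exact extension_eq hn hμ hlam hs hu q.1 hq q.2.2
  · intro x y t hy
    have ht : deriv (fun t' => extension μ lam s u x y t') t = (poissonConst s * y ^ (2 * s)) •
        lameInv μ lam s (dirMul (WithLp.toLp 2 (0, 1)) (transPart u))
          (dirMul (WithLp.toLp 2 (0, 1)) (longPart u)) (WithLp.toLp 2 (x, t), y) := by
      have e : (fun t' => extension μ lam s u x y t') = fun t' => _ :=
        funext fun t' => extension_eq hn hμ hlam hs hu x hy t'
      rw [e]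
      exact ((hasDerivAt_lameInv_time hn hμ hlam hs m₁ m₂ x hy t).const_smul
        (poissonConst s * y ^ (2 * s))).deriv
    have hx : (fun x' => extension μ lam s u x' y t) = fun x' => _ :=
      funext fun x' => extension_eq hn hμ hlam hs hu x' hy t
    have hy' := extension_eventuallyEq hn hμ hlam hs hu x hy t
    rw [ht, hx, lameOp_lameInv hn hμ hlam hs m₁ m₂ (act_dirProj_transPart u)
      (act_dirProj_longPart u) x hy, hy'.deriv_eq, hy'.iteratedDeriv_eq 2,
      bessel_rpow_smul s (poissonConst s)
        (fun y hy => hasDerivAt_lameInv_y hn hμ hlam hs m₁ m₂ (WithLp.toLp 2 (x, t)) hy)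
        (fun y hy => hasDerivAt_lameInv_y hn hμ hlam (ν := s + 1) (by linarith) m₁ m₂
          (WithLp.toLp 2 (x, t)) hy) hy, ← smul_add]
    congr 1
    rw [lameInv, timeMul_eq hn hμ hs m₁ hy, timeMul_eq hn hlam hs m₂ hy,
      show s + 1 + 1 = s + 2 by ring]
    simp only [lameInv, smul_add]
    abel

/-! ### The scalar multipliers of the extension and of its normal derivative -/

/-- The Fourier multiplier of the extension at height `y`. -/
def traceMul (s y : ℝ) (z : ℂ) : ℂ := ((poissonConst s * y ^ (2 * s) : ℝ) : ℂ) * subLaplace s y z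

/-- The Fourier multiplier of the normal derivative of the extension at height `y`. -/
def neumannMul (s y : ℝ) (z : ℂ) : ℂ :=
  ((2 * s * poissonConst s * y ^ (2 * s - 1) : ℝ) : ℂ) * subLaplace s y z
    - ((poissonConst s / 2 * y ^ (2 * s + 1) : ℝ) : ℂ) * subLaplace (s + 1) y z

section

variable {s : ℝ}

lemma poissonConst_pos (hs : 0 < s) : 0 < poissonConst s := by
  have := Real.Gamma_pos_of_pos hs
  unfold poissonConst
  positivity

/-- The normalization gives the subordination kernel total mass one, that is, the multiplier equals
1 at z = 0. -/
lemma poissonConst_mul (hs : 0 < s) {y : ℝ} (hy : 0 < y) :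
    poissonConst s * y ^ (2 * s) * ((4 / y ^ 2) ^ s * Real.Gamma s) = 1 := by
  have h1 := Real.Gamma_pos_of_pos hs
  have h2 : (2 : ℝ) ^ (2 * s) = 4 ^ s := by
    rw [Real.rpow_mul two_pos.le]
    norm_num
  have h3 : y ^ (2 * s) = (y ^ 2) ^ s := by
    rw [Real.rpow_mul hy.le, Real.rpow_two]
  have h4 : 0 < (y ^ 2) ^ s := by positivity
  rw [poissonConst, h2, h3, Real.div_rpow (by norm_num) (by positivity)]
  field_simp

lemma traceMul_eq {y : ℝ} (hy : 0 < y) (z : ℂ) :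
    traceMul s y z = (poissonConst s : ℂ) * subLaplace s 1 (y ^ 2 * z) := by
  rw [traceMul, subLaplace_scale s hy, ← mul_assoc, ← Complex.ofReal_mul, mul_assoc,
    ← Real.rpow_add hy, add_neg_cancel, Real.rpow_zero, mul_one]

lemma norm_traceMul_le_one (hs : 0 < s) {y : ℝ} (hy : 0 < y) {z : ℂ} (hz : 0 ≤ z.re) :
    ‖traceMul s y z‖ ≤ 1 := by
  have := poissonConst_pos hs
  rw [traceMul, norm_mul, Complex.norm_real, Real.norm_of_nonneg (by positivity),
    ← poissonConst_mul hs hy]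
  exact mul_le_mul_of_nonneg_left (norm_subLaplace_le hs hy hz) (by positivity)

/-- After scaling, y occurs only in e^{-τy²z}, and the kernel with y = 1 dominates; the limit is its
mass. -/
lemma tendsto_traceMul (hs : 0 < s) {z : ℂ} (hz : 0 ≤ z.re) :
    Tendsto (fun y => traceMul s y z) (𝓝[>] 0) (𝓝 1) := by
  have h : Tendsto (fun y : ℝ => subLaplace s 1 (y ^ 2 * z)) (𝓝[>] 0)
      (𝓝 (∫ τ in Ioi (0 : ℝ), (subKernel s 1 τ : ℂ))) := by
    refine tendsto_integral_filter_of_dominated_convergence (subKernel s 1)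
      (Eventually.of_forall fun y => aestronglyMeasurable_subKernel_mul_exp s 1 _ _)
      (Eventually.of_forall fun y => ?_) (integrableOn_subKernel hs one_pos)
      (Eventually.of_forall fun τ => ?_)
    · filter_upwards [ae_restrict_mem measurableSet_Ioi] with τ hτ
      refine norm_subKernel_mul_exp_le s 1 ?_ hτ
      rw [← Complex.ofReal_pow, Complex.re_ofReal_mul]
      positivity
    · have hc : Continuous fun y : ℝ =>
          (subKernel s 1 τ : ℂ) * Complex.exp (-(τ * ((y : ℂ) ^ 2 * z))) := by fun_prop
      have := hc.tendsto 0
      simp only [Complex.ofReal_zero, ne_eq, OfNat.ofNat_ne_zero, not_false_eq_true, zero_pow,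
        zero_mul, mul_zero, neg_zero, Complex.exp_zero, mul_one] at this
      exact this.mono_left nhdsWithin_le_nhds
  have h2 := h.const_mul (poissonConst s : ℂ)
  rw [integral_complex_ofReal, integral_subKernel hs one_pos, ← Complex.ofReal_mul,
    show poissonConst s * ((4 / 1 ^ 2) ^ s * Real.Gamma s) = 1 by
      simpa using poissonConst_mul hs one_pos, Complex.ofReal_one] at h2
  refine h2.congr' ?_
  filter_upwards [self_mem_nhdsWithin] with y hy
  exact (traceMul_eq hy z).symm

lemma re_sq_mul_pos {y : ℝ} (hy : 0 < y) {z : ℂ} (hz : 0 < z.re) :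
    0 < ((y : ℂ) ^ 2 * z).re := by
  rw [← Complex.ofReal_pow, Complex.re_ofReal_mul]
  positivity

lemma norm_sq_mul {y : ℝ} (z : ℂ) : ‖(y : ℂ) ^ 2 * z‖ = y ^ 2 * ‖z‖ := by
  rw [norm_mul, norm_pow, Complex.norm_real, Real.norm_eq_abs, sq_abs]

/-- One power of decay in w = y²z, for the part of the energy integral far from the boundary. -/
lemma exists_norm_traceMul_le (hs : 0 < s) :
    ∃ C : ℝ, 0 ≤ C ∧ ∀ y : ℝ, 0 < y → ∀ z : ℂ, 0 < z.re →
      ‖traceMul s y z‖ ≤ C / (y ^ 2 * ‖z‖) := by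
  obtain ⟨C, hC, H⟩ := exists_norm_pow_mul_subLaplace_le (a := 1) (b := 1) one_pos 1 hs
  have hc := poissonConst_pos hs
  refine ⟨poissonConst s * C, by positivity, fun y hy z hz => ?_⟩
  have hz0 : 0 < ‖z‖ := norm_pos_iff.2 fun h => by simp [h] at hz
  have h := H 1 ⟨le_rfl, le_rfl⟩ _ (re_sq_mul_pos hy hz)
  rw [traceMul_eq hy, norm_mul, Complex.norm_real, Real.norm_of_nonneg hc.le,
    le_div_iff₀ (by positivity), mul_assoc]
  rw [pow_one, norm_sq_mul, mul_comm] at h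
  exact mul_le_mul_of_nonneg_left h hc.le

/-- The recursion at ν = s-1, read backwards. As y → 0 the two terms of `neumannMul` are each of
order y⁻¹; this form shows their cancellation. -/
lemma neumannMul_eq (hs : 0 < s) {y : ℝ} (hy : 0 < y) {z : ℂ} (hz : 0 < z.re) :
    neumannMul s y z = ((-(2 * poissonConst s * y ^ (2 * s - 1)) : ℝ) : ℂ) *
      (z * subLaplace (s - 1) y z) := by
  rw [mul_subLaplace (by linarith) hy hz, neumannMul, sub_add_cancel,
    show s - 1 + 2 = s + 1 by ring, Real.rpow_add_one hy.ne', Real.rpow_sub_one hy.ne']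
  have : (y : ℂ) ≠ 0 := by exact_mod_cast hy.ne'
  push_cast
  field_simp
  ring

lemma neumannMul_eq_scale (hs : 0 < s) {y : ℝ} (hy : 0 < y) {z : ℂ} (hz : 0 < z.re) :
    neumannMul s y z = ((-(2 * poissonConst s / y) : ℝ) : ℂ) *
      ((y ^ 2 * z) * subLaplace (s - 1) 1 (y ^ 2 * z)) := by
  rw [neumannMul_eq hs hy hz, subLaplace_scale (s - 1) hy,
    show -(2 * (s - 1)) = -(2 * s) + 2 by ring, Real.rpow_add hy, Real.rpow_neg hy.le,
    Real.rpow_two, Real.rpow_sub_one hy.ne']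
  have h1 : (y : ℂ) ≠ 0 := by exact_mod_cast hy.ne'
  have h2 : ((y ^ (2 * s) : ℝ) : ℂ) ≠ 0 := by
    have : 0 < y ^ (2 * s) := by positivity
    exact_mod_cast this.ne'
  rw [Complex.ofReal_neg, Complex.ofReal_neg, Complex.ofReal_mul, Complex.ofReal_mul,
    Complex.ofReal_mul, Complex.ofReal_inv, Complex.ofReal_div, Complex.ofReal_div,
    Complex.ofReal_mul, Complex.ofReal_pow]
  field_simp

/-- The bound |w L_{s-1}(1, w)| ≤ C|w|^s at w = y²z, divided by y. It is the domination in the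
Neumann limit and the near-boundary bound in the energy. -/
lemma exists_norm_neumannMul_le (hs0 : 0 < s) (hs1 : s < 1) :
    ∃ C : ℝ, 0 ≤ C ∧ ∀ y : ℝ, 0 < y → ∀ z : ℂ, 0 < z.re →
      ‖neumannMul s y z‖ ≤ C * (y ^ (2 * s - 1) * ‖z‖ ^ s) := by
  obtain ⟨C, hC, H⟩ := exists_norm_mul_subLaplace_le_rpow hs0 hs1
  have hc := poissonConst_pos hs0
  refine ⟨2 * poissonConst s * C, by positivity, fun y hy z hz => ?_⟩
  have h := H _ (re_sq_mul_pos hy hz)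
  rw [norm_sq_mul, Real.mul_rpow (by positivity) (norm_nonneg _), ← Real.rpow_two,
    ← Real.rpow_mul hy.le] at h
  rw [neumannMul_eq_scale hs0 hy hz, norm_mul, Complex.norm_real, norm_neg,
    Real.norm_of_nonneg (by positivity), Real.rpow_sub_one hy.ne']
  calc _ ≤ 2 * poissonConst s / y * (C * (y ^ (2 * s) * ‖z‖ ^ s)) := by gcongr
    _ = _ := by ring

/-- Far from the boundary the decay of L_s and L_{s+1} gives 1/(y²|z|), and the prefactor
contributes another 1/y. -/
lemma exists_norm_neumannMul_le_div (hs : 0 < s) :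
    ∃ C : ℝ, 0 ≤ C ∧ ∀ y : ℝ, 0 < y → ∀ z : ℂ, 0 < z.re →
      ‖neumannMul s y z‖ ≤ C / (y ^ 3 * ‖z‖) := by
  obtain ⟨C, hC, H⟩ := exists_norm_pow_mul_subLaplace_le (a := 1) (b := 1) one_pos 1 hs
  obtain ⟨C', hC', H'⟩ := exists_norm_pow_mul_subLaplace_le (a := 1) (b := 1) one_pos 1
    (ν := s + 1) (by linarith)
  have hc := poissonConst_pos hs
  refine ⟨2 * poissonConst s * (s * C + C'), by positivity, fun y hy z hz => ?_⟩
  have hz0 : 0 < ‖z‖ := norm_pos_iff.2 fun h => by simp [h] at hz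
  have hw := re_sq_mul_pos hy hz
  have h := H 1 ⟨le_rfl, le_rfl⟩ _ hw
  have h' := H' 1 ⟨le_rfl, le_rfl⟩ _ hw
  rw [neumannMul_eq_scale hs hy hz, norm_mul, Complex.norm_real, norm_neg,
    Real.norm_of_nonneg (by positivity), mul_subLaplace (by linarith) one_pos hw,
    show s - 1 + 1 = s by ring, show s - 1 + 2 = s + 1 by ring]
  set J := subLaplace s 1 (y ^ 2 * z)
  set J' := subLaplace (s + 1) 1 (y ^ 2 * z)
  rw [pow_one, norm_sq_mul] at h h'
  have e : ‖(-(1 + ((s - 1 : ℝ) : ℂ)) * J + ((1 : ℝ) : ℂ) ^ 2 / 4 * J')‖ ≤ s * ‖J‖ + ‖J'‖ := by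
    refine (norm_add_le _ _).trans (add_le_add (le_of_eq ?_) ?_)
    · rw [norm_mul, norm_neg, ← Complex.ofReal_one, ← Complex.ofReal_add, Complex.norm_real,
        Real.norm_of_nonneg (by linarith)]
      ring
    · rw [norm_mul]
      refine mul_le_of_le_one_left (norm_nonneg _) ?_
      norm_num
  rw [le_div_iff₀ (by positivity)]
  calc _ ≤ 2 * poissonConst s / y * (s * ‖J‖ + ‖J'‖) * (y ^ 3 * ‖z‖) := by gcongr
    _ = 2 * poissonConst s * (s * (y ^ 2 * ‖z‖ * ‖J‖) + y ^ 2 * ‖z‖ * ‖J'‖) := by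
        field_simp
    _ ≤ _ := by gcongr

/-- The constant in the weighted Neumann condition. -/
def neumannConst (s : ℝ) : ℝ := (2 : ℝ) ^ (2 * s - 1) * Real.Gamma s / Real.Gamma (1 - s)

/-- The weight cancels y^{2s-1}, leaving -z L_{s-1}(y, z)/Γ(1-s), and L_{s-1}(y, z) tends to Γ(1-s)
z^{s-1}. The constant `neumannConst` is the one for which the Gamma factors cancel. -/
lemma tendsto_neumannMul (hs0 : 0 < s) (hs1 : s < 1) {z : ℂ} (hz : 0 < z.re) :
    Tendsto (fun y => ((neumannConst s * y ^ (1 - 2 * s) : ℝ) : ℂ) * neumannMul s y z + z ^ (s : ℂ))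
      (𝓝[>] 0) (𝓝 0) := by
  have h1 := Real.Gamma_pos_of_pos hs0
  have h2 := Real.Gamma_pos_of_pos (sub_pos.2 hs1)
  have hz0 : z ≠ 0 := fun h => by simp [h] at hz
  have h := ((tendsto_subLaplace_zero (ν := s - 1) (by linarith) hz).const_mul
    (-(z / (Real.Gamma (1 - s) : ℂ)))).add_const (z ^ (s : ℂ))
  have e : -(z / (Real.Gamma (1 - s) : ℂ)) * ((Real.Gamma (-(s - 1)) : ℂ) * z ^ ((s - 1 : ℝ) : ℂ))
      + z ^ (s : ℂ) = 0 := by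
    have h3 : ((Real.Gamma (1 - s) : ℝ) : ℂ) ≠ 0 := by exact_mod_cast h2.ne'
    rw [neg_sub, Complex.ofReal_sub, Complex.ofReal_one, Complex.cpow_sub _ _ hz0, Complex.cpow_one]
    field_simp
    ring
  rw [e] at h
  refine h.congr' ?_
  filter_upwards [self_mem_nhdsWithin] with y hy
  have hy' : 0 < y := hy
  rw [neumannMul_eq hs0 hy' hz, ← mul_assoc, ← Complex.ofReal_mul]
  have e2 : neumannConst s * y ^ (1 - 2 * s) * -(2 * poissonConst s * y ^ (2 * s - 1))
      = -(1 / Real.Gamma (1 - s)) := by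
    have h4 : y ^ (1 - 2 * s) * y ^ (2 * s - 1) = 1 := by
      rw [← Real.rpow_add hy']
      simp
    have h5 : (0 : ℝ) < 2 ^ (2 * s) := by positivity
    rw [neumannConst, poissonConst, Real.rpow_sub_one two_ne_zero]
    calc _ = -(1 / Real.Gamma (1 - s)) * (y ^ (1 - 2 * s) * y ^ (2 * s - 1)) := by
          field_simp
      _ = _ := by rw [h4, mul_one]
  rw [e2]
  push_cast
  ring

end

/-! ### Matrix multipliers with the eigenspaces of the Lamé symbol -/

/-- The function `φ(μ|ξ|² + iσ) (I - P) û + φ((2μ + lam)|ξ|² + iσ) P û`. -/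
def lameMul (μ lam : ℝ) (φ : ℂ → ℂ) (u : SpaceTime n → Val n) (ζ : SpaceTime n) : Val n :=
  φ (parSymbol μ ζ) • transPart u ζ + φ (parSymbol (2 * μ + lam) ζ) • longPart u ζ

lemma lameMul_one (μ lam : ℝ) (u : SpaceTime n → Val n) :
    lameMul μ lam (fun _ => 1) u = fourierL2 u := by
  ext1 ζ
  rw [lameMul, one_smul, one_smul, transPart_add_longPart]

lemma lameMul_add (μ lam : ℝ) (φ ψ : ℂ → ℂ) (u : SpaceTime n → Val n) :
    lameMul μ lam (fun z => φ z + ψ z) u = lameMul μ lam φ u + lameMul μ lam ψ u := by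
  ext1 ζ
  simp only [lameMul, Pi.add_apply]
  module

lemma lameMul_sub (μ lam : ℝ) (φ ψ : ℂ → ℂ) (u : SpaceTime n → Val n) :
    lameMul μ lam (fun z => φ z - ψ z) u = lameMul μ lam φ u - lameMul μ lam ψ u := by
  ext1 ζ
  simp only [lameMul, Pi.sub_apply]
  module

lemma lameMul_const_mul (μ lam : ℝ) (c : ℂ) (φ : ℂ → ℂ) (u : SpaceTime n → Val n) :
    lameMul μ lam (fun z => c * φ z) u = fun ζ => c • lameMul μ lam φ u ζ := by
  ext1 ζ
  simp only [lameMul]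
  module

/-- This puts the fractional power into the same scalar functional calculus as the extension, so
that the two can be compared at the level of functions of z. -/
lemma act_fracSymbol (μ lam s : ℝ) (u : SpaceTime n → Val n) (ζ : SpaceTime n) :
    act (fracSymbol μ lam s ((2 * Real.pi) • ζ.fst) (2 * Real.pi * ζ.snd)) (fourierL2 u ζ)
      = lameMul μ lam (fun z => z ^ (s : ℂ)) u ζ := by
  change act (parSymbol μ ζ ^ (s : ℂ) • (1 : Matrix (Fin n) (Fin n) ℂ)
    + (parSymbol (2 * μ + lam) ζ ^ (s : ℂ) - parSymbol μ ζ ^ (s : ℂ)) •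
      dirProj ((2 * Real.pi) • ζ.fst)) (fourierL2 u ζ) = _
  rw [dirProj_smul (by positivity : 2 * Real.pi ≠ 0), act_add, act_smul, act_smul, act_one, lameMul,
    eq_sub_of_add_eq (transPart_add_longPart u ζ)]
  simp only [longPart]
  module

lemma norm_lameMul_le {μ lam : ℝ} {φ : ℂ → ℂ} {B : ℝ} (u : SpaceTime n → Val n)
    {ζ : SpaceTime n} (h₁ : ‖φ (parSymbol μ ζ)‖ ≤ B) (h₂ : ‖φ (parSymbol (2 * μ + lam) ζ)‖ ≤ B) :
    ‖lameMul μ lam φ u ζ‖ ≤ 3 * B * ‖fourierL2 u ζ‖ := by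
  have hB : 0 ≤ B := (norm_nonneg _).trans h₁
  refine (norm_add_le _ _).trans ?_
  rw [norm_smul, norm_smul]
  calc _ ≤ B * (2 * ‖fourierL2 u ζ‖) + B * ‖fourierL2 u ζ‖ := by
        gcongr
        · exact norm_transPart_le u ζ
        · exact norm_longPart_le u ζ
    _ = _ := by ring

lemma aestronglyMeasurable_lameMul (μ lam : ℝ) {φ : ℂ → ℂ} (hφ : Measurable φ)
    (u : SpaceTime n → Val n) : AEStronglyMeasurable (lameMul μ lam φ u) volume :=
  ((hφ.comp (continuous_parSymbol μ).measurable).aestronglyMeasurable.smul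
    (memLp_transPart u).1).add
    ((hφ.comp (continuous_parSymbol (2 * μ + lam)).measurable).aestronglyMeasurable.smul
      (memLp_longPart u).1)

/-! ### The extension and its derivatives at fixed height as inverse Fourier transforms. -/

section Slices

variable {μ lam s y : ℝ}

lemma lameMul_traceMul (u : SpaceTime n → Val n) : lameMul μ lam (traceMul s y) u = fun ζ =>
    ((poissonConst s * y ^ (2 * s) : ℝ) : ℂ) • (subLaplace s y (parSymbol μ ζ) • transPart u ζ
      + subLaplace s y (parSymbol (2 * μ + lam) ζ) • longPart u ζ) := by
  ext1 ζ
  simp only [lameMul, traceMul]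
  module

lemma lameMul_neumannMul (u : SpaceTime n → Val n) : lameMul μ lam (neumannMul s y) u = fun ζ =>
    ((2 * s * poissonConst s * y ^ (2 * s - 1) : ℝ) : ℂ) •
      (subLaplace s y (parSymbol μ ζ) • transPart u ζ
        + subLaplace s y (parSymbol (2 * μ + lam) ζ) • longPart u ζ)
    - ((poissonConst s / 2 * y ^ (2 * s + 1) : ℝ) : ℂ) •
      (subLaplace (s + 1) y (parSymbol μ ζ) • transPart u ζ
        + subLaplace (s + 1) y (parSymbol (2 * μ + lam) ζ) • longPart u ζ) := by
  ext1 ζ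
  simp only [lameMul, neumannMul]
  module

lemma integrable_subLaplace_add (hn : 1 ≤ n) (hμ : 0 < μ) (hlam : 0 < 2 * μ + lam) {ν : ℝ}
    (hν : 0 < ν) (hy : 0 < y) {g₁ g₂ : SpaceTime n → Val n} (h₁ : ModerateL2 g₁)
    (h₂ : ModerateL2 g₂) : Integrable (fun ζ => subLaplace ν y (parSymbol μ ζ) • g₁ ζ
      + subLaplace ν y (parSymbol (2 * μ + lam) ζ) • g₂ ζ) volume :=
  (h₁.integrable hn hμ hν hy).add (h₂.integrable hn hlam hν hy)

lemma memLp_subLaplace_add (hn : 1 ≤ n) (hμ : 0 < μ) (hlam : 0 < 2 * μ + lam) {ν : ℝ}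
    (hν : 0 < ν) (hy : 0 < y) {g₁ g₂ : SpaceTime n → Val n} (h₁ : ModerateL2 g₁)
    (h₂ : ModerateL2 g₂) : MemLp (fun ζ => subLaplace ν y (parSymbol μ ζ) • g₁ ζ
      + subLaplace ν y (parSymbol (2 * μ + lam) ζ) • g₂ ζ) 2 volume :=
  (h₁.memLp hn hμ hν hy).add (h₂.memLp hn hlam hν hy)

lemma lameInv_eq (hn : 1 ≤ n) (hμ : 0 < μ) (hlam : 0 < 2 * μ + lam) {ν : ℝ} (hν : 0 < ν)
    {g₁ g₂ : SpaceTime n → Val n} (h₁ : ModerateL2 g₁) (h₂ : ModerateL2 g₂) (p : SpaceTime n)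
    (hy : 0 < y) : lameInv μ lam ν g₁ g₂ (p, y)
      = 𝓕⁻ (fun ζ => subLaplace ν y (parSymbol μ ζ) • g₁ ζ
        + subLaplace ν y (parSymbol (2 * μ + lam) ζ) • g₂ ζ) p := by
  simp only [lameInv, invFourier, fourierInv_eq_wave, smul_add]
  exact (integral_add (integrable_wave_smul (h₁.integrable hn hμ hν hy) p)
    (integrable_wave_smul (h₂.integrable hn hlam hν hy) p)).symm

lemma fourierInv_const_smul (c : ℝ) (R : SpaceTime n → Val n) (p : SpaceTime n) :
    𝓕⁻ (fun ζ => (c : ℂ) • R ζ) p = c • 𝓕⁻ R p := by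
  rw [fourierInv_eq_wave, fourierInv_eq_wave, ← integral_smul]
  simp only [Complex.coe_smul, smul_comm _ c]

lemma fourierInv_sub {f g : SpaceTime n → Val n} (hf : Integrable f volume)
    (hg : Integrable g volume) (p : SpaceTime n) :
    𝓕⁻ (fun ζ => f ζ - g ζ) p = 𝓕⁻ f p - 𝓕⁻ g p := by
  simp only [fourierInv_eq_wave, smul_sub]
  exact integral_sub (integrable_wave_smul hf p) (integrable_wave_smul hg p)

lemma integrable_traceMul (hn : 1 ≤ n) (hμ : 0 < μ) (hlam : 0 < 2 * μ + lam) (hs : 0 < s)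
    (hy : 0 < y) (u : SpaceTime n → Val n) :
    Integrable (lameMul μ lam (traceMul s y) u) volume := by
  rw [lameMul_traceMul]
  exact (integrable_subLaplace_add hn hμ hlam hs hy (MemLp.moderateL2 (memLp_transPart u))
    (MemLp.moderateL2 (memLp_longPart u))).smul ((poissonConst s * y ^ (2 * s) : ℝ) : ℂ)

lemma memLp_traceMul (hn : 1 ≤ n) (hμ : 0 < μ) (hlam : 0 < 2 * μ + lam) (hs : 0 < s)
    (hy : 0 < y) (u : SpaceTime n → Val n) :
    MemLp (lameMul μ lam (traceMul s y) u) 2 volume := by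
  rw [lameMul_traceMul]
  exact (memLp_subLaplace_add hn hμ hlam hs hy (MemLp.moderateL2 (memLp_transPart u))
    (MemLp.moderateL2 (memLp_longPart u))).const_smul ((poissonConst s * y ^ (2 * s) : ℝ) : ℂ)

lemma integrable_neumannMul (hn : 1 ≤ n) (hμ : 0 < μ) (hlam : 0 < 2 * μ + lam) (hs : 0 < s)
    (hy : 0 < y) (u : SpaceTime n → Val n) :
    Integrable (lameMul μ lam (neumannMul s y) u) volume := by
  rw [lameMul_neumannMul]
  have m₁ : ModerateL2 (transPart u) := MemLp.moderateL2 (memLp_transPart u)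
  have m₂ : ModerateL2 (longPart u) := MemLp.moderateL2 (memLp_longPart u)
  have hs1 : 0 < s + 1 := by linarith
  exact (((integrable_subLaplace_add hn hμ hlam hs hy m₁ m₂).smul
    ((2 * s * poissonConst s * y ^ (2 * s - 1) : ℝ) : ℂ))).sub
    ((integrable_subLaplace_add hn hμ hlam hs1 hy m₁ m₂).smul
      ((poissonConst s / 2 * y ^ (2 * s + 1) : ℝ) : ℂ))

lemma memLp_neumannMul (hn : 1 ≤ n) (hμ : 0 < μ) (hlam : 0 < 2 * μ + lam) (hs : 0 < s)
    (hy : 0 < y) (u : SpaceTime n → Val n) :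
    MemLp (lameMul μ lam (neumannMul s y) u) 2 volume := by
  rw [lameMul_neumannMul]
  have m₁ : ModerateL2 (transPart u) := MemLp.moderateL2 (memLp_transPart u)
  have m₂ : ModerateL2 (longPart u) := MemLp.moderateL2 (memLp_longPart u)
  have hs1 : 0 < s + 1 := by linarith
  exact (((memLp_subLaplace_add hn hμ hlam hs hy m₁ m₂).const_smul
    ((2 * s * poissonConst s * y ^ (2 * s - 1) : ℝ) : ℂ))).sub
    ((memLp_subLaplace_add hn hμ hlam hs1 hy m₁ m₂).const_smul
      ((poissonConst s / 2 * y ^ (2 * s + 1) : ℝ) : ℂ))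

/-- The Fourier representation of the extension at height `y`. -/
lemma extension_slice (hn : 1 ≤ n) (hμ : 0 < μ) (hlam : 0 < 2 * μ + lam) (hs : 0 < s)
    (hy : 0 < y) {u : SpaceTime n → Val n} (hu : MemLp u 2 volume) :
    (fun p : SpaceTime n => extension μ lam s u p.fst y p.snd)
      = 𝓕⁻ (lameMul μ lam (traceMul s y) u) := by
  ext1 p
  rw [extension_eq hn hμ hlam hs hu p.fst hy p.snd, lameMul_traceMul, fourierInv_const_smul]
  exact congrArg _ (lameInv_eq hn hμ hlam hs (MemLp.moderateL2 (memLp_transPart u))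
    (MemLp.moderateL2 (memLp_longPart u)) p hy)

/-- The Fourier representation of the normal derivative of the extension at height `y`. -/
lemma deriv_extension_slice (hn : 1 ≤ n) (hμ : 0 < μ) (hlam : 0 < 2 * μ + lam) (hs : 0 < s)
    (hy : 0 < y) {u : SpaceTime n → Val n} (hu : MemLp u 2 volume) :
    (fun p : SpaceTime n => deriv (fun y' => extension μ lam s u p.fst y' p.snd) y)
      = 𝓕⁻ (lameMul μ lam (neumannMul s y) u) := by
  ext1 p
  have m₁ : ModerateL2 (transPart u) := MemLp.moderateL2 (memLp_transPart u)
  have m₂ : ModerateL2 (longPart u) := MemLp.moderateL2 (memLp_longPart u)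
  have hs1 : 0 < s + 1 := by linarith
  have hp : (WithLp.toLp 2 (p.fst, p.snd) : SpaceTime n) = p := rfl
  have he := extension_eventuallyEq hn hμ hlam hs hu p.fst hy p.snd
  rw [hp] at he
  have hd := (hasDerivAt_rpow_smul
    (A := fun y => lameInv μ lam s (transPart u) (longPart u) (p, y))
    (B := fun y => lameInv μ lam (s + 1) (transPart u) (longPart u) (p, y)) s (poissonConst s) hy
    (hasDerivAt_lameInv_y hn hμ hlam hs m₁ m₂ p hy)).deriv
  rw [he.deriv_eq, hd, lameMul_neumannMul]
  refine Eq.trans ?_ (fourierInv_sub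
    ((integrable_subLaplace_add hn hμ hlam hs hy m₁ m₂).smul
      ((2 * s * poissonConst s * y ^ (2 * s - 1) : ℝ) : ℂ))
    ((integrable_subLaplace_add hn hμ hlam hs1 hy m₁ m₂).smul
      ((poissonConst s / 2 * y ^ (2 * s + 1) : ℝ) : ℂ)) p).symm
  rw [lameInv_eq hn hμ hlam hs m₁ m₂ p hy, lameInv_eq hn hμ hlam hs1 m₁ m₂ p hy,
    ← fourierInv_const_smul, ← fourierInv_const_smul]
  rfl

lemma partialMul_traceMul (i : Fin n) (u : SpaceTime n → Val n) :
    partialMul i (lameMul μ lam (traceMul s y) u) = fun ζ =>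
      ((poissonConst s * y ^ (2 * s) : ℝ) : ℂ) •
        (subLaplace s y (parSymbol μ ζ) • partialMul i (transPart u) ζ
        + subLaplace s y (parSymbol (2 * μ + lam) ζ) • partialMul i (longPart u) ζ) := by
  ext1 ζ
  simp only [lameMul_traceMul, partialMul_apply]
  module

/-- The Fourier representation of the tangential derivatives of the extension at height `y`. -/
lemma fderiv_extension_slice (hn : 1 ≤ n) (hμ : 0 < μ) (hlam : 0 < 2 * μ + lam) (hs : 0 < s)
    (hy : 0 < y) {u : SpaceTime n → Val n} (hu : MemLp u 2 volume) (i : Fin n) :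
    (fun p : SpaceTime n => fderiv ℝ (fun x' => extension μ lam s u x' y p.snd) p.fst
        (EuclideanSpace.single i 1))
      = 𝓕⁻ (partialMul i (lameMul μ lam (traceMul s y) u)) := by
  ext1 p
  have m₁ : ModerateL2 (transPart u) := MemLp.moderateL2 (memLp_transPart u)
  have m₂ : ModerateL2 (longPart u) := MemLp.moderateL2 (memLp_longPart u)
  have hx : (fun x' => extension μ lam s u x' y p.snd) = fun x' => _ :=
    funext fun x' => extension_eq hn hμ hlam hs hu x' hy p.snd
  rw [hx, hasFDerivAt_lameInv_space hn hμ hlam hs m₁ m₂ p.fst hy p.snd, partialMul_traceMul,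
    fourierInv_const_smul]
  exact congrArg _ (lameInv_eq hn hμ hlam hs (m₁.partialMul i) (m₂.partialMul i) p hy)

lemma integrable_partialMul_traceMul (hn : 1 ≤ n) (hμ : 0 < μ) (hlam : 0 < 2 * μ + lam)
    (hs : 0 < s) (hy : 0 < y) (u : SpaceTime n → Val n) (i : Fin n) :
    Integrable (partialMul i (lameMul μ lam (traceMul s y) u)) volume := by
  rw [partialMul_traceMul]
  exact (integrable_subLaplace_add hn hμ hlam hs hy
    ((MemLp.moderateL2 (memLp_transPart u)).partialMul i)
    ((MemLp.moderateL2 (memLp_longPart u)).partialMul i)).smul ((poissonConst s * y ^ (2 * s) : ℝ) : ℂ)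

lemma memLp_partialMul_traceMul (hn : 1 ≤ n) (hμ : 0 < μ) (hlam : 0 < 2 * μ + lam)
    (hs : 0 < s) (hy : 0 < y) (u : SpaceTime n → Val n) (i : Fin n) :
    MemLp (partialMul i (lameMul μ lam (traceMul s y) u)) 2 volume := by
  rw [partialMul_traceMul]
  exact (memLp_subLaplace_add hn hμ hlam hs hy
    ((MemLp.moderateL2 (memLp_transPart u)).partialMul i)
    ((MemLp.moderateL2 (memLp_longPart u)).partialMul i)).const_smul ((poissonConst s * y ^ (2 * s) : ℝ) : ℂ)

end Slices

/-! ### Sobolev norms of the multipliers -/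

/-- Reduces boundedness of a multiplier from H^s to H^r to a pointwise comparison of weights; 9 is
the square of the 3 in `norm_lameMul_le`. -/
lemma weight_mul_enorm_sq_le {r s B K : ℝ} {ζ : SpaceTime n} {v w : Val n}
    (hv : ‖v‖ ≤ 3 * B * ‖w‖) (hB : weight ζ ^ (r / 2) * B ^ 2 ≤ K * weight ζ ^ (s / 2)) :
    ENNReal.ofReal (weight ζ ^ (r / 2)) * ‖v‖ₑ ^ 2
      ≤ ENNReal.ofReal (9 * K) * (ENNReal.ofReal (weight ζ ^ (s / 2)) * ‖w‖ₑ ^ 2) := by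
  have hw : 0 < weight ζ := one_pos.trans_le (one_le_weight ζ)
  have h0 : 0 ≤ K * weight ζ ^ (s / 2) := le_trans (by positivity) hB
  have hK : 0 ≤ K := nonneg_of_mul_nonneg_left h0 (by positivity)
  rw [← ofReal_norm, ← ofReal_norm, ← ENNReal.ofReal_pow (norm_nonneg _),
    ← ENNReal.ofReal_pow (norm_nonneg _), ← ENNReal.ofReal_mul (by positivity),
    ← ENNReal.ofReal_mul (by positivity), ← ENNReal.ofReal_mul (by positivity)]
  refine ENNReal.ofReal_le_ofReal ?_
  calc weight ζ ^ (r / 2) * ‖v‖ ^ 2 ≤ weight ζ ^ (r / 2) * (3 * B * ‖w‖) ^ 2 := by gcongr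
    _ = 9 * (weight ζ ^ (r / 2) * B ^ 2) * ‖w‖ ^ 2 := by ring
    _ ≤ 9 * (K * weight ζ ^ (s / 2)) * ‖w‖ ^ 2 := by gcongr
    _ = _ := by ring

lemma MemH.lintegral_lt_top {s : ℝ} {u : SpaceTime n → Val n} (hu : MemH s u) :
    ∫⁻ ζ, ENNReal.ofReal (weight ζ ^ (s / 2)) * ‖fourierL2 u ζ‖ₑ ^ 2 < ⊤ :=
  (hasFourierDensity_toDist hu.1).lintegral_lt_top hu.2

section

variable {μ lam s : ℝ} {u : SpaceTime n → Val n}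

lemma sobolevNorm_lameMul_lt_top (hn : 1 ≤ n) (hμ : 0 < μ) (hlam : 0 < 2 * μ + lam)
    (hu : MemH s u) {r K : ℝ} {B : SpaceTime n → ℝ} {φ : ℂ → ℂ}
    (h₁ : ∀ ζ : SpaceTime n, 0 < (parSymbol μ ζ).re → ‖φ (parSymbol μ ζ)‖ ≤ B ζ)
    (h₂ : ∀ ζ : SpaceTime n, 0 < (parSymbol (2 * μ + lam) ζ).re →
      ‖φ (parSymbol (2 * μ + lam) ζ)‖ ≤ B ζ)
    (hB : ∀ ζ, weight ζ ^ (r / 2) * B ζ ^ 2 ≤ K * weight ζ ^ (s / 2))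
    {T : 𝓢'(SpaceTime n, Val n)} (hT : HasFourierDensity T (lameMul μ lam φ u)) :
    sobolevNorm r T < ⊤ := by
  have hfin : ∫⁻ ζ, ENNReal.ofReal (9 * K) *
      (ENNReal.ofReal (weight ζ ^ (s / 2)) * ‖fourierL2 u ζ‖ₑ ^ 2) < ⊤ := by
    rw [lintegral_const_mul' _ _ ENNReal.ofReal_ne_top]
    exact ENNReal.mul_lt_top ENNReal.ofReal_lt_top hu.lintegral_lt_top
  refine hT.sobolevNorm_lt_top ((lintegral_mono_ae ?_).trans_lt hfin)
  filter_upwards [ae_parSymbol_re_pos hn hμ, ae_parSymbol_re_pos hn hlam] with ζ a b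
  exact weight_mul_enorm_sq_le (norm_lameMul_le u (h₁ ζ a) (h₂ ζ b)) (hB ζ)

/-- Dominated convergence on the Fourier side: the majorant B is independent of y, and finiteness of
the H^s norm of u makes the resulting bound integrable. -/
lemma tendsto_sobolevNorm_lameMul (hn : 1 ≤ n) (hμ : 0 < μ) (hlam : 0 < 2 * μ + lam)
    (hu : MemH s u) {r K : ℝ} {B : SpaceTime n → ℝ} {φ : ℝ → ℂ → ℂ}
    (h₁ : ∀ y : ℝ, 0 < y → ∀ ζ : SpaceTime n, 0 < (parSymbol μ ζ).re →
      ‖φ y (parSymbol μ ζ)‖ ≤ B ζ)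
    (h₂ : ∀ y : ℝ, 0 < y → ∀ ζ : SpaceTime n, 0 < (parSymbol (2 * μ + lam) ζ).re →
      ‖φ y (parSymbol (2 * μ + lam) ζ)‖ ≤ B ζ)
    (hB : ∀ ζ, weight ζ ^ (r / 2) * B ζ ^ 2 ≤ K * weight ζ ^ (s / 2))
    (hlim : ∀ z : ℂ, 0 < z.re → Tendsto (fun y => φ y z) (𝓝[>] 0) (𝓝 0))
    {T : ℝ → 𝓢'(SpaceTime n, Val n)}
    (hT : ∀ y : ℝ, 0 < y → HasFourierDensity (T y) (lameMul μ lam (φ y) u)) :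
    Tendsto (fun y => sobolevNorm r (T y)) (𝓝[>] 0) (𝓝 0) := by
  have key : Tendsto (fun y => ∫⁻ ζ, ENNReal.ofReal (weight ζ ^ (r / 2)) *
      ‖lameMul μ lam (φ y) u ζ‖ₑ ^ 2) (𝓝[>] 0) (𝓝 (∫⁻ _ : SpaceTime n, 0)) := by
    have hw : Measurable fun ζ : SpaceTime n => ENNReal.ofReal (weight ζ ^ (r / 2)) :=
      (measurable_weight.pow_const _).ennreal_ofReal
    refine tendsto_lintegral_filter_of_dominated_convergence' (fun ζ => ENNReal.ofReal (9 * K) *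
      (ENNReal.ofReal (weight ζ ^ (s / 2)) * ‖fourierL2 u ζ‖ₑ ^ 2)) ?_ ?_ ?_ ?_
    · filter_upwards [self_mem_nhdsWithin] with y hy
      exact hw.aemeasurable.mul ((hT y hy).1.enorm.pow_const 2)
    · filter_upwards [self_mem_nhdsWithin] with y hy
      filter_upwards [ae_parSymbol_re_pos hn hμ, ae_parSymbol_re_pos hn hlam] with ζ a b
      exact weight_mul_enorm_sq_le (norm_lameMul_le u (h₁ y hy ζ a) (h₂ y hy ζ b)) (hB ζ)
    · rw [lintegral_const_mul' _ _ ENNReal.ofReal_ne_top]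
      exact (ENNReal.mul_lt_top ENNReal.ofReal_lt_top hu.lintegral_lt_top).ne
    · filter_upwards [ae_parSymbol_re_pos hn hμ, ae_parSymbol_re_pos hn hlam] with ζ a b
      have h := ((hlim _ a).smul_const (transPart u ζ)).add ((hlim _ b).smul_const (longPart u ζ))
      rw [zero_smul, zero_smul, add_zero] at h
      have h' := (ENNReal.continuous_pow 2).continuousAt.tendsto.comp h.enorm
      have h'' := ENNReal.Tendsto.const_mul (a := ENNReal.ofReal (weight ζ ^ (r / 2))) h'
        (Or.inr ENNReal.ofReal_ne_top)
      simpa using! h''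
  rw [lintegral_zero] at key
  have h2 := (ENNReal.continuous_rpow_const (y := 1 / 2)).continuousAt.tendsto.comp key
  rw [ENNReal.zero_rpow_of_pos (by norm_num)] at h2
  refine h2.congr' ?_
  filter_upwards [self_mem_nhdsWithin] with y hy
  exact ((hT y hy).sobolevNorm_eq r).symm

/-! ### The boundary values of the extension -/

lemma memLp_extension (hn : 1 ≤ n) (hμ : 0 < μ) (hlam : 0 < 2 * μ + lam) (hs : 0 < s) {y : ℝ}
    (hy : 0 < y) (hu : MemLp u 2 volume) :
    MemLp (fun p : SpaceTime n => extension μ lam s u p.fst y p.snd) 2 volume := by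
  rw [extension_slice hn hμ hlam hs hy hu]
  exact memLp_fourierInv (integrable_traceMul hn hμ hlam hs hy u)
    (memLp_traceMul hn hμ hlam hs hy u)

lemma hasFourierDensity_extension (hn : 1 ≤ n) (hμ : 0 < μ) (hlam : 0 < 2 * μ + lam)
    (hs : 0 < s) {y : ℝ} (hy : 0 < y) (hu : MemLp u 2 volume) :
    HasFourierDensity (toDist fun p : SpaceTime n => extension μ lam s u p.fst y p.snd)
      (lameMul μ lam (traceMul s y) u) := by
  refine (hasFourierDensity_toDist (memLp_extension hn hμ hlam hs hy hu)).congr ?_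
  rw [extension_slice hn hμ hlam hs hy hu]
  exact fourierL2_fourierInv_ae_eq (integrable_traceMul hn hμ hlam hs hy u)
    (memLp_traceMul hn hμ hlam hs hy u)

lemma memH_extension (hn : 1 ≤ n) (hμ : 0 < μ) (hlam : 0 < 2 * μ + lam) (hs : 0 < s) {y : ℝ}
    (hy : 0 < y) (hu : MemH s u) :
    MemH s fun p : SpaceTime n => extension μ lam s u p.fst y p.snd :=
  ⟨memLp_extension hn hμ hlam hs hy hu.1, sobolevNorm_lameMul_lt_top hn hμ hlam hu (K := 1)
    (B := fun _ => 1) (fun _ h => norm_traceMul_le_one hs hy h.le)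
    (fun _ h => norm_traceMul_le_one hs hy h.le) (fun ζ => by simp)
    (hasFourierDensity_extension hn hμ hlam hs hy hu.1)⟩

lemma tendsto_extension (hn : 1 ≤ n) (hμ : 0 < μ) (hlam : 0 < 2 * μ + lam) (hs : 0 < s)
    (hu : MemH s u) :
    Tendsto (fun y : ℝ => sobolevNorm s
      (toDist (fun p : SpaceTime n => extension μ lam s u p.fst y p.snd) - toDist u))
      (𝓝[>] 0) (𝓝 0) := by
  have hb : ∀ y : ℝ, 0 < y → ∀ z : ℂ, 0 < z.re → ‖traceMul s y z - 1‖ ≤ 2 := fun y hy z hz => by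
    have h := norm_sub_le (traceMul s y z) 1
    rw [norm_one] at h
    linarith [norm_traceMul_le_one hs hy hz.le]
  refine tendsto_sobolevNorm_lameMul hn hμ hlam hu (K := 4) (B := fun _ => 2)
    (φ := fun y z => traceMul s y z - 1) (fun y hy ζ h => hb y hy _ h) (fun y hy ζ h => hb y hy _ h)
    (fun ζ => by linarith) (fun z hz => ?_) fun y hy => ?_
  · simpa using (tendsto_traceMul hs hz.le).sub_const 1
  · rw [lameMul_sub, lameMul_one]
    exact (hasFourierDensity_extension hn hμ hlam hs hy hu.1).sub (hasFourierDensity_toDist hu.1)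

/-! ### The weighted normal derivative -/

lemma memLp_deriv_extension (hn : 1 ≤ n) (hμ : 0 < μ) (hlam : 0 < 2 * μ + lam) (hs : 0 < s) {y : ℝ}
    (hy : 0 < y) (hu : MemLp u 2 volume) :
    MemLp (fun p : SpaceTime n => deriv (fun y' => extension μ lam s u p.fst y' p.snd) y) 2
      volume := by
  rw [deriv_extension_slice hn hμ hlam hs hy hu]
  exact memLp_fourierInv (integrable_neumannMul hn hμ hlam hs hy u)
    (memLp_neumannMul hn hμ hlam hs hy u)

lemma hasFourierDensity_smul_deriv_extension (hn : 1 ≤ n) (hμ : 0 < μ) (hlam : 0 < 2 * μ + lam)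
    (hs : 0 < s) {y : ℝ} (hy : 0 < y) (hu : MemLp u 2 volume) (c : ℝ) :
    HasFourierDensity (toDist fun p : SpaceTime n =>
        c • deriv (fun y' => extension μ lam s u p.fst y' p.snd) y)
      (lameMul μ lam (fun z => (c : ℂ) * neumannMul s y z) u) := by
  have i1 : Integrable (fun ζ => (c : ℂ) • lameMul μ lam (neumannMul s y) u ζ) volume :=
    (integrable_neumannMul hn hμ hlam hs hy u).smul (c : ℂ)
  have i2 : MemLp (fun ζ => (c : ℂ) • lameMul μ lam (neumannMul s y) u ζ) 2 volume :=
    (memLp_neumannMul hn hμ hlam hs hy u).const_smul (c : ℂ)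
  have e : (fun p : SpaceTime n =>
      c • deriv (fun y' => extension μ lam s u p.fst y' p.snd) y)
      = 𝓕⁻ (fun ζ => (c : ℂ) • lameMul μ lam (neumannMul s y) u ζ) := by
    ext1 p
    rw [fourierInv_const_smul, ← deriv_extension_slice hn hμ hlam hs hy hu]
  rw [lameMul_const_mul, e]
  exact (hasFourierDensity_toDist (memLp_fourierInv i1 i2)).congr (fourierL2_fourierInv_ae_eq i1 i2)

/-- For κ = 1 the weight was made for this, |z| ≤ `weight ζ` to the power 1/2; other values of κ are
comparable. -/
lemma exists_norm_parSymbol_rpow_le {κ : ℝ} (hκ : 0 < κ) (hs : 0 < s) :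
    ∃ K : ℝ, 0 ≤ K ∧ ∀ ζ : SpaceTime n, ‖parSymbol κ ζ‖ ^ s ≤ K * weight ζ ^ (s / 2) := by
  refine ⟨(κ / 1 + 1) ^ s, by positivity, fun ζ => ?_⟩
  have h1 := norm_parSymbol_le_mul hκ.le one_pos ζ
  have h2 : ‖parSymbol 1 ζ‖ ≤ weight ζ ^ (1 / 2 : ℝ) := by
    rw [← Real.sqrt_eq_rpow]
    refine Real.le_sqrt_of_sq_le ?_
    rw [weight_eq]
    linarith
  have hw : 0 < weight ζ := one_pos.trans_le (one_le_weight ζ)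
  calc ‖parSymbol κ ζ‖ ^ s ≤ ((κ / 1 + 1) * weight ζ ^ (1 / 2 : ℝ)) ^ s := by
        refine Real.rpow_le_rpow (norm_nonneg _) (h1.trans ?_) hs.le
        gcongr
    _ = _ := by
        rw [Real.mul_rpow (by positivity) (by positivity), ← Real.rpow_mul hw.le]
        congr 2
        ring

/-- A crude polynomial bound, via |z|^s ≤ 1 + |z| for s < 1, which makes A^s û the density of a
tempered distribution. -/
lemma exists_norm_parSymbol_rpow_le_one_add {κ : ℝ} (hκ : 0 < κ) (hs0 : 0 < s) (hs1 : s < 1) :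
    ∃ K : ℝ, 0 ≤ K ∧ ∀ ζ : SpaceTime n, ‖parSymbol κ ζ‖ ^ s ≤ K * (1 + ‖ζ‖ ^ 2) := by
  refine ⟨1 + (κ + 1) * (2 * Real.pi) ^ 2, by positivity, fun ζ => ?_⟩
  have h1 := norm_parSymbol_le hκ.le ζ
  have h2 : ‖parSymbol κ ζ‖ ^ s ≤ 1 + ‖parSymbol κ ζ‖ := by
    have h0 := norm_nonneg (parSymbol κ ζ)
    calc ‖parSymbol κ ζ‖ ^ s ≤ (1 + ‖parSymbol κ ζ‖) ^ s :=
          Real.rpow_le_rpow h0 (by linarith) hs0.le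
      _ ≤ (1 + ‖parSymbol κ ζ‖) ^ (1 : ℝ) :=
          Real.rpow_le_rpow_of_exponent_le (by linarith) hs1.le
      _ = _ := Real.rpow_one _
  nlinarith [sq_nonneg ‖ζ‖]

lemma measurable_cpow_const (c : ℂ) : Measurable fun z : ℂ => z ^ c := by fun_prop

lemma exists_isFracPower (hμ : 0 < μ) (hlam : 0 < 2 * μ + lam) (hs0 : 0 < s) (hs1 : s < 1)
    (u : SpaceTime n → Val n) : ∃ T : 𝓢'(SpaceTime n, Val n), IsFracPower μ lam s u T := by
  obtain ⟨K₁, hK₁, H₁⟩ := exists_norm_parSymbol_rpow_le_one_add (n := n) hμ hs0 hs1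
  obtain ⟨K₂, hK₂, H₂⟩ := exists_norm_parSymbol_rpow_le_one_add (n := n) hlam hs0 hs1
  unfold IsFracPower
  simp only [act_fracSymbol]
  refine exists_hasFourierDensity ((memLp_fourierL2 u).of_le_mul (c := 3 * (K₁ + K₂)) ?_
    (Eventually.of_forall fun ζ => ?_))
  · have hc : Continuous fun ζ : SpaceTime n => ((1 + ‖ζ‖ ^ 2)⁻¹ : ℝ) :=
      Continuous.inv₀ (by fun_prop) fun ζ => by positivity
    exact hc.aestronglyMeasurable.smul
      (aestronglyMeasurable_lameMul μ lam (measurable_cpow_const s) u)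
  · have hp : 0 < 1 + ‖ζ‖ ^ 2 := by positivity
    have h := norm_lameMul_le (μ := μ) (lam := lam) (φ := fun z => z ^ (s : ℂ)) u (ζ := ζ)
      (B := (K₁ + K₂) * (1 + ‖ζ‖ ^ 2))
      (by rw [Complex.norm_cpow_real]; nlinarith [H₁ ζ]) (by rw [Complex.norm_cpow_real]; nlinarith [H₂ ζ])
    rw [norm_smul, Real.norm_of_nonneg (by positivity), inv_mul_le_iff₀ hp]
    linarith

/-- The exponents balance, -s/2 + 2·(s/2) = s/2, so a multiplier of size |z|^s maps H^s to H^{-s}.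
-/
lemma weight_neg_rpow_mul (K : ℝ) (ζ : SpaceTime n) :
    weight ζ ^ (-s / 2) * (K * weight ζ ^ (s / 2)) ^ 2 = K ^ 2 * weight ζ ^ (s / 2) := by
  have hw : 0 < weight ζ := one_pos.trans_le (one_le_weight ζ)
  rw [neg_div, Real.rpow_neg hw.le]
  field_simp

lemma sobolevNorm_fracPower_lt_top (hn : 1 ≤ n) (hμ : 0 < μ) (hlam : 0 < 2 * μ + lam)
    (hs : 0 < s) (hu : MemH s u) {T : 𝓢'(SpaceTime n, Val n)} (hT : IsFracPower μ lam s u T) :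
    sobolevNorm (-s) T < ⊤ := by
  obtain ⟨K₁, hK₁, H₁⟩ := exists_norm_parSymbol_rpow_le (n := n) hμ hs
  obtain ⟨K₂, hK₂, H₂⟩ := exists_norm_parSymbol_rpow_le (n := n) hlam hs
  unfold IsFracPower at hT
  simp only [act_fracSymbol] at hT
  have hw : ∀ ζ : SpaceTime n, 0 ≤ weight ζ ^ (s / 2) := fun ζ =>
    Real.rpow_nonneg (zero_le_one.trans (one_le_weight ζ)) _
  refine sobolevNorm_lameMul_lt_top hn hμ hlam hu (K := (K₁ + K₂) ^ 2)
    (B := fun ζ => (K₁ + K₂) * weight ζ ^ (s / 2)) (fun ζ _ => ?_) (fun ζ _ => ?_)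
    (fun ζ => (weight_neg_rpow_mul _ ζ).le) hT
  · rw [Complex.norm_cpow_real]
    nlinarith [H₁ ζ, hw ζ]
  · rw [Complex.norm_cpow_real]
    nlinarith [H₂ ζ, hw ζ]

lemma tendsto_neumann (hn : 1 ≤ n) (hμ : 0 < μ) (hlam : 0 < 2 * μ + lam) (hs0 : 0 < s)
    (hs1 : s < 1) (hu : MemH s u) {T : 𝓢'(SpaceTime n, Val n)} (hT : IsFracPower μ lam s u T) :
    Tendsto (fun y : ℝ => sobolevNorm (-s) (toDist (fun p : SpaceTime n =>
        (neumannConst s * y ^ (1 - 2 * s)) •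
          deriv (fun y' => extension μ lam s u p.fst y' p.snd) y) + T)) (𝓝[>] 0) (𝓝 0) := by
  obtain ⟨C, hC, H⟩ := exists_norm_neumannMul_le hs0 hs1
  obtain ⟨K₁, hK₁, H₁⟩ := exists_norm_parSymbol_rpow_le (n := n) hμ hs0
  obtain ⟨K₂, hK₂, H₂⟩ := exists_norm_parSymbol_rpow_le (n := n) hlam hs0
  unfold IsFracPower at hT
  simp only [act_fracSymbol] at hT
  have hw : ∀ ζ : SpaceTime n, 0 ≤ weight ζ ^ (s / 2) := fun ζ =>
    Real.rpow_nonneg (zero_le_one.trans (one_le_weight ζ)) _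
  have hc : 0 ≤ neumannConst s := by
    have h1 := Real.Gamma_pos_of_pos hs0
    have h2 := Real.Gamma_pos_of_pos (sub_pos.2 hs1)
    unfold neumannConst
    positivity
  -- Both terms are of size |z|^s uniformly in y, because y^{1-2s} cancels the power of y in the
  -- near-boundary bound.
  have hb : ∀ y : ℝ, 0 < y → ∀ z : ℂ, 0 < z.re →
      ‖((neumannConst s * y ^ (1 - 2 * s) : ℝ) : ℂ) * neumannMul s y z + z ^ (s : ℂ)‖
        ≤ (neumannConst s * C + 1) * ‖z‖ ^ s := fun y hy z hz => by
    refine (norm_add_le _ _).trans ?_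
    rw [norm_mul, Complex.norm_real, Real.norm_of_nonneg (by positivity), Complex.norm_cpow_real]
    have e : y ^ (1 - 2 * s) * y ^ (2 * s - 1) = 1 := by
      rw [← Real.rpow_add hy]
      simp
    calc _ ≤ neumannConst s * y ^ (1 - 2 * s) * (C * (y ^ (2 * s - 1) * ‖z‖ ^ s)) + ‖z‖ ^ s := by
          gcongr
          exact H y hy z hz
      _ = neumannConst s * C * (y ^ (1 - 2 * s) * y ^ (2 * s - 1)) * ‖z‖ ^ s + ‖z‖ ^ s := by ring
      _ = _ := by rw [e]; ring
  have hD : 0 ≤ neumannConst s * C + 1 := by positivity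
  refine tendsto_sobolevNorm_lameMul hn hμ hlam hu
    (K := ((neumannConst s * C + 1) * (K₁ + K₂)) ^ 2)
    (B := fun ζ => (neumannConst s * C + 1) * (K₁ + K₂) * weight ζ ^ (s / 2))
    (φ := fun y z => ((neumannConst s * y ^ (1 - 2 * s) : ℝ) : ℂ) * neumannMul s y z + z ^ (s : ℂ))
    (fun y hy ζ h => (hb y hy _ h).trans ?_) (fun y hy ζ h => (hb y hy _ h).trans ?_)
    (fun ζ => (weight_neg_rpow_mul _ ζ).le) (fun z hz => tendsto_neumannMul hs0 hs1 hz)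
    fun y hy => ?_
  · rw [mul_assoc]
    exact mul_le_mul_of_nonneg_left (by nlinarith [H₁ ζ, hw ζ]) hD
  · rw [mul_assoc]
    exact mul_le_mul_of_nonneg_left (by nlinarith [H₂ ζ, hw ζ]) hD
  · rw [lameMul_add]
    exact (hasFourierDensity_smul_deriv_extension hn hμ hlam hs0 hy hu.1 _).add hT

end

/-! ### The energy bounds -/

lemma lintegral_Ioc_const_mul_rpow {a c Y : ℝ} (ha : -1 < a) (hc : 0 ≤ c) (hY : 0 < Y) :
    ∫⁻ y in Ioc 0 Y, ENNReal.ofReal (c * y ^ a) = ENNReal.ofReal (c * (Y ^ (a + 1) / (a + 1))) := by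
  have hi : IntegrableOn (fun y : ℝ => c * y ^ a) (Ioc 0 Y) :=
    ((intervalIntegrable_iff_integrableOn_Ioc_of_le hY.le).1
      (intervalIntegral.intervalIntegrable_rpow' ha)).const_mul c
  rw [← ofReal_integral_eq_lintegral_ofReal hi, integral_const_mul,
    ← intervalIntegral.integral_of_le hY.le, integral_rpow (Or.inl ha),
    Real.zero_rpow (by linarith), sub_zero]
  filter_upwards [ae_restrict_mem measurableSet_Ioc] with y hy
  have := hy.1
  positivity

lemma lintegral_Ioi_const_mul_rpow {a c Y : ℝ} (ha : a < -1) (hc : 0 ≤ c) (hY : 0 < Y) :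
    ∫⁻ y in Ioi Y, ENNReal.ofReal (c * y ^ a)
      = ENNReal.ofReal (c * (Y ^ (a + 1) / (-(a + 1)))) := by
  have hi : IntegrableOn (fun y : ℝ => c * y ^ a) (Ioi Y) :=
    (integrableOn_Ioi_rpow_of_lt ha hY).const_mul c
  rw [← ofReal_integral_eq_lintegral_ofReal hi, integral_const_mul, integral_Ioi_rpow_of_lt ha hY,
    neg_div, div_neg]
  filter_upwards [ae_restrict_mem measurableSet_Ioi] with y hy
  have : 0 < y := hY.trans hy
  positivity

section Scalar

variable {s : ℝ}

/-- The energy density of the multipliers. -/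
def energyMul (s y : ℝ) (z : ℂ) : ℝ :=
  y ^ (1 - 2 * s) * (‖z‖ * ‖traceMul s y z‖ ^ 2 + ‖neumannMul s y z‖ ^ 2)

lemma measurable_traceMul_uncurry (s : ℝ) : Measurable fun q : ℝ × ℂ => traceMul s q.1 q.2 := by
  have := (stronglyMeasurable_subLaplace_uncurry s).measurable
  unfold traceMul
  exact Measurable.mul (Complex.measurable_ofReal.comp (by fun_prop)) this

lemma measurable_neumannMul_uncurry (s : ℝ) :
    Measurable fun q : ℝ × ℂ => neumannMul s q.1 q.2 := by
  have h1 := (stronglyMeasurable_subLaplace_uncurry s).measurable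
  have h2 := (stronglyMeasurable_subLaplace_uncurry (s + 1)).measurable
  unfold neumannMul
  exact (Measurable.mul (Complex.measurable_ofReal.comp (by fun_prop)) h1).sub
    (Measurable.mul (Complex.measurable_ofReal.comp (by fun_prop)) h2)

lemma measurable_energyMul_uncurry (s : ℝ) : Measurable fun q : ℝ × ℂ => energyMul s q.1 q.2 := by
  have h1 := measurable_traceMul_uncurry s
  have h2 := measurable_neumannMul_uncurry s
  unfold energyMul
  exact Measurable.mul (by fun_prop) ((Measurable.mul (by fun_prop) (h1.norm.pow_const 2)).add
    (h2.norm.pow_const 2))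

/-- By scaling the integral has to be a multiple of |z|^s; only its convergence matters. Near y = 0
this rests on 1-2s > -1 and 2s-1 > -1, at infinity on the decay of the multipliers. -/
lemma exists_lintegral_energyMul_le (hs0 : 0 < s) (hs1 : s < 1) :
    ∃ C : ℝ, 0 ≤ C ∧ ∀ z : ℂ, 0 < z.re →
      ∫⁻ y in Ioi (0 : ℝ), ENNReal.ofReal (energyMul s y z) ≤ ENNReal.ofReal (C * ‖z‖ ^ s) := by
  obtain ⟨A, hA, HA⟩ := exists_norm_traceMul_le hs0
  obtain ⟨B, hB, HB⟩ := exists_norm_neumannMul_le hs0 hs1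
  obtain ⟨D, hD, HD⟩ := exists_norm_neumannMul_le_div hs0
  -- The four terms come from integrating y^{1-2s} and y^{2s-1} below Y, and y^{-3-2s} and y^{-5-2s}
  -- above Y.
  refine ⟨1 / (2 - 2 * s) + B ^ 2 / (2 * s) + A ^ 2 / (2 + 2 * s) + D ^ 2 / (4 + 2 * s), ?_,
    fun z hz => ?_⟩
  · have : 0 < 2 - 2 * s := by linarith
    positivity
  have hr : 0 < ‖z‖ := norm_pos_iff.2 fun h => by simp [h] at hz
  set r := ‖z‖
  have hY : 0 < r ^ (-1 / 2 : ℝ) := by positivity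
  -- The splitting height is where y²|z| = 1.
  set Y := r ^ (-1 / 2 : ℝ)
  have hYp : ∀ {a b : ℝ}, b - a / 2 = s → r ^ b * Y ^ a = r ^ s := by
    intro a b h
    rw [← Real.rpow_mul hr.le, ← Real.rpow_add hr]
    congr 1
    linarith
  have near : ∀ y ∈ Ioc 0 Y, ENNReal.ofReal (energyMul s y z)
      ≤ ENNReal.ofReal (r ^ (1 : ℝ) * y ^ (1 - 2 * s))
        + ENNReal.ofReal (B ^ 2 * r ^ (2 * s) * y ^ (2 * s - 1)) := by
    intro y hy
    have hy0 : 0 < y := hy.1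
    rw [← ENNReal.ofReal_add (by positivity) (by positivity)]
    refine ENNReal.ofReal_le_ofReal ?_
    have e : y ^ (1 - 2 * s) * (y ^ (2 * s - 1)) ^ 2 = y ^ (2 * s - 1) := by
      rw [← Real.rpow_natCast (y ^ (2 * s - 1)), ← Real.rpow_mul hy0.le, ← Real.rpow_add hy0]
      congr 1
      push_cast
      ring
    have e2 : (r ^ s) ^ 2 = r ^ (2 * s) := by
      rw [← Real.rpow_natCast, ← Real.rpow_mul hr.le, mul_comm]
      norm_num
    calc energyMul s y z
        ≤ y ^ (1 - 2 * s) * (r * 1 ^ 2 + (B * (y ^ (2 * s - 1) * r ^ s)) ^ 2) := by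
          unfold energyMul
          gcongr
          · exact norm_traceMul_le_one hs0 hy0 hz.le
          · exact HB y hy0 z hz
      _ = r * y ^ (1 - 2 * s)
          + B ^ 2 * (r ^ s) ^ 2 * (y ^ (1 - 2 * s) * (y ^ (2 * s - 1)) ^ 2) := by ring
      _ = _ := by rw [e, e2, Real.rpow_one]
  have far : ∀ y ∈ Ioi Y, ENNReal.ofReal (energyMul s y z)
      ≤ ENNReal.ofReal (A ^ 2 * r ^ (-1 : ℝ) * y ^ (-3 - 2 * s))
        + ENNReal.ofReal (D ^ 2 * r ^ (-2 : ℝ) * y ^ (-5 - 2 * s)) := by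
    intro y hy
    have hy0 : 0 < y := hY.trans hy
    rw [← ENNReal.ofReal_add (by positivity) (by positivity)]
    refine ENNReal.ofReal_le_ofReal ?_
    have e1 : y ^ (-3 - 2 * s) = y ^ (1 - 2 * s) / y ^ 4 := by
      rw [show -3 - 2 * s = (1 - 2 * s) - (4 : ℕ) by push_cast; ring, Real.rpow_sub_natCast hy0.ne']
    have e2 : y ^ (-5 - 2 * s) = y ^ (1 - 2 * s) / y ^ 6 := by
      rw [show -5 - 2 * s = (1 - 2 * s) - (6 : ℕ) by push_cast; ring, Real.rpow_sub_natCast hy0.ne']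
    have e3 : r ^ (-2 : ℝ) = (r ^ 2)⁻¹ := by
      rw [Real.rpow_neg hr.le, Real.rpow_two]
    calc energyMul s y z
        ≤ y ^ (1 - 2 * s) * (r * (A / (y ^ 2 * r)) ^ 2 + (D / (y ^ 3 * r)) ^ 2) := by
          unfold energyMul
          gcongr
          · exact HA y hy0 z hz
          · exact HD y hy0 z hz
      _ = _ := by
          rw [e1, e2, e3, Real.rpow_neg_one]
          field_simp
  rw [← Ioc_union_Ioi_eq_Ioi hY.le]
  refine (lintegral_union_le _ _ _).trans ?_
  refine (add_le_add (setLIntegral_mono' measurableSet_Ioc near)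
    (setLIntegral_mono' measurableSet_Ioi far)).trans ?_
  have hm : ∀ (m : Measure ℝ) (c a : ℝ), AEMeasurable (fun y : ℝ => ENNReal.ofReal (c * y ^ a)) m :=
    fun m c a => Measurable.aemeasurable (by fun_prop)
  have hs2 : 0 < 2 - 2 * s := by linarith
  rw [lintegral_add_left' (hm _ _ _), lintegral_add_left' (hm _ _ _),
    lintegral_Ioc_const_mul_rpow (by linarith) (by positivity) hY,
    lintegral_Ioc_const_mul_rpow (by linarith) (by positivity) hY,
    lintegral_Ioi_const_mul_rpow (by linarith) (by positivity) hY,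
    lintegral_Ioi_const_mul_rpow (by linarith) (by positivity) hY]
  have p1 : 0 < 1 - 2 * s + 1 := by linarith
  have p2 : 0 < 2 * s - 1 + 1 := by linarith
  have p3 : 0 < -(-3 - 2 * s + 1) := by linarith
  have p4 : 0 < -(-5 - 2 * s + 1) := by linarith
  rw [← ENNReal.ofReal_add (by positivity) (by positivity),
    ← ENNReal.ofReal_add (by positivity) (by positivity),
    ← ENNReal.ofReal_add (by positivity) (by positivity)]
  refine ENNReal.ofReal_le_ofReal (le_of_eq ?_)
  have q1 := hYp (a := 1 - 2 * s + 1) (b := 1) (by ring)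
  have q2 := hYp (a := 2 * s - 1 + 1) (b := 2 * s) (by ring)
  have q3 := hYp (a := -3 - 2 * s + 1) (b := -1) (by ring)
  have q4 := hYp (a := -5 - 2 * s + 1) (b := -2) (by ring)
  calc _ = r ^ (1 : ℝ) * Y ^ (1 - 2 * s + 1) / (1 - 2 * s + 1)
        + B ^ 2 * (r ^ (2 * s) * Y ^ (2 * s - 1 + 1)) / (2 * s - 1 + 1)
        + (A ^ 2 * (r ^ (-1 : ℝ) * Y ^ (-3 - 2 * s + 1)) / (-(-3 - 2 * s + 1))
        + D ^ 2 * (r ^ (-2 : ℝ) * Y ^ (-5 - 2 * s + 1)) / (-(-5 - 2 * s + 1))) := by ring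
    _ = _ := by
      rw [q1, q2, q3, q4, show 1 - 2 * s + 1 = 2 - 2 * s by ring,
        show 2 * s - 1 + 1 = 2 * s by ring, show -(-3 - 2 * s + 1) = 2 + 2 * s by ring,
        show -(-5 - 2 * s + 1) = 4 + 2 * s by ring]
      ring

end Scalar

section

variable {μ lam s : ℝ} {u : SpaceTime n → Val n}

lemma norm_lameMul_sq_le (φ : ℂ → ℂ) (u : SpaceTime n → Val n) (ζ : SpaceTime n) :
    ‖lameMul μ lam φ u ζ‖ ^ 2
      ≤ 8 * (‖φ (parSymbol μ ζ)‖ ^ 2 + ‖φ (parSymbol (2 * μ + lam) ζ)‖ ^ 2) *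
        ‖fourierL2 u ζ‖ ^ 2 := by
  set a := ‖φ (parSymbol μ ζ)‖
  set b := ‖φ (parSymbol (2 * μ + lam) ζ)‖
  have ha : 0 ≤ a := norm_nonneg _
  have hb : 0 ≤ b := norm_nonneg _
  have h : ‖lameMul μ lam φ u ζ‖ ≤ (2 * a + b) * ‖fourierL2 u ζ‖ := by
    refine (norm_add_le _ _).trans ?_
    rw [norm_smul, norm_smul]
    calc _ ≤ a * (2 * ‖fourierL2 u ζ‖) + b * ‖fourierL2 u ζ‖ := by
          gcongr
          · exact norm_transPart_le u ζ
          · exact norm_longPart_le u ζ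
      _ = _ := by ring
  calc _ ≤ ((2 * a + b) * ‖fourierL2 u ζ‖) ^ 2 := by gcongr
    _ = (2 * a + b) ^ 2 * ‖fourierL2 u ζ‖ ^ 2 := by ring
    _ ≤ _ := by
      gcongr
      nlinarith [sq_nonneg (2 * a - b), sq_nonneg b]

/-- Plancherel at each height and |m_y| ≤ 1 bound a slice by 16 y^{1-2s} times the square of the L²
norm, where 16 = 8·(1 + 1) from `norm_lameMul_sq_le`. -/
lemma lintegral_extension_sq_le (hn : 1 ≤ n) (hμ : 0 < μ) (hlam : 0 < 2 * μ + lam)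
    (hs0 : 0 < s) (hs1 : s < 1) (hu : MemLp u 2 volume) {M : ℝ} (hM : 0 < M) :
    ∫⁻ y in Ioo 0 M, ∫⁻ p : SpaceTime n,
        ENNReal.ofReal (y ^ (1 - 2 * s)) * ‖extension μ lam s u p.fst y p.snd‖ₑ ^ 2
      ≤ ENNReal.ofReal (16 / (2 - 2 * s)) * ENNReal.ofReal (M ^ (1 + (1 - 2 * s))) *
        eLpNorm u 2 volume ^ 2 := by
  have hslice : ∀ y ∈ Ioo 0 M, ∫⁻ p : SpaceTime n,
      ENNReal.ofReal (y ^ (1 - 2 * s)) * ‖extension μ lam s u p.fst y p.snd‖ₑ ^ 2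
      ≤ ENNReal.ofReal (16 * y ^ (1 - 2 * s)) * eLpNorm u 2 volume ^ 2 := by
    intro y hy
    have hy0 : 0 < y := hy.1
    have e : ∀ p : SpaceTime n, extension μ lam s u p.fst y p.snd
        = 𝓕⁻ (lameMul μ lam (traceMul s y) u) p :=
      fun p => congrFun (extension_slice hn hμ hlam hs0 hy0 hu) p
    simp only [e]
    rw [lintegral_const_mul' _ _ ENNReal.ofReal_ne_top, lintegral_enorm_fourierInv_sq
      (integrable_traceMul hn hμ hlam hs0 hy0 u) (memLp_traceMul hn hμ hlam hs0 hy0 u),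
      mul_comm 16, ENNReal.ofReal_mul (by positivity), mul_assoc, ← lintegral_enorm_fourierL2_sq hu,
      ← lintegral_const_mul' (ENNReal.ofReal 16) _ ENNReal.ofReal_ne_top]
    refine mul_le_mul_right (lintegral_mono_ae ?_) _
    filter_upwards [ae_parSymbol_re_pos hn hμ, ae_parSymbol_re_pos hn hlam] with ζ a b
    rw [← ofReal_norm, ← ofReal_norm, ← ENNReal.ofReal_pow (norm_nonneg _),
      ← ENNReal.ofReal_pow (norm_nonneg _), ← ENNReal.ofReal_mul (by norm_num)]
    refine ENNReal.ofReal_le_ofReal ((norm_lameMul_sq_le _ u ζ).trans ?_)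
    have h1 := norm_traceMul_le_one hs0 hy0 a.le
    have h2 := norm_traceMul_le_one hs0 hy0 b.le
    have h3 := pow_le_one₀ (n := 2) (norm_nonneg _) h1
    have h4 := pow_le_one₀ (n := 2) (norm_nonneg _) h2
    gcongr
    linarith
  refine (setLIntegral_mono' measurableSet_Ioo hslice).trans ?_
  rw [lintegral_mul_const _ (by fun_prop)]
  gcongr
  refine (lintegral_mono_set Ioo_subset_Ioc_self).trans (le_of_eq ?_)
  rw [lintegral_Ioc_const_mul_rpow (by linarith) (by norm_num) hM, ← ENNReal.ofReal_mul
    (div_nonneg (by norm_num) (by linarith))]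
  rw [show 1 - 2 * s + 1 = 2 - 2 * s by ring, show 1 + (1 - 2 * s) = 2 - 2 * s by ring]
  congr 1
  ring

/-- The energy at height `y` and frequency `ζ` is controlled by the scalar energy densities. -/
lemma energy_density_le (hμ : 0 < μ) (hlam : 0 < 2 * μ + lam) {y : ℝ} (hy : 0 < y)
    (u : SpaceTime n → Val n) (ζ : SpaceTime n) :
    y ^ (1 - 2 * s) * (‖(2 * Real.pi) • ζ.fst‖ ^ 2 * ‖lameMul μ lam (traceMul s y) u ζ‖ ^ 2
        + ‖lameMul μ lam (neumannMul s y) u ζ‖ ^ 2)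
      ≤ 8 * (1 / μ + 1 / (2 * μ + lam) + 1) *
        (energyMul s y (parSymbol μ ζ) + energyMul s y (parSymbol (2 * μ + lam) ζ)) *
        ‖fourierL2 u ζ‖ ^ 2 := by
  -- Since κ|2πξ|² is the real part of the symbol, the tangential derivatives are controlled by
  -- |z|/κ.
  have hx : ∀ {κ : ℝ}, 0 < κ → ‖(2 * Real.pi) • ζ.fst‖ ^ 2 ≤ 1 / κ * ‖parSymbol κ ζ‖ := by
    intro κ hκ
    have h := (le_abs_self _).trans (Complex.abs_re_le_norm (parSymbol κ ζ))
    rw [parSymbol_re] at h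
    rw [one_div, inv_mul_eq_div, le_div_iff₀ hκ]
    linarith
  have h1 := norm_lameMul_sq_le (μ := μ) (lam := lam) (traceMul s y) u ζ
  have h2 := norm_lameMul_sq_le (μ := μ) (lam := lam) (neumannMul s y) u ζ
  have x1 := hx hμ
  have x2 := hx hlam
  unfold energyMul
  set X := ‖(2 * Real.pi) • ζ.fst‖ ^ 2
  set r₁ := ‖parSymbol μ ζ‖
  set r₂ := ‖parSymbol (2 * μ + lam) ζ‖
  set a₁ := ‖traceMul s y (parSymbol μ ζ)‖ ^ 2
  set a₂ := ‖traceMul s y (parSymbol (2 * μ + lam) ζ)‖ ^ 2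
  set b₁ := ‖neumannMul s y (parSymbol μ ζ)‖ ^ 2
  set b₂ := ‖neumannMul s y (parSymbol (2 * μ + lam) ζ)‖ ^ 2
  set w := ‖fourierL2 u ζ‖ ^ 2
  have hX : 0 ≤ X := sq_nonneg _
  have ha₁ : 0 ≤ a₁ := sq_nonneg _
  have ha₂ : 0 ≤ a₂ := sq_nonneg _
  have hb₁ : 0 ≤ b₁ := sq_nonneg _
  have hb₂ : 0 ≤ b₂ := sq_nonneg _
  have hr₁ : 0 ≤ r₁ := norm_nonneg _
  have hr₂ : 0 ≤ r₂ := norm_nonneg _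
  set k₁ := 1 / μ
  set k₂ := 1 / (2 * μ + lam)
  have hk₁ : 0 ≤ k₁ := by positivity
  have hk₂ : 0 ≤ k₂ := by positivity
  calc _ ≤ y ^ (1 - 2 * s) * (X * (8 * (a₁ + a₂) * w) + 8 * (b₁ + b₂) * w) := by gcongr
    _ = y ^ (1 - 2 * s) * (8 * (X * a₁ + X * a₂ + (b₁ + b₂)) * w) := by ring
    _ ≤ y ^ (1 - 2 * s) * (8 * ((k₁ + k₂ + 1) * (r₁ * a₁ + b₁ + (r₂ * a₂ + b₂))) * w) := by
        gcongr
        have i1 : X * a₁ ≤ k₁ * r₁ * a₁ := by gcongr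
        have i2 : X * a₂ ≤ k₂ * r₂ * a₂ := by gcongr
        have j1 : 0 ≤ r₁ * a₁ := by positivity
        have j2 : 0 ≤ r₂ * a₂ := by positivity
        nlinarith [mul_nonneg hk₁ j2, mul_nonneg hk₂ j1, mul_nonneg hk₁ hb₁, mul_nonneg hk₁ hb₂,
          mul_nonneg hk₂ hb₁, mul_nonneg hk₂ hb₂]
    _ = _ := by ring

lemma sum_enorm_partialMul_sq (h : SpaceTime n → Val n) (ζ : SpaceTime n) :
    ∑ i, ‖partialMul i h ζ‖ₑ ^ 2
      = ENNReal.ofReal (‖(2 * Real.pi) • ζ.fst‖ ^ 2 * ‖h ζ‖ ^ 2) := by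
  have e : ∀ i, ‖partialMul i h ζ‖ₑ ^ 2
      = ENNReal.ofReal ((2 * Real.pi) ^ 2 * ζ.fst i ^ 2 * ‖h ζ‖ ^ 2) := by
    intro i
    rw [← ofReal_norm, ← ENNReal.ofReal_pow (norm_nonneg _), partialMul_apply, norm_smul, norm_mul,
      norm_mul, norm_mul, Complex.norm_I, Complex.norm_real, Complex.norm_real, Complex.norm_ofNat,
      Real.norm_of_nonneg Real.pi_pos.le, mul_one, mul_pow, mul_pow, Real.norm_eq_abs, sq_abs]
  simp only [e]
  rw [← ENNReal.ofReal_sum_of_nonneg fun i _ => by positivity, ← Finset.sum_mul, ← Finset.mul_sum,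
    ← EuclideanSpace.real_norm_sq_eq, norm_two_pi_smul_sq]

/-- Plancherel's identity for the gradient of the extension at height `y`. -/
lemma lintegral_gradSq_slice (hn : 1 ≤ n) (hμ : 0 < μ) (hlam : 0 < 2 * μ + lam) (hs : 0 < s)
    {y : ℝ} (hy : 0 < y) (hu : MemLp u 2 volume) :
    ∫⁻ p : SpaceTime n, ENNReal.ofReal (y ^ (1 - 2 * s)) *
        gradSq (extension μ lam s u) p.fst y p.snd
      = ∫⁻ ζ : SpaceTime n, ENNReal.ofReal (y ^ (1 - 2 * s) *
        (‖(2 * Real.pi) • ζ.fst‖ ^ 2 * ‖lameMul μ lam (traceMul s y) u ζ‖ ^ 2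
          + ‖lameMul μ lam (neumannMul s y) u ζ‖ ^ 2)) := by
  have ix := fun i : Fin n => integrable_partialMul_traceMul hn hμ hlam hs hy u i
  have mx := fun i : Fin n => memLp_partialMul_traceMul hn hμ hlam hs hy u i
  have iy := integrable_neumannMul hn hμ hlam hs hy u
  have my := memLp_neumannMul hn hμ hlam hs hy u
  have ex : ∀ (i : Fin n) (p : SpaceTime n), fderiv ℝ (fun x' => extension μ lam s u x' y p.snd)
      p.fst (EuclideanSpace.single i 1) = 𝓕⁻ (partialMul i (lameMul μ lam (traceMul s y) u)) p :=
    fun i p => congrFun (fderiv_extension_slice hn hμ hlam hs hy hu i) p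
  have ey : ∀ p : SpaceTime n, deriv (fun y' => extension μ lam s u p.fst y' p.snd) y
      = 𝓕⁻ (lameMul μ lam (neumannMul s y) u) p :=
    fun p => congrFun (deriv_extension_slice hn hμ hlam hs hy hu) p
  simp only [gradSq, ex, ey]
  have hmeas : ∀ {g : SpaceTime n → Val n}, AEStronglyMeasurable g volume →
      AEMeasurable (fun p => ‖g p‖ₑ ^ 2) volume := fun hg => hg.enorm.pow_const 2
  rw [lintegral_const_mul' _ _ ENNReal.ofReal_ne_top,
    lintegral_add_right' _ (hmeas (continuous_fourierInv iy).aestronglyMeasurable),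
    lintegral_finsetSum' _ fun i _ => hmeas (continuous_fourierInv (ix i)).aestronglyMeasurable,
    lintegral_enorm_fourierInv_sq iy my,
    Finset.sum_congr rfl fun i _ => lintegral_enorm_fourierInv_sq (ix i) (mx i),
    ← lintegral_finsetSum' _ fun i _ => hmeas (mx i).1, ← lintegral_add_right' _ (hmeas my.1),
    ← lintegral_const_mul' _ _ ENNReal.ofReal_ne_top]
  refine lintegral_congr fun ζ => ?_
  rw [sum_enorm_partialMul_sq, ← ofReal_norm, ← ENNReal.ofReal_pow (norm_nonneg _),
    ← ENNReal.ofReal_add (by positivity) (by positivity), ← ENNReal.ofReal_mul (by positivity)]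

/-- Plancherel in each slice, then Tonelli so that the height is integrated first at fixed
frequency. The scalar energy estimate yields |z|^s for both eigenvalues, which the Sobolev weight
dominates. -/
lemma exists_lintegral_gradSq_le (hn : 1 ≤ n) (hμ : 0 < μ) (hlam : 0 < 2 * μ + lam)
    (hs0 : 0 < s) (hs1 : s < 1) :
    ∃ C : ℝ, 0 ≤ C ∧ ∀ u : SpaceTime n → Val n, MemLp u 2 volume →
      ∫⁻ y in Ioi (0 : ℝ), ∫⁻ p : SpaceTime n, ENNReal.ofReal (y ^ (1 - 2 * s)) *
          gradSq (extension μ lam s u) p.fst y p.snd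
        ≤ ENNReal.ofReal C * sobolevNorm s (toDist u) ^ 2 := by
  obtain ⟨E, hE, HE⟩ := exists_lintegral_energyMul_le hs0 hs1
  obtain ⟨K₁, hK₁, H₁⟩ := exists_norm_parSymbol_rpow_le (n := n) hμ hs0
  obtain ⟨K₂, hK₂, H₂⟩ := exists_norm_parSymbol_rpow_le (n := n) hlam hs0
  set A := 8 * (1 / μ + 1 / (2 * μ + lam) + 1) with hA
  have hA0 : 0 ≤ A := by positivity
  refine ⟨A * (E * (K₁ + K₂)), by positivity, fun u hu => ?_⟩
  set G : ℝ → SpaceTime n → ℝ≥0∞ := fun y ζ => ENNReal.ofReal A *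
    ((ENNReal.ofReal (energyMul s y (parSymbol μ ζ))
      + ENNReal.ofReal (energyMul s y (parSymbol (2 * μ + lam) ζ))) * ‖fourierL2 u ζ‖ₑ ^ 2) with hG
  have hen : ∀ {y : ℝ}, 0 < y → ∀ z : ℂ, 0 ≤ energyMul s y z := by
    intro y hy z
    unfold energyMul
    positivity
  have h1 : ∀ y ∈ Ioi (0 : ℝ), ∫⁻ p : SpaceTime n, ENNReal.ofReal (y ^ (1 - 2 * s)) *
      gradSq (extension μ lam s u) p.fst y p.snd ≤ ∫⁻ ζ, G y ζ := by
    intro y hy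
    rw [lintegral_gradSq_slice hn hμ hlam hs0 hy hu]
    refine lintegral_mono fun ζ => ?_
    simp only [hG]
    rw [← ENNReal.ofReal_add (hen hy _) (hen hy _), ← ofReal_norm,
      ← ENNReal.ofReal_pow (norm_nonneg _), ← ENNReal.ofReal_mul (add_nonneg (hen hy _) (hen hy _)),
      ← ENNReal.ofReal_mul hA0, ← mul_assoc]
    exact ENNReal.ofReal_le_ofReal (energy_density_le hμ hlam hy u ζ)
  refine (setLIntegral_mono' measurableSet_Ioi h1).trans ?_
  have hmeas : ∀ κ : ℝ, Measurable fun q : ℝ × SpaceTime n =>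
      ENNReal.ofReal (energyMul s q.1 (parSymbol κ q.2)) := fun κ =>
    ((measurable_energyMul_uncurry s).comp (measurable_fst.prodMk
      ((continuous_parSymbol κ).measurable.comp measurable_snd))).ennreal_ofReal
  have hGm : AEMeasurable (Function.uncurry G)
      ((volume.restrict (Ioi (0 : ℝ))).prod (volume : Measure (SpaceTime n))) :=
    (((hmeas μ).add (hmeas (2 * μ + lam))).aemeasurable.mul
      ((memLp_fourierL2 u).1.enorm.pow_const 2).comp_snd).const_mul _
  rw [lintegral_lintegral_swap hGm, (hasFourierDensity_toDist hu).sobolevNorm_sq,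
    ← lintegral_const_mul' _ _ ENNReal.ofReal_ne_top]
  refine lintegral_mono_ae ?_
  filter_upwards [ae_parSymbol_re_pos hn hμ, ae_parSymbol_re_pos hn hlam] with ζ a b
  have hmy : ∀ z : ℂ, Measurable fun y : ℝ => ENNReal.ofReal (energyMul s y z) := fun z =>
    ((measurable_energyMul_uncurry s).comp (measurable_id.prodMk measurable_const)).ennreal_ofReal
  have hadd : Measurable fun y : ℝ => ENNReal.ofReal (energyMul s y (parSymbol μ ζ))
      + ENNReal.ofReal (energyMul s y (parSymbol (2 * μ + lam) ζ)) := (hmy _).add (hmy _)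
  simp only [hG]
  rw [lintegral_const_mul' _ _ ENNReal.ofReal_ne_top, lintegral_mul_const _ hadd, lintegral_add_left (hmy _),
    ENNReal.ofReal_mul hA0, mul_assoc, ← mul_assoc (ENNReal.ofReal (E * (K₁ + K₂)))]
  refine mul_le_mul_right (mul_le_mul_left ((add_le_add (HE _ a) (HE _ b)).trans ?_) _) _
  have hw : 0 ≤ weight ζ ^ (s / 2) := Real.rpow_nonneg (zero_le_one.trans (one_le_weight ζ)) _
  rw [← ENNReal.ofReal_add (by positivity) (by positivity), ← ENNReal.ofReal_mul (by positivity)]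
  refine ENNReal.ofReal_le_ofReal ?_
  nlinarith [mul_le_mul_of_nonneg_left (H₁ ζ) hE, mul_le_mul_of_nonneg_left (H₂ ζ) hE]

end

end Lame

end

theorem theorem1p1 (n : ℕ) (hn : 1 ≤ n) (s : ℝ) (hs0 : 0 < s) (hs1 : s < 1)
    (δ₀ μ lam : ℝ) (hδ₀ : 0 < δ₀) (hμ : δ₀ ≤ μ) (hlam : δ₀ ≤ 2 * μ + lam) :
    ∃ C : ℝ≥0, ∀ u : Lame.SpaceTime n → Lame.Val n, Lame.MemH s u →
      -- the integral defining the extension converges absolutely at every point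
      (∀ (x : Lame.Space n) (y t : ℝ), 0 < y →
        Integrable (Function.uncurry (Lame.poissonIntegrand μ lam s u x y t))
          ((volume.restrict (Ioi (0 : ℝ))).prod volume)) ∧
      -- the equation
      Lame.SolvesExtensionEquation μ lam s (Lame.extension μ lam s u) ∧
      -- the trace
      (∀ y : ℝ, 0 < y →
        Lame.MemH s (fun p => Lame.extension μ lam s u p.fst y p.snd)) ∧
      Tendsto (fun y : ℝ => Lame.sobolevNorm s
          (Lame.toDist (fun p => Lame.extension μ lam s u p.fst y p.snd) - Lame.toDist u))
        (𝓝[>] 0) (𝓝 0) ∧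
      -- the weighted Neumann derivative
      (∀ y : ℝ, 0 < y →
        MemLp (fun p : Lame.SpaceTime n =>
          deriv (fun y' => Lame.extension μ lam s u p.fst y' p.snd) y) 2 volume) ∧
      (∃ T : 𝓢'(Lame.SpaceTime n, Lame.Val n),
        Lame.IsFracPower μ lam s u T ∧ Lame.sobolevNorm (-s) T < ⊤ ∧
        Tendsto (fun y : ℝ => Lame.sobolevNorm (-s)
            (Lame.toDist (fun p => ((2 : ℝ) ^ (2 * s - 1) * Real.Gamma s / Real.Gamma (1 - s) *
                y ^ (1 - 2 * s)) •
              deriv (fun y' => Lame.extension μ lam s u p.fst y' p.snd) y) + T))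
          (𝓝[>] 0) (𝓝 0)) ∧
      -- the energy bounds
      (∀ M : ℝ, 0 < M →
        ∫⁻ y in Ioo 0 M, ∫⁻ p : Lame.SpaceTime n,
            ENNReal.ofReal (y ^ (1 - 2 * s)) * ‖Lame.extension μ lam s u p.fst y p.snd‖ₑ ^ 2
          ≤ C * ENNReal.ofReal (M ^ (1 + (1 - 2 * s))) * eLpNorm u 2 volume ^ 2) ∧
      ∫⁻ y in Ioi (0 : ℝ), ∫⁻ p : Lame.SpaceTime n,
          ENNReal.ofReal (y ^ (1 - 2 * s)) *
            Lame.gradSq (Lame.extension μ lam s u) p.fst y p.snd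
        ≤ C * Lame.sobolevNorm s (Lame.toDist u) ^ 2 := by
  have hμ0 : 0 < μ := hδ₀.trans_le hμ
  have hlam0 : 0 < 2 * μ + lam := hδ₀.trans_le hlam
  obtain ⟨C, hC, hE⟩ := Lame.exists_lintegral_gradSq_le (n := n) hn hμ0 hlam0 hs0 hs1
  have hs2 : 0 < 2 - 2 * s := by linarith
  -- One constant for both energy bounds: the sum of their two constants.
  refine ⟨(16 / (2 - 2 * s) + C).toNNReal, fun u hu => ⟨?_, ?_, ?_, ?_, ?_, ?_, ?_, ?_⟩⟩
  · exact fun x y t hy => (Lame.poisson_representation hn hμ0 hlam0 hs0 hy hu.1 x t).1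
  · exact Lame.solvesExtensionEquation hn hμ0 hlam0 hs0 hu.1
  · exact fun y hy => Lame.memH_extension hn hμ0 hlam0 hs0 hy hu
  · exact Lame.tendsto_extension hn hμ0 hlam0 hs0 hu
  · exact fun y hy => Lame.memLp_deriv_extension hn hμ0 hlam0 hs0 hy hu.1
  · obtain ⟨T, hT⟩ := Lame.exists_isFracPower hμ0 hlam0 hs0 hs1 u
    exact ⟨T, hT, Lame.sobolevNorm_fracPower_lt_top hn hμ0 hlam0 hs0 hu hT,
      Lame.tendsto_neumann hn hμ0 hlam0 hs0 hs1 hu hT⟩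
  · intro M hM
    refine (Lame.lintegral_extension_sq_le hn hμ0 hlam0 hs0 hs1 hu.1 hM).trans ?_
    gcongr
    exact ENNReal.ofReal_le_ofReal (by linarith)
  · refine (hE u hu.1).trans ?_
    gcongr
    exact ENNReal.ofReal_le_ofReal (le_add_of_nonneg_left (by positivity))
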